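/- Let $\Delta$ be a fan in $N_{\mathbb{R}}$, where $N \cong \mathbb{Z}^2$, such that the toric surface $X = X(\Delta)$ is smooth and projective, let $T$ be its torus, and let $X(\mathbb{R})$ be its set of real points with the real analytic topology. Let $C \subset X$ be a $T$-invariant curve, that is, an irreducible closed $T$-stable subvariety of dimension one, let $C(\mathbb{R}) \subset X(\mathbb{R})$ be its set of real points, and let $C^2 \in \mathbb{Z}$ be its self-intersection number. Let $U$ be a tubular neighborhood of $C(\mathbb{R})$ in $X(\mathbb{R})$, that is, an open subset $U \subset X(\mathbb{R})$ for which there are a real line bundle $E \to C(\mathbb{R})$ and a homeomorphism from the total space of $E$ onto $U$ that restricts to the inclusion of $C(\mathbb{R})$ on the zero section. If $C^2$ is even, then $U$ is homeomorphic to the cylinder $S^1 \times (0,1)$; if $C^2$ is odd, then $U$ is homeomorphic to the (open) Möbius band, the quotient of $[0,1] \times (0,1)$ by $(0,y) \sim (1,1-y)$. -/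

import Mathlib

noncomputable section

namespace Toric

/-! ### Fans

The lattice is `N = ℤⁿ`, with `N_ℝ = ℝⁿ`, and the dual lattice is `M = ℤⁿ`, paired with `N_ℝ` by the
dot product. -/

/-- The pairing of `m ∈ M = ℤⁿ` with `v ∈ N_ℝ = ℝⁿ`. -/
def pairing {n : ℕ} (m : Fin n → ℤ) (v : Fin n → ℝ) : ℝ := ∑ i, (m i : ℝ) * v i

/-- The inclusion of `N = ℤⁿ` in `N_ℝ = ℝⁿ`. -/
def latticeVec {n : ℕ} (v : Fin n → ℤ) : Fin n → ℝ := fun i => (v i : ℝ)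

/-- A fan: a finite set of strongly convex rational polyhedral cones in `N_ℝ`, closed under passing
to faces, any two of which meet in a common face. -/
structure Fan (n : ℕ) where
  cones : Set (PointedCone ℝ (Fin n → ℝ))
  finite : cones.Finite
  rational : ∀ σ ∈ cones, ∃ s : Finset (Fin n → ℤ),
    σ = PointedCone.hull ℝ (latticeVec '' (s : Set (Fin n → ℤ)))
  salient : ∀ σ ∈ cones, (σ : ConvexCone ℝ (Fin n → ℝ)).Salient
  face_mem : ∀ σ ∈ cones, ∀ τ : PointedCone ℝ (Fin n → ℝ), τ.IsFaceOf σ → τ ∈ cones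
  inf_face : ∀ σ ∈ cones, ∀ τ ∈ cones, (σ ⊓ τ).IsFaceOf σ

namespace Fan

variable {n : ℕ}

/-- The toric variety of `Δ` is smooth: every cone is generated by part of a basis of `N`. -/
def IsSmooth (Δ : Fan n) : Prop :=
  ∀ σ ∈ Δ.cones, ∃ (b : Module.Basis (Fin n) ℤ (Fin n → ℤ)) (s : Set (Fin n)),
    σ = PointedCone.hull ℝ ((fun i => latticeVec (b i)) '' s)

/-- The toric variety of `Δ` is projective: the cones cover `N_ℝ`, and there is a strictly convex
support function, that is, a family of integral linear functions `ℓ σ`, for `σ` a maximal cone, such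
that for `v` in a maximal cone `τ` the minimum of the numbers `⟨ℓ σ, v⟩` is `⟨ℓ τ, v⟩`, attained
exactly for those `σ` that contain `v`. -/
structure IsProjective (Δ : Fan n) : Prop where
  complete : ∀ v : Fin n → ℝ, ∃ σ ∈ Δ.cones, v ∈ σ
  strictlyConvex : ∃ ℓ : PointedCone ℝ (Fin n → ℝ) → (Fin n → ℤ),
    ∀ σ τ, Maximal (· ∈ Δ.cones) σ → Maximal (· ∈ Δ.cones) τ → ∀ v ∈ τ,
      pairing (ℓ τ) v ≤ pairing (ℓ σ) v ∧ (pairing (ℓ τ) v = pairing (ℓ σ) v ↔ v ∈ σ)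

end Fan

/-! ### The points of the toric variety of a fan -/

/-- The semigroup `S_σ = σ^∨ ∩ M`. -/
def dualMonoid {n : ℕ} (σ : PointedCone ℝ (Fin n → ℝ)) : AddSubmonoid (Fin n → ℤ) where
  carrier := {m | ∀ v ∈ σ, 0 ≤ pairing m v}
  zero_mem' := by intro v _; simp [pairing]
  add_mem' := by
    intro a b ha hb v hv
    have h : pairing (a + b) v = pairing a v + pairing b v := by
      simp [pairing, add_mul, Finset.sum_add_distrib]
    rw [h]
    exact add_nonneg (ha v hv) (hb v hv)

/-- The coordinate ring `k[S_σ]` of the affine chart `U_σ`. -/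
abbrev CoordRing {n : ℕ} (σ : PointedCone ℝ (Fin n → ℝ)) (k : Type) [Field k] : Type :=
  AddMonoidAlgebra k (dualMonoid σ)

/-- The `k`-points of the affine chart `U_σ = Spec k[S_σ]`, as semigroup homomorphisms from `S_σ` to
the multiplicative monoid of `k`; these are the same as `k`-algebra homomorphisms `k[S_σ] → k`, see
`AffPoints.eval`. -/
structure AffPoints {n : ℕ} (σ : PointedCone ℝ (Fin n → ℝ)) (k : Type) [Field k] : Type where
  hom : Multiplicative (dualMonoid σ) →* k

namespace AffPoints

variable {n : ℕ} {σ : PointedCone ℝ (Fin n → ℝ)} {k : Type} [Field k]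

/-- The value of the character `χ^m`, for `m ∈ S_σ`, at a point. -/
def chi (x : AffPoints σ k) (m : dualMonoid σ) : k := x.hom (Multiplicative.ofAdd m)

/-- Evaluation of regular functions at a point. -/
def eval (x : AffPoints σ k) : CoordRing σ k →ₐ[k] k := AddMonoidAlgebra.lift k k (dualMonoid σ) x.hom

/-- Extension of scalars. -/
def baseChange {l : Type} [Field l] (f : k →+* l) (x : AffPoints σ k) : AffPoints σ l :=
  ⟨(f : k →* l).comp x.hom⟩

/-- The action of a point `t` of the torus `T(k) = Hom(M, kˣ)`: `χ^m(t • x) = χ^m(t) χ^m(x)`. -/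
def translate (t : Multiplicative (Fin n → ℤ) →* kˣ) (x : AffPoints σ k) : AffPoints σ k :=
  ⟨(Units.coeHom k).comp (t.comp (AddMonoidHom.toMultiplicative (dualMonoid σ).subtype)) * x.hom⟩

/-- The topology of pointwise convergence (the analytic topology, if `k` is `ℝ` or `ℂ`). -/
instance [TopologicalSpace k] : TopologicalSpace (AffPoints σ k) :=
  TopologicalSpace.induced (fun x m => x.chi m) Pi.topologicalSpace

end AffPoints

/-- The gluing relation: for `τ ⊆ σ`, a point of `U_τ` is identified with its image in `U_σ`, which
is its restriction to `S_σ ⊆ S_τ`. -/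
def GlueRel {n : ℕ} (Δ : Fan n) (k : Type) [Field k] (p q : Σ σ : Δ.cones, AffPoints σ.1 k) : Prop :=
  q.1.1 ≤ p.1.1 ∧ ∀ (m : Fin n → ℤ) (hp : m ∈ dualMonoid p.1.1) (hq : m ∈ dualMonoid q.1.1),
    p.2.chi ⟨m, hp⟩ = q.2.chi ⟨m, hq⟩

/-- The set `X(k)` of `k`-points of the toric variety `X = X(Δ)`, glued from the charts `U_σ(k)`. -/
def Points {n : ℕ} (Δ : Fan n) (k : Type) [Field k] : Type := Quot (GlueRel Δ k)

/-- The chart `U_σ(k) → X(k)`. -/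
def Points.mk {n : ℕ} {Δ : Fan n} {k : Type} [Field k] (σ : Δ.cones) (x : AffPoints σ.1 k) :
    Points Δ k := Quot.mk _ ⟨σ, x⟩

/-- The topology on `X(k)` glued from those of the charts; the analytic topology on `X(ℝ)`. -/
instance {n : ℕ} (Δ : Fan n) (k : Type) [Field k] [TopologicalSpace k] :
    TopologicalSpace (Points Δ k) :=
  inferInstanceAs (TopologicalSpace (Quot (GlueRel Δ k)))

/-- Extension of scalars `X(k) → X(l)`. -/
def Points.baseChange {n : ℕ} {Δ : Fan n} {k l : Type} [Field k] [Field l] (f : k →+* l) :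
    Points Δ k → Points Δ l :=
  Quot.map (fun p => ⟨p.1, p.2.baseChange f⟩)
    (fun _ _ h => ⟨h.1, fun m hp hq => congrArg f (h.2 m hp hq)⟩)

/-- The action of `T(k)` on `X(k)`. -/
def Points.translate {n : ℕ} {Δ : Fan n} {k : Type} [Field k]
    (t : Multiplicative (Fin n → ℤ) →* kˣ) : Points Δ k → Points Δ k :=
  Quot.map (fun p => ⟨p.1, p.2.translate t⟩)
    (fun _ _ h => ⟨h.1, fun m hp hq =>
      congrArg (fun c => (t (Multiplicative.ofAdd m) : k) * c) (h.2 m hp hq)⟩)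

/-! ### Invariant curves -/

/-- The Zariski topology on the `k`-points of `U_σ = Spec k[S_σ]`. -/
@[reducible]
def AffPoints.zariski {n : ℕ} (σ : PointedCone ℝ (Fin n → ℝ)) (k : Type) [Field k] :
    TopologicalSpace (AffPoints σ k) :=
  TopologicalSpace.induced
    (fun x => (⟨RingHom.ker x.eval, RingHom.ker_isPrime _⟩ : PrimeSpectrum (CoordRing σ k)))
    inferInstance

/-- The Zariski topology on `X(k)`: a set is open if its intersection with each chart is. -/
@[reducible]
def Points.zariski {n : ℕ} (Δ : Fan n) (k : Type) [Field k] : TopologicalSpace (Points Δ k) :=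
  ⨆ σ : Δ.cones, TopologicalSpace.coinduced (Points.mk σ) (AffPoints.zariski σ.1 k)

/-- A `T`-invariant curve in `X`, given by its set of complex points: an irreducible Zariski closed
subset of `X(ℂ)` of dimension one that is mapped to itself by the torus. -/
structure IsInvariantCurve {n : ℕ} (Δ : Fan n) (C : Set (Points Δ ℂ)) : Prop where
  isClosed : @IsClosed _ (Points.zariski Δ ℂ) C
  irreducible : @IsIrreducible _ (Points.zariski Δ ℂ) C
  dim_eq_one : @topologicalKrullDim C
    (TopologicalSpace.induced Subtype.val (Points.zariski Δ ℂ)) = 1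
  invariant : ∀ t, ∀ p ∈ C, Points.translate t p ∈ C

/-- The set `C(ℝ) ⊆ X(ℝ)` of real points of `C ⊆ X`. -/
def realLocus {n : ℕ} {Δ : Fan n} (C : Set (Points Δ ℂ)) : Set (Points Δ ℝ) :=
  Points.baseChange Complex.ofRealHom ⁻¹' C

/-! ### Intersection numbers on a smooth surface -/

/-- The ideal in `ℂ[S_σ]` of the functions that vanish on `C ∩ U_σ`. -/
def idealOf {n : ℕ} {Δ : Fan n} (C : Set (Points Δ ℂ)) (σ : Δ.cones) : Ideal (CoordRing σ.1 ℂ) :=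
  ⨅ x ∈ {x : AffPoints σ.1 ℂ | Points.mk σ x ∈ C}, RingHom.ker x.eval

/-- The local intersection multiplicity `dim_ℂ 𝒪_{X,p} / (I_C + I_D)` of two distinct curves at a
point `p` of a smooth surface, computed in some chart that contains `p`. -/
def localIntersection {n : ℕ} {Δ : Fan n} (C D : Set (Points Δ ℂ)) (p : Points Δ ℂ) : ℕ :=
  let q : Σ σ : Δ.cones, AffPoints σ.1 ℂ := Quot.out p
  haveI : (RingHom.ker q.2.eval).IsPrime := RingHom.ker_isPrime _
  let O := Localization.AtPrime (RingHom.ker q.2.eval)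
  Module.finrank ℂ (O ⧸ (idealOf C q.1 ⊔ idealOf D q.1).map (algebraMap (CoordRing q.1.1 ℂ) O))

/-- The intersection number `C · D` of two distinct curves on a smooth projective surface. -/
def intersectionNumber {n : ℕ} {Δ : Fan n} (C D : Set (Points Δ ℂ)) : ℕ :=
  ∑ᶠ p ∈ C ∩ D, localIntersection C D p

/-- The order of vanishing along `D` of a regular function `f ≠ 0` on a chart `U_σ` that meets `D`.
With `I` the prime ideal of `D ∩ U_σ`, it is the largest `j` such that `f` lies in the `j`-th power of
the maximal ideal of the discrete valuation ring `ℂ[S_σ]_I`. -/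
def chartOrder {n : ℕ} {Δ : Fan n} (D : Set (Points Δ ℂ)) (σ : Δ.cones) (f : CoordRing σ.1 ℂ) : ℕ :=
  sSup {j : ℕ | ∃ s, s ∉ idealOf D σ ∧ s * f ∈ idealOf D σ ^ j}

/-- `j` is the order along `D` of the rational function `χ^m = χ^{m₁} / χ^{m₂}`, computed in a chart
that meets `D` and on which `χ^{m₁}` and `χ^{m₂}` are regular. -/
def HasOrder {n : ℕ} {Δ : Fan n} (D : Set (Points Δ ℂ)) (m : Fin n → ℤ) (j : ℤ) : Prop :=
  ∃ (σ : Δ.cones) (m₁ m₂ : dualMonoid σ.1), (∃ x, Points.mk σ x ∈ D) ∧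
    m = (m₁ : Fin n → ℤ) - (m₂ : Fin n → ℤ) ∧
    j = (chartOrder D σ (AddMonoidAlgebra.single m₁ 1) : ℤ) -
      (chartOrder D σ (AddMonoidAlgebra.single m₂ 1) : ℤ)

open Classical in
/-- The order `ord_D(χ^m)` of the rational function `χ^m` along the curve `D`. -/
def order {n : ℕ} {Δ : Fan n} (D : Set (Points Δ ℂ)) (m : Fin n → ℤ) : ℤ :=
  if h : ∃ j, HasOrder D m j then h.choose else 0

open Classical in
/-- The self-intersection number `C²` of a `T`-invariant curve `C` on a smooth projective toric
surface: `C` is replaced by the linearly equivalent divisor `C + div(χ^m)`, with `m` such that `C` is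
not a component of it, and the latter is intersected with `C`. (The function `χ^m` has no zeros or
poles on `T`, so that only `T`-invariant curves `D` occur in its divisor.) -/
def selfIntersection {n : ℕ} {Δ : Fan n} (C : Set (Points Δ ℂ)) : ℤ :=
  if h : ∃ m : Fin n → ℤ, order C m = -1 then
    ∑ᶠ D ∈ {D : Set (Points Δ ℂ) | IsInvariantCurve Δ D ∧ D ≠ C},
      order D h.choose * (intersectionNumber D C : ℤ)
  else 0

/-! ### Tubular neighborhoods, the cylinder and the Möbius band -/

/-- `U` is an (open) tubular neighborhood of the curve `K` in the surface `X`: an open set with a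
homeomorphism onto `U` of the total space of a real line bundle over `K`, which is the inclusion of
`K` on the zero section. -/
def IsTubularNeighborhood {X : Type} [TopologicalSpace X] (K U : Set X) : Prop :=
  IsOpen U ∧ ∃ (E : K → Type) (_ : ∀ x, AddCommGroup (E x)) (_ : ∀ x, Module ℝ (E x))
    (_ : ∀ x, TopologicalSpace (E x)) (_ : TopologicalSpace (Bundle.TotalSpace ℝ E))
    (_ : FiberBundle ℝ E) (_ : VectorBundle ℝ ℝ E) (h : Bundle.TotalSpace ℝ E ≃ₜ U),
    ∀ x : K, (h ⟨x, 0⟩ : X) = x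

/-- The cylinder `S¹ × (0, 1)`. -/
abbrev Cylinder : Type := Circle × Set.Ioo (0 : ℝ) 1

/-- The Möbius band: `[0, 1] × (0, 1)` with `(0, y)` glued to `(1, 1 - y)`. -/
abbrev MoebiusBand : Type :=
  Quot (fun p q : Set.Icc (0 : ℝ) 1 × Set.Ioo (0 : ℝ) 1 =>
    (p.1 : ℝ) = 0 ∧ (q.1 : ℝ) = 1 ∧ (q.2 : ℝ) = 1 - p.2)

end Toric

end

/-!
Every invariant curve of a smooth complete toric surface is the divisor `D_v` of a ray `v` of the
fan: a closed invariant set contains the closure of every orbit that it meets, the orbit closures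
are the whole surface, the divisors of the rays and the finitely many fixed points, and an
irreducible set of fixed points is a point (`IsInvariantCurve.exists_eq_divisor`). Let `u`, `v`, `w`
be consecutive rays. Smoothness of the two cones at `v` gives `u + w = a v` with `a = det u w`, and
moving `D_v` by the divisor of a character of order `-1` along it shows that its self-intersection
number is `-a` (`selfIntersection_divisor`). So the parity in question is that of `a`.

The two maximal cones at `v` give two open planar charts of the real points, glued by
`(x, y) ↦ (y⁻¹, x y ^ a)`, in which the real curve consists of the axes `x = 0` and `y = 0`
(`gluedCharts`, `curve_gluedCharts`). These charts cover the curve, and nothing else about the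
surface is needed from there on.

A line bundle over the closed curve has a nowhere vanishing section along the path once around the
curve, and the section can be scaled so that its end value is `ε` times its initial value with
`ε = ±1` (`exists_section_along_loop`). Multiples of the section map the strip `[0, 1] × ℝ` properly
onto the total space, gluing only `(1, r)` to `(0, ε r)`, so that the total space is a cylinder for
`ε = 1` and a Möbius band for `ε = -1`.

It remains to see that `ε = (-1) ^ a` (`GluedCharts.IsStrip.eq_neg_one_zpow`). A thin parallel
`r = const` never meets the curve, so the sign of the transverse coordinate is constant along it as
long as it stays in one chart; it changes chart twice, once where `y > 0` and once where `y < 0`,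
and only the latter change affects the sign, by the factor `(-1) ^ a`. If `ε = 1` the parallel
closes up, which forces `(-1) ^ a = 1`. If `ε = -1` it ends where the parallel `-r` begins; that one
runs on the opposite side of the curve, since the strip covers a neighbourhood of the curve, and
hence `(-1) ^ a = -1`.
-/

open scoped Matrix Topology

noncomputable section

namespace Toric

/-! ### Lattice pairings and smooth cones -/

section Cones

variable {n : ℕ}

lemma pairing_latticeVec (m v : Fin n → ℤ) : pairing m (latticeVec v) = ((m ⬝ᵥ v : ℤ) : ℝ) := by
  simp [pairing, latticeVec, dotProduct]

lemma pairing_add (m : Fin n → ℤ) (v w : Fin n → ℝ) :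
    pairing m (v + w) = pairing m v + pairing m w := by
  simp [pairing, mul_add, Finset.sum_add_distrib]

lemma pairing_smul (m : Fin n → ℤ) (c : ℝ) (v : Fin n → ℝ) :
    pairing m (c • v) = c * pairing m v := by
  simp only [pairing, Pi.smul_apply, smul_eq_mul, Finset.mul_sum]
  exact Finset.sum_congr rfl fun i _ => by ring

lemma pairing_sum {ι : Type*} (m : Fin n → ℤ) (s : Finset ι) (f : ι → Fin n → ℝ) :
    pairing m (∑ i ∈ s, f i) = ∑ i ∈ s, pairing m (f i) := by
  simp only [pairing, Finset.sum_apply, Finset.mul_sum]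
  exact Finset.sum_comm

lemma add_pairing (m m' : Fin n → ℤ) (v : Fin n → ℝ) :
    pairing (m + m') v = pairing m v + pairing m' v := by
  simp [pairing, add_mul, Finset.sum_add_distrib]

lemma neg_pairing (m : Fin n → ℤ) (v : Fin n → ℝ) : pairing (-m) v = -pairing m v := by
  simp [pairing]

lemma sub_pairing (m m' : Fin n → ℤ) (v : Fin n → ℝ) :
    pairing (m - m') v = pairing m v - pairing m' v := by
  rw [sub_eq_add_neg, add_pairing, neg_pairing, sub_eq_add_neg]

lemma sum_pairing {ι : Type*} (s : Finset ι) (f : ι → Fin n → ℤ) (v : Fin n → ℝ) :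
    pairing (∑ i ∈ s, f i) v = ∑ i ∈ s, pairing (f i) v := by
  simp only [pairing, Finset.sum_apply, Int.cast_sum, Finset.sum_mul]
  exact Finset.sum_comm

lemma latticeVec_zero : latticeVec (0 : Fin n → ℤ) = 0 := by
  ext i; simp [latticeVec]

lemma latticeVec_sum {ι : Type*} (s : Finset ι) (f : ι → Fin n → ℤ) :
    latticeVec (∑ i ∈ s, f i) = ∑ i ∈ s, latticeVec (f i) := by
  ext i; simp [latticeVec]

/-- The vectors of `M` dual to a basis `b` of `N`. -/
def dualVec (b : Module.Basis (Fin n) ℤ (Fin n → ℤ)) (i : Fin n) : Fin n → ℤ :=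
  fun j => b.repr (Pi.single j 1) i

lemma dualVec_dotProduct (b : Module.Basis (Fin n) ℤ (Fin n → ℤ)) (i : Fin n) (v : Fin n → ℤ) :
    dualVec b i ⬝ᵥ v = b.repr v i := by
  have h := LinearMap.pi_apply_eq_sum_univ (b.coord i) v
  rw [Module.Basis.coord_apply] at h
  rw [h, dotProduct]
  refine Finset.sum_congr rfl fun j _ => ?_
  rw [smul_eq_mul, mul_comm, dualVec, Module.Basis.coord_apply]
  congr 3
  ext k
  rcases eq_or_ne j k with rfl | h
  · simp
  · simp [h, h.symm]

lemma dualVec_dotProduct_basis (b : Module.Basis (Fin n) ℤ (Fin n → ℤ)) (i j : Fin n) :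
    dualVec b i ⬝ᵥ b j = if i = j then 1 else 0 := by
  rw [dualVec_dotProduct, Module.Basis.repr_self, Finsupp.single_apply]
  simp only [eq_comm]

lemma sum_pairing_dualVec_smul (b : Module.Basis (Fin n) ℤ (Fin n → ℤ)) (v : Fin n → ℝ) :
    ∑ i, pairing (dualVec b i) v • latticeVec (b i) = v := by
  have key : ∀ j, ∑ i, pairing (dualVec b i) (latticeVec (Pi.single j 1)) • latticeVec (b i)
      = latticeVec (Pi.single j 1) := by
    intro j
    refine Eq.trans ?_ (congrArg latticeVec (b.sum_repr (Pi.single j 1)))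
    rw [latticeVec_sum]
    refine Finset.sum_congr rfl fun i _ => ?_
    rw [pairing_latticeVec, dualVec_dotProduct]
    ext k
    simp only [latticeVec, Pi.smul_apply, smul_eq_mul, Int.cast_mul]
  have hv : v = ∑ j, v j • latticeVec (Pi.single j 1) := by
    ext k
    simp [latticeVec, Finset.sum_apply, Pi.single_apply]
  conv_rhs => rw [hv]
  rw [← Finset.sum_congr rfl fun j _ => congrArg (v j • ·) (key j)]
  simp_rw [Finset.smul_sum]
  rw [Finset.sum_comm]
  refine Finset.sum_congr rfl fun i _ => ?_
  conv_lhs => rw [hv]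
  rw [pairing_sum, Finset.sum_smul]
  exact Finset.sum_congr rfl fun j _ => by rw [pairing_smul, mul_smul]

/-- A cone generated by part of a basis is cut out by the coordinates of that basis. -/
lemma mem_hull_basis_iff (b : Module.Basis (Fin n) ℤ (Fin n → ℤ)) (s : Set (Fin n))
    (v : Fin n → ℝ) :
    v ∈ PointedCone.hull ℝ ((fun i => latticeVec (b i)) '' s) ↔
      (∀ i, 0 ≤ pairing (dualVec b i) v) ∧ ∀ i ∉ s, pairing (dualVec b i) v = 0 := by
  constructor
  · intro hv
    induction hv using Submodule.span_induction with
    | mem x hx =>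
      obtain ⟨j, hj, rfl⟩ := hx
      simp only [pairing_latticeVec, dualVec_dotProduct_basis]
      refine ⟨fun i => by split_ifs <;> simp, fun i hi => ?_⟩
      rw [if_neg (by rintro rfl; exact hi hj)]; simp
    | zero => simp [pairing]
    | add x y _ _ hx hy =>
      simp only [pairing_add]
      exact ⟨fun i => add_nonneg (hx.1 i) (hy.1 i), fun i hi => by rw [hx.2 i hi, hy.2 i hi, add_zero]⟩
    | smul a x _ hx =>
      have : a • x = (a : ℝ) • x := rfl
      simp only [this, pairing_smul]
      exact ⟨fun i => mul_nonneg a.2 (hx.1 i), fun i hi => by rw [hx.2 i hi, mul_zero]⟩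
  · rintro ⟨h0, h1⟩
    rw [← sum_pairing_dualVec_smul b v]
    refine Submodule.sum_mem _ fun i _ => ?_
    by_cases hi : i ∈ s
    · exact PointedCone.smul_mem _ (h0 i) (Submodule.subset_span ⟨i, hi, rfl⟩)
    · rw [h1 i hi, zero_smul]; exact Submodule.zero_mem _

lemma dualMonoid_anti {σ τ : PointedCone ℝ (Fin n → ℝ)} (h : τ ≤ σ) :
    dualMonoid σ ≤ dualMonoid τ := fun _ hm v hv => hm v (h hv)

lemma dotProduct_nonneg_of_mem {σ : PointedCone ℝ (Fin n → ℝ)} {m v : Fin n → ℤ}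
    (hm : m ∈ dualMonoid σ) (hv : latticeVec v ∈ σ) : 0 ≤ m ⬝ᵥ v := by
  have := hm _ hv
  rw [pairing_latticeVec] at this
  exact_mod_cast this

lemma mem_dualMonoid_hull {S : Set (Fin n → ℤ)} {m : Fin n → ℤ} :
    m ∈ dualMonoid (PointedCone.hull ℝ (latticeVec '' S)) ↔ ∀ v ∈ S, 0 ≤ m ⬝ᵥ v := by
  constructor
  · exact fun h v hv => dotProduct_nonneg_of_mem h (Submodule.subset_span ⟨v, hv, rfl⟩)
  · intro h v hv
    induction hv using Submodule.span_induction with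
    | mem x hx =>
      obtain ⟨j, hj, rfl⟩ := hx
      rw [pairing_latticeVec]
      exact_mod_cast h j hj
    | zero => simp [pairing]
    | add x y _ _ hx hy => rw [pairing_add]; exact add_nonneg hx hy
    | smul a x _ hx =>
      have : a • x = (a : ℝ) • x := rfl
      rw [this, pairing_smul]
      exact mul_nonneg a.2 hx

namespace Fan

variable {Δ : Fan n}

lemma isFaceOf_of_le {σ τ : PointedCone ℝ (Fin n → ℝ)} (hσ : σ ∈ Δ.cones) (hτ : τ ∈ Δ.cones)
    (h : τ ≤ σ) : τ.IsFaceOf σ := by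
  simpa [inf_eq_right.mpr h] using Δ.inf_face σ hσ τ hτ

lemma inf_mem {σ τ : PointedCone ℝ (Fin n → ℝ)} (hσ : σ ∈ Δ.cones) (hτ : τ ∈ Δ.cones) :
    σ ⊓ τ ∈ Δ.cones := Δ.face_mem σ hσ _ (Δ.inf_face σ hσ τ hτ)

/-- A cone of a smooth fan contains `v` as soon as all of `σ^∨ ∩ M` is nonnegative on `v`. -/
lemma IsSmooth.mem_of_forall_dualMonoid (hs : Δ.IsSmooth) {σ : PointedCone ℝ (Fin n → ℝ)}
    (hσ : σ ∈ Δ.cones) {v : Fin n → ℝ} (h : ∀ m ∈ dualMonoid σ, 0 ≤ pairing m v) : v ∈ σ := by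
  obtain ⟨b, s, rfl⟩ := hs σ hσ
  have h1 : ∀ i, dualVec b i ∈ dualMonoid (PointedCone.hull ℝ ((fun i => latticeVec (b i)) '' s)) :=
    fun i w hw => ((mem_hull_basis_iff b s w).1 hw).1 i
  refine (mem_hull_basis_iff b s v).2 ⟨fun i => h _ (h1 i), fun i hi => ?_⟩
  refine le_antisymm ?_ (h _ (h1 i))
  have := h (-dualVec b i) fun w hw => by
    rw [neg_pairing, ((mem_hull_basis_iff b s w).1 hw).2 i hi, neg_zero]
  rw [neg_pairing] at this
  linarith

/-- If `τ` is a face of `σ`, then `S_τ` arises from `S_σ` by inverting one element. -/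
lemma IsSmooth.exists_face_functional (hs : Δ.IsSmooth) {σ τ : PointedCone ℝ (Fin n → ℝ)}
    (hσ : σ ∈ Δ.cones) (hτ : τ ∈ Δ.cones) (h : τ ≤ σ) :
    ∃ m₀ ∈ dualMonoid σ, -m₀ ∈ dualMonoid τ ∧
      ∀ m ∈ dualMonoid τ, ∃ k : ℕ, m + k • m₀ ∈ dualMonoid σ := by
  classical
  have hf := isFaceOf_of_le hσ hτ h
  obtain ⟨b, s, rfl⟩ := hs σ hσ
  set σ := PointedCone.hull ℝ ((fun i => latticeVec (b i)) '' s) with hσdef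
  have hbσ : ∀ i ∈ s, latticeVec (b i) ∈ σ := fun i hi => Submodule.subset_span ⟨i, hi, rfl⟩
  let F : Finset (Fin n) := Finset.univ.filter fun i => i ∈ s ∧ latticeVec (b i) ∉ τ
  have hm0 : ∀ j, (∑ i ∈ F, dualVec b i) ⬝ᵥ b j = if j ∈ F then 1 else 0 := by
    intro j
    simp [sum_dotProduct, dualVec_dotProduct_basis]
  have himg : ∀ m, m ∈ dualMonoid σ ↔ ∀ i ∈ s, 0 ≤ m ⬝ᵥ b i := by
    intro m
    have : ((fun i => latticeVec (b i)) '' s) = latticeVec '' (b '' s) := by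
      rw [Set.image_image]
    rw [hσdef, this, mem_dualMonoid_hull]
    simp
  refine ⟨∑ i ∈ F, dualVec b i, ?_, ?_, ?_⟩
  · rw [himg]
    intro i _
    rw [hm0]; split_ifs <;> simp
  · intro v hv
    rw [neg_pairing, sum_pairing, Finset.sum_eq_zero, neg_zero]
    intro i hi
    have hv' := (mem_hull_basis_iff b s v).1 (h hv)
    by_contra hne
    have hpos := lt_of_le_of_ne (hv'.1 i) (Ne.symm hne)
    have hi' : i ∈ s ∧ latticeVec (b i) ∉ τ := by simpa [F] using hi
    have hsum : v = pairing (dualVec b i) v • latticeVec (b i) +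
        ∑ j ∈ Finset.univ.erase i, pairing (dualVec b j) v • latticeVec (b j) := by
      rw [Finset.add_sum_erase Finset.univ
        (fun j => pairing (dualVec b j) v • latticeVec (b j)) (Finset.mem_univ i),
        sum_pairing_dualVec_smul]
    rw [hsum] at hv
    refine hi'.2 (hf.mem_of_smul_add_mem (hbσ i hi'.1) ?_ hpos hv)
    refine Submodule.sum_mem _ fun j _ => ?_
    by_cases hj : j ∈ s
    · exact PointedCone.smul_mem _ (hv'.1 j) (hbσ j hj)
    · rw [hv'.2 j hj, zero_smul]; exact Submodule.zero_mem _
  · intro m hm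
    refine ⟨∑ i, (m ⬝ᵥ b i).natAbs, ?_⟩
    rw [himg]
    intro i hi
    rw [add_dotProduct, smul_dotProduct, hm0]
    by_cases hiτ : latticeVec (b i) ∈ τ
    · have h0 := dotProduct_nonneg_of_mem hm hiτ
      split_ifs <;> simp <;> positivity
    · rw [if_pos (by simp [F, hi, hiτ])]
      have h1 : (m ⬝ᵥ b i).natAbs ≤ ∑ i, (m ⬝ᵥ b i).natAbs :=
        Finset.single_le_sum (f := fun i => (m ⬝ᵥ b i).natAbs) (fun _ _ => Nat.zero_le _)
          (Finset.mem_univ i)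
      rw [nsmul_eq_mul, mul_one]
      omega

lemma exists_le_maximal {σ : PointedCone ℝ (Fin n → ℝ)} (hσ : σ ∈ Δ.cones) :
    ∃ τ, σ ≤ τ ∧ Maximal (· ∈ Δ.cones) τ := by
  obtain ⟨τ, h, hτ⟩ := Δ.finite.exists_le_maximal hσ
  exact ⟨τ, h, hτ⟩

end Fan

end Cones

/-! ### Points of affine charts and values of characters -/

section Charts

variable {n : ℕ} {k : Type} [Field k]

/-- A character that is nonnegative on the face of `τ` where `m₀` vanishes becomes regular on `U_τ`
after multiplication by a power of `χ^{m₀}`. -/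
lemma Fan.IsSmooth.exists_add_nsmul_mem {Δ : Fan n} (hs : Δ.IsSmooth)
    {τ : PointedCone ℝ (Fin n → ℝ)} (hτ : τ ∈ Δ.cones) {m₀ : Fin n → ℤ}
    (h₀ : m₀ ∈ dualMonoid τ) {m : Fin n → ℤ}
    (hm : ∀ v ∈ τ, pairing m₀ v = 0 → 0 ≤ pairing m v) :
    ∃ j : ℕ, m + j • m₀ ∈ dualMonoid τ := by
  obtain ⟨b, s, rfl⟩ := hs τ hτ
  have hb : ∀ i ∈ s, latticeVec (b i) ∈ PointedCone.hull ℝ ((fun i => latticeVec (b i)) '' s) :=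
    fun i hi => Submodule.subset_span ⟨i, hi, rfl⟩
  have himg : ((fun i => latticeVec (b i)) '' s) = latticeVec '' (b '' s) := by
    rw [Set.image_image]
  refine ⟨∑ i, (m ⬝ᵥ b i).natAbs, ?_⟩
  rw [himg, mem_dualMonoid_hull]
  rintro _ ⟨i, hi, rfl⟩
  rw [add_dotProduct, smul_dotProduct]
  have h1 : (m ⬝ᵥ b i).natAbs ≤ ∑ i, (m ⬝ᵥ b i).natAbs :=
    Finset.single_le_sum (f := fun i => (m ⬝ᵥ b i).natAbs) (fun _ _ => Nat.zero_le _)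
      (Finset.mem_univ i)
  have h2 := dotProduct_nonneg_of_mem h₀ (hb i hi)
  rcases h2.eq_or_lt with h2 | h2
  · have := hm _ (hb i hi) (by rw [pairing_latticeVec, ← h2, Int.cast_zero])
    rw [pairing_latticeVec] at this
    have : 0 ≤ m ⬝ᵥ b i := by exact_mod_cast this
    rw [← h2]; simpa
  · rw [nsmul_eq_mul]
    have h3 : (((∑ i, (m ⬝ᵥ b i).natAbs : ℕ)) : ℤ) ≤ ((∑ i, (m ⬝ᵥ b i).natAbs : ℕ)) * (m₀ ⬝ᵥ b i) :=
      le_mul_of_one_le_right (Nat.cast_nonneg _) h2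
    omega

namespace AffPoints

variable {σ τ : PointedCone ℝ (Fin n → ℝ)}

@[ext]
lemma ext {x y : AffPoints σ k} (h : ∀ m, x.chi m = y.chi m) : x = y := by
  cases x; cases y
  congr 1
  refine MonoidHom.ext fun m => ?_
  exact h m.toAdd

lemma chi_zero (x : AffPoints σ k) : x.chi 0 = 1 := x.hom.map_one

lemma chi_add (x : AffPoints σ k) (m m' : dualMonoid σ) : x.chi (m + m') = x.chi m * x.chi m' :=
  x.hom.map_mul _ _

lemma chi_nsmul (x : AffPoints σ k) (j : ℕ) (m : dualMonoid σ) : x.chi (j • m) = x.chi m ^ j :=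
  x.hom.map_pow _ _

/-- The point of `U_σ` with given values of the characters. -/
def ofFun (f : dualMonoid σ → k) (h0 : f 0 = 1) (hadd : ∀ m m', f (m + m') = f m * f m') :
    AffPoints σ k :=
  ⟨{ toFun := fun m => f m.toAdd, map_one' := h0, map_mul' := fun m m' => hadd m.toAdd m'.toAdd }⟩

@[simp]
lemma chi_ofFun (f : dualMonoid σ → k) (h0 : f 0 = 1) (hadd : ∀ m m', f (m + m') = f m * f m')
    (m : dualMonoid σ) : (ofFun f h0 hadd).chi m = f m := rfl

lemma chi_translate (t : Multiplicative (Fin n → ℤ) →* kˣ) (x : AffPoints σ k) (m : dualMonoid σ) :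
    (x.translate t).chi m = t (Multiplicative.ofAdd (m : Fin n → ℤ)) * x.chi m := rfl

lemma chi_baseChange {l : Type} [Field l] (f : k →+* l) (x : AffPoints σ k) (m : dualMonoid σ) :
    (x.baseChange f).chi m = f (x.chi m) := rfl

/-- The map `U_τ → U_σ` for `τ ⊆ σ`. -/
def restrict (h : τ ≤ σ) (x : AffPoints τ k) : AffPoints σ k :=
  ofFun (fun m => x.chi ⟨m, dualMonoid_anti h m.2⟩) x.chi_zero
    (fun m m' => x.chi_add ⟨m, dualMonoid_anti h m.2⟩ ⟨m', dualMonoid_anti h m'.2⟩)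

lemma chi_restrict (h : τ ≤ σ) (x : AffPoints τ k) (m : dualMonoid σ) :
    (x.restrict h).chi m = x.chi ⟨m, dualMonoid_anti h m.2⟩ := rfl

/-- The rational function `χ^m` is regular at the point `x` of `U_σ`, as a quotient of characters
with nonvanishing denominator, and has the value `c` there. -/
def HasVal (x : AffPoints σ k) (m : Fin n → ℤ) (c : k) : Prop :=
  ∃ m₁ m₂ : dualMonoid σ, m = (m₁ : Fin n → ℤ) - m₂ ∧ x.chi m₂ ≠ 0 ∧ c * x.chi m₂ = x.chi m₁

lemma hasVal_chi (x : AffPoints σ k) (m : dualMonoid σ) : x.HasVal m (x.chi m) :=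
  ⟨m, 0, by simp, by simp [chi_zero], by simp [chi_zero]⟩

lemma HasVal.unique {x : AffPoints σ k} {m : Fin n → ℤ} {c c' : k} (h : x.HasVal m c)
    (h' : x.HasVal m c') : c = c' := by
  obtain ⟨m₁, m₂, e, h0, hc⟩ := h
  obtain ⟨m₁', m₂', e', h0', hc'⟩ := h'
  have : m₁ + m₂' = m₁' + m₂ := by
    ext1
    push_cast
    rw [e] at e'
    exact sub_eq_sub_iff_add_eq_add.1 e'
  have h1 := congrArg x.chi this
  rw [chi_add, chi_add, ← hc, ← hc'] at h1
  have h2 : (c - c') * (x.chi m₂ * x.chi m₂') = 0 := by linear_combination h1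
  exact sub_eq_zero.1 ((mul_eq_zero.1 h2).resolve_right (mul_ne_zero h0 h0'))

lemma HasVal.add {x : AffPoints σ k} {m m' : Fin n → ℤ} {c c' : k} (h : x.HasVal m c)
    (h' : x.HasVal m' c') : x.HasVal (m + m') (c * c') := by
  obtain ⟨m₁, m₂, rfl, h0, hc⟩ := h
  obtain ⟨m₁', m₂', rfl, h0', hc'⟩ := h'
  refine ⟨m₁ + m₁', m₂ + m₂', by push_cast; abel, ?_, ?_⟩
  · rw [chi_add]; exact mul_ne_zero h0 h0'
  · rw [chi_add, chi_add, ← hc, ← hc']; ring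

/-- The relation `HasVal` is compatible with the gluing: passing to a face inverts a character that
does not vanish at the points of the smaller chart. -/
lemma hasVal_restrict_iff {Δ : Fan n} (hs : Δ.IsSmooth) (hσ : σ ∈ Δ.cones) (hτ : τ ∈ Δ.cones)
    (h : τ ≤ σ) (x : AffPoints τ k) (m : Fin n → ℤ) (c : k) :
    (x.restrict h).HasVal m c ↔ x.HasVal m c := by
  constructor
  · rintro ⟨m₁, m₂, rfl, h0, hc⟩
    exact ⟨⟨m₁, dualMonoid_anti h m₁.2⟩, ⟨m₂, dualMonoid_anti h m₂.2⟩, rfl, h0, hc⟩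
  · rintro ⟨m₁, m₂, rfl, h0, hc⟩
    obtain ⟨m₀, hm, hm', hk⟩ := hs.exists_face_functional hσ hτ h
    obtain ⟨j₁, hj₁⟩ := hk m₁ m₁.2
    obtain ⟨j₂, hj₂⟩ := hk m₂ m₂.2
    let u : dualMonoid τ := ⟨m₀, dualMonoid_anti h hm⟩
    have hu : x.chi u ≠ 0 := by
      have h1 : u + ⟨-m₀, hm'⟩ = 0 := by ext1; simp [u]
      have h2 := congrArg x.chi h1
      rw [chi_add, chi_zero] at h2
      exact left_ne_zero_of_mul_eq_one h2
    have e1 : (⟨m₁ + j₁ • m₀ + j₂ • m₀, dualMonoid_anti h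
        (add_mem hj₁ (nsmul_mem hm j₂))⟩ : dualMonoid τ) = m₁ + (j₁ + j₂) • u := by
      ext1; simp [u, add_smul, add_assoc]
    have e2 : (⟨m₂ + j₂ • m₀ + j₁ • m₀, dualMonoid_anti h
        (add_mem hj₂ (nsmul_mem hm j₁))⟩ : dualMonoid τ) = m₂ + (j₁ + j₂) • u := by
      ext1; simp [u, add_smul]; abel
    refine ⟨⟨m₁ + j₁ • m₀ + j₂ • m₀, add_mem hj₁ (nsmul_mem hm j₂)⟩,
      ⟨m₂ + j₂ • m₀ + j₁ • m₀, add_mem hj₂ (nsmul_mem hm j₁)⟩, ?_, ?_, ?_⟩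
    · simp only; abel
    · rw [chi_restrict, e2, chi_add, chi_nsmul]
      exact mul_ne_zero h0 (pow_ne_zero _ hu)
    · rw [chi_restrict, chi_restrict, e1, e2, chi_add, chi_add, ← hc, mul_assoc]

end AffPoints

namespace Points

variable {Δ : Fan n}

lemma mk_restrict {σ τ : Δ.cones} (h : τ.1 ≤ σ.1) (x : AffPoints τ.1 k) :
    mk σ (x.restrict h) = mk τ x :=
  Quot.sound ⟨h, fun _ _ _ => rfl⟩

lemma exists_mk (p : Points Δ k) : ∃ σ x, mk σ x = p := by
  induction p using Quot.ind with
  | mk a => exact ⟨a.1, a.2, rfl⟩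

lemma exists_mk_maximal (p : Points Δ k) :
    ∃ (σ : Δ.cones) (x : _), Maximal (· ∈ Δ.cones) σ.1 ∧ mk σ x = p := by
  obtain ⟨τ, x, rfl⟩ := exists_mk p
  obtain ⟨σ, h, hσ⟩ := Fan.exists_le_maximal τ.2
  exact ⟨⟨σ, hσ.1⟩, x.restrict h, hσ, mk_restrict h x⟩

/-- The rational function `χ^m` is regular at `p` and has the value `c` there. -/
def HasVal (p : Points Δ k) (m : Fin n → ℤ) (c : k) : Prop :=
  ∃ (σ : Δ.cones) (x : _), mk σ x = p ∧ x.HasVal m c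

/-- The value of a character at a point does not depend on the chart in which it is computed. -/
lemma hasVal_mk (hs : Δ.IsSmooth) {σ : Δ.cones} {x : AffPoints σ.1 k} {m : Fin n → ℤ} {c : k} :
    (mk σ x).HasVal m c ↔ x.HasVal m c := by
  have hglue : ∀ p q : Σ σ : Δ.cones, AffPoints σ.1 k, GlueRel Δ k p q →
      (p.2.HasVal m c ↔ q.2.HasVal m c) := by
    rintro ⟨σ, x⟩ ⟨τ, y⟩ ⟨h, hxy⟩
    change τ.1 ≤ σ.1 at h
    have : x = y.restrict h := by
      ext m
      exact hxy m m.2 (dualMonoid_anti h m.2)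
    subst this
    exact AffPoints.hasVal_restrict_iff hs σ.2 τ.2 h y m c
  refine ⟨?_, fun h => ⟨σ, x, rfl, h⟩⟩
  rintro ⟨τ, y, e, h⟩
  have : ∀ p q : Σ σ : Δ.cones, AffPoints σ.1 k, Relation.EqvGen (GlueRel Δ k) p q →
      (p.2.HasVal m c ↔ q.2.HasVal m c) := by
    intro p q hpq
    induction hpq with
    | rel p q h => exact hglue p q h
    | refl => rfl
    | symm _ _ _ ih => exact ih.symm
    | trans _ _ _ _ _ ih1 ih2 => exact ih1.trans ih2
  exact (this _ _ (Quot.eqvGen_exact e)).1 h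

lemma HasVal.unique (hs : Δ.IsSmooth) {p : Points Δ k} {m : Fin n → ℤ} {c c' : k}
    (h : p.HasVal m c) (h' : p.HasVal m c') : c = c' := by
  obtain ⟨σ, x, rfl⟩ := exists_mk p
  rw [hasVal_mk hs] at h h'
  exact h.unique h'

lemma HasVal.add (hs : Δ.IsSmooth) {p : Points Δ k} {m m' : Fin n → ℤ} {c c' : k}
    (h : p.HasVal m c) (h' : p.HasVal m' c') : p.HasVal (m + m') (c * c') := by
  obtain ⟨σ, x, rfl⟩ := exists_mk p
  rw [hasVal_mk hs] at h h' ⊢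
  exact h.add h'

lemma hasVal_mk_chi (σ : Δ.cones) (x : AffPoints σ.1 k) (m : dualMonoid σ.1) :
    (mk σ x).HasVal m (x.chi m) := ⟨σ, x, rfl, x.hasVal_chi m⟩

lemma mk_injective (hs : Δ.IsSmooth) (σ : Δ.cones) :
    Function.Injective (mk σ : AffPoints σ.1 k → Points Δ k) := by
  intro x y h
  ext m
  have h1 := hasVal_mk_chi σ x m
  rw [h, hasVal_mk hs] at h1
  exact h1.unique (y.hasVal_chi m)

/-- The chart of a maximal cone `σ` consists of the points at which all characters in `σ^∨ ∩ M` are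
regular: a difference of two linear functions of the strictly convex support function separates `σ`
from any other maximal cone. -/
lemma exists_mk_of_regular (hs : Δ.IsSmooth) (hp : Δ.IsProjective) {σ : Δ.cones}
    (hσ : Maximal (· ∈ Δ.cones) σ.1) {p : Points Δ k}
    (h : ∀ m ∈ dualMonoid σ.1, ∃ c, p.HasVal m c) : ∃ x, mk σ x = p := by
  obtain ⟨τ, y, hτ, rfl⟩ := exists_mk_maximal p
  obtain ⟨ℓ, hℓ⟩ := hp.strictlyConvex
  -- the separating character `χ^m`, with `m = ℓ σ - ℓ τ`, is regular on `U_τ`, and regularity of its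
  -- inverse at the point puts the point into the chart of the common face
  have hm : ℓ τ.1 - ℓ σ.1 ∈ dualMonoid σ.1 := fun v hv => by
    rw [sub_pairing, sub_nonneg]; exact (hℓ τ.1 σ.1 hτ hσ v hv).1
  have hm' : ℓ σ.1 - ℓ τ.1 ∈ dualMonoid τ.1 := fun v hv => by
    rw [sub_pairing, sub_nonneg]; exact (hℓ σ.1 τ.1 hσ hτ v hv).1
  have hne : y.chi ⟨_, hm'⟩ ≠ 0 := by
    obtain ⟨c, hc⟩ := h _ hm
    rw [hasVal_mk hs] at hc
    have h1 := hc.add (y.hasVal_chi ⟨_, hm'⟩)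
    have h2 := y.hasVal_chi 0
    rw [y.chi_zero] at h2
    have e : ℓ τ.1 - ℓ σ.1 + (ℓ σ.1 - ℓ τ.1) = ((0 : dualMonoid τ.1) : Fin n → ℤ) := by simp
    rw [e] at h1
    exact right_ne_zero_of_mul_eq_one (h1.unique h2)
  let ρ : Δ.cones := ⟨σ.1 ⊓ τ.1, Fan.inf_mem σ.2 τ.2⟩
  have hreg : ∀ m : dualMonoid ρ.1, ∃ c, y.HasVal m c := by
    intro m
    obtain ⟨j, hj⟩ := hs.exists_add_nsmul_mem τ.2 hm' (m := m) (by
      intro v hv h0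
      refine m.2 v ⟨(hℓ σ.1 τ.1 hσ hτ v hv).2.1 ?_, hv⟩
      rw [sub_pairing] at h0
      linarith)
    refine ⟨y.chi ⟨_, hj⟩ / y.chi ⟨_, hm'⟩ ^ j, ⟨_, hj⟩, j • ⟨_, hm'⟩, ?_, ?_, ?_⟩
    · simp
    · rw [y.chi_nsmul]; exact pow_ne_zero _ hne
    · rw [y.chi_nsmul]; exact div_mul_cancel₀ _ (pow_ne_zero _ hne)
  choose f hf using hreg
  let z : AffPoints ρ.1 k := AffPoints.ofFun f
    ((hf 0).unique (by have := y.hasVal_chi 0; rwa [y.chi_zero] at this))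
    (fun m m' => (hf (m + m')).unique ((hf m).add (hf m')))
  refine ⟨z.restrict inf_le_left, ?_⟩
  have hz : z.restrict inf_le_right = y := by
    ext m
    exact (hf ⟨m, _⟩).unique (y.hasVal_chi m)
  rw [mk_restrict (τ := ρ) (σ := σ) inf_le_left z, ← mk_restrict (τ := ρ) (σ := τ) inf_le_right z, hz]

end Points

/-! ### The subvarieties of lattice vectors in the support of the fan -/

/-- The closed subset `D_v` of `X(k)`: the points that lie in the orbit of a cone that contains `v`.
For `v` the primitive generator of a ray, this is the invariant divisor of the ray, and for `v = 0` it
is all of `X(k)`. It consists of the points at which only characters with nonnegative order along `v`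
are regular. -/
def divisor (Δ : Fan n) (k : Type) [Field k] (v : Fin n → ℤ) : Set (Points Δ k) :=
  {p | ∀ m c, p.HasVal m c → 0 ≤ m ⬝ᵥ v}

/-- In a chart, `D_v` is empty unless the cone contains `v`, and then it is the common zero set of the
characters that are not orthogonal to `v`. -/
lemma mk_mem_divisor {Δ : Fan n} (hs : Δ.IsSmooth) {v : Fin n → ℤ} {σ : Δ.cones}
    {x : AffPoints σ.1 k} :
    Points.mk σ x ∈ divisor Δ k v ↔
      latticeVec v ∈ σ.1 ∧ ∀ m : dualMonoid σ.1, (m : Fin n → ℤ) ⬝ᵥ v ≠ 0 → x.chi m = 0 := by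
  simp only [divisor, Set.mem_ofPred_eq, Points.hasVal_mk hs]
  constructor
  · intro h
    have hv : latticeVec v ∈ σ.1 := hs.mem_of_forall_dualMonoid σ.2 fun m hm => by
      rw [pairing_latticeVec]
      exact_mod_cast h m _ (x.hasVal_chi ⟨m, hm⟩)
    refine ⟨hv, fun m hm => ?_⟩
    by_contra hne
    have h1 := h (-(m : Fin n → ℤ)) (x.chi m)⁻¹
      ⟨0, m, by simp, hne, by rw [inv_mul_cancel₀ hne, x.chi_zero]⟩
    rw [neg_dotProduct] at h1
    have := dotProduct_nonneg_of_mem m.2 hv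
    omega
  · rintro ⟨hv, h⟩ m c ⟨m₁, m₂, rfl, h0, _⟩
    have h2 : (m₂ : Fin n → ℤ) ⬝ᵥ v = 0 := by
      by_contra hne
      exact h0 (h m₂ hne)
    rw [sub_dotProduct, h2, sub_zero]
    exact dotProduct_nonneg_of_mem m₁.2 hv

lemma baseChange_preimage_divisor {Δ : Fan n} (hs : Δ.IsSmooth) {l : Type} [Field l] (f : k →+* l)
    (v : Fin n → ℤ) :
    Points.baseChange f ⁻¹' divisor Δ l v = divisor Δ k v := by
  ext p
  obtain ⟨σ, x, rfl⟩ := Points.exists_mk p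
  change Points.mk σ (x.baseChange f) ∈ divisor Δ l v ↔ _
  rw [mk_mem_divisor hs, mk_mem_divisor hs]
  simp [AffPoints.chi_baseChange]

end Charts

/-! ### Smooth complete fans in the plane -/

section Plane

/-- The determinant of two vectors of `ℤ²`. -/
def det (u w : Fin 2 → ℤ) : ℤ := u 0 * w 1 - u 1 * w 0

/-- The element of the dual lattice with `⟨perp u, z⟩ = det u z`. -/
def perp (u : Fin 2 → ℤ) : Fin 2 → ℤ := ![-u 1, u 0]

lemma perp_dotProduct (u z : Fin 2 → ℤ) : perp u ⬝ᵥ z = det u z := by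
  simp [perp, det, dotProduct]; ring

lemma neg_perp_dotProduct (u z : Fin 2 → ℤ) : -perp u ⬝ᵥ z = det z u := by
  simp [perp, det, dotProduct]; ring

lemma eq_det_smul_add {u w : Fin 2 → ℤ} (h : det u w = 1) (z : Fin 2 → ℤ) :
    z = det z w • u + det u z • w := by
  ext i
  fin_cases i <;> simp [det] at h ⊢
  · linear_combination (-z 0) * h
  · linear_combination (-z 1) * h

lemma dotProduct_perp {u w : Fin 2 → ℤ} (h : det u w = 1) (m : Fin 2 → ℤ) :
    m = (m ⬝ᵥ u) • (-perp w) + (m ⬝ᵥ w) • perp u := by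
  ext i
  fin_cases i <;> simp [det, perp, dotProduct] at h ⊢
  · linear_combination (-m 0) * h
  · linear_combination (-m 1) * h

/-- The cone generated by `u` and `w`. -/
def cone₂ (u w : Fin 2 → ℤ) : PointedCone ℝ (Fin 2 → ℝ) :=
  PointedCone.hull ℝ (latticeVec '' {u, w})

lemma left_mem_cone₂ (u w : Fin 2 → ℤ) : latticeVec u ∈ cone₂ u w :=
  Submodule.subset_span ⟨u, by simp, rfl⟩

lemma right_mem_cone₂ (u w : Fin 2 → ℤ) : latticeVec w ∈ cone₂ u w :=
  Submodule.subset_span ⟨w, by simp, rfl⟩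

lemma cone₂_le {u w : Fin 2 → ℤ} {σ : PointedCone ℝ (Fin 2 → ℝ)} (hu : latticeVec u ∈ σ)
    (hw : latticeVec w ∈ σ) : cone₂ u w ≤ σ := by
  refine Submodule.span_le.2 ?_
  rintro _ ⟨v, hv, rfl⟩
  rcases hv with rfl | rfl
  exacts [hu, hw]

lemma mem_dualMonoid_cone₂ {u w m : Fin 2 → ℤ} :
    m ∈ dualMonoid (cone₂ u w) ↔ 0 ≤ m ⬝ᵥ u ∧ 0 ≤ m ⬝ᵥ w := by
  simp [cone₂, mem_dualMonoid_hull]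

lemma latticeVec_mem_cone₂ {u w : Fin 2 → ℤ} (h : det u w = 1) {z : Fin 2 → ℤ} :
    latticeVec z ∈ cone₂ u w ↔ 0 ≤ det z w ∧ 0 ≤ det u z := by
  constructor
  · intro hz
    rw [← neg_perp_dotProduct, ← perp_dotProduct]
    constructor
    · refine dotProduct_nonneg_of_mem (mem_dualMonoid_cone₂.2 ?_) hz
      rw [neg_perp_dotProduct, neg_perp_dotProduct, h]
      simp [det, mul_comm]
    · refine dotProduct_nonneg_of_mem (mem_dualMonoid_cone₂.2 ?_) hz
      rw [perp_dotProduct, perp_dotProduct, h]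
      simp [det, mul_comm]
  · rintro ⟨h1, h2⟩
    have e : latticeVec z = (det z w : ℝ) • latticeVec u + (det u z : ℝ) • latticeVec w := by
      conv_lhs => rw [eq_det_smul_add h z]
      ext i
      simp [latticeVec]
    rw [e]
    exact add_mem (PointedCone.smul_mem _ (by exact_mod_cast h1) (left_mem_cone₂ u w))
      (PointedCone.smul_mem _ (by exact_mod_cast h2) (right_mem_cone₂ u w))

namespace Fan

/-- `u` and `w` are the primitive generators of a two-dimensional cone of `Δ`, in counterclockwise
order. -/
def Adj (Δ : Fan 2) (u w : Fin 2 → ℤ) : Prop := det u w = 1 ∧ cone₂ u w ∈ Δ.cones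

/-- `v` is the primitive generator of an edge of a two-dimensional cone of `Δ`. -/
def IsRay (Δ : Fan 2) (v : Fin 2 → ℤ) : Prop := (∃ w, Δ.Adj v w) ∨ ∃ w, Δ.Adj w v

/-- In a complete fan, some cone contains `v` and a point near it in the direction `w`. -/
lemma exists_cone_mem_add {n : ℕ} {Δ : Fan n} (hs : Δ.IsSmooth)
    (hc : ∀ v : Fin n → ℝ, ∃ σ ∈ Δ.cones, v ∈ σ) (v w : Fin n → ℤ) :
    ∃ τ ∈ Δ.cones, latticeVec v ∈ τ ∧ ∃ j : ℕ, latticeVec (j • v + w) ∈ τ := by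
  -- one of the finitely many cones contains `j v + w` for infinitely many `j`
  choose f hf hmem using fun j : ℕ => hc (latticeVec (j • v + w))
  have : Finite Δ.cones := Δ.finite
  obtain ⟨τ, hτ⟩ := Finite.exists_infinite_fiber fun j : ℕ => (⟨f j, hf j⟩ : Δ.cones)
  have hinf := Set.infinite_coe_iff.1 hτ
  have hτmem : ∀ j ∈ (fun j : ℕ => (⟨f j, hf j⟩ : Δ.cones)) ⁻¹' {τ},
      latticeVec (j • v + w) ∈ τ.1 := by
    intro j hj
    have : f j = τ.1 := congrArg Subtype.val hj
    exact this ▸ hmem j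
  refine ⟨τ.1, τ.2, ?_, ?_⟩
  · refine hs.mem_of_forall_dualMonoid τ.2 fun m hm => ?_
    rw [pairing_latticeVec]
    by_contra hneg
    have hneg : m ⬝ᵥ v < 0 := by
      rw [not_le] at hneg; exact_mod_cast hneg
    obtain ⟨j, hj, hjlt⟩ := hinf.exists_gt (m ⬝ᵥ w).natAbs
    have h1 := dotProduct_nonneg_of_mem hm (hτmem j hj)
    rw [dotProduct_add, dotProduct_smul, nsmul_eq_mul] at h1
    have h2 : (j : ℤ) * (m ⬝ᵥ v) ≤ -j := by nlinarith
    omega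
  · obtain ⟨j, hj⟩ := hinf.nonempty
    exact ⟨j, hτmem j hj⟩

variable {Δ : Fan 2}

/-- The maximal cones of a smooth complete fan in the plane are two-dimensional. -/
lemma exists_adj_of_maximal (hs : Δ.IsSmooth) (hc : ∀ v : Fin 2 → ℝ, ∃ σ ∈ Δ.cones, v ∈ σ)
    {σ : PointedCone ℝ (Fin 2 → ℝ)} (hσ : Maximal (· ∈ Δ.cones) σ) :
    ∃ u w, Δ.Adj u w ∧ σ = cone₂ u w := by
  classical
  obtain ⟨b, s, hb⟩ := hs σ hσ.1
  have hbσ : ∀ i ∈ s, latticeVec (b i) ∈ σ := fun i hi => hb ▸ Submodule.subset_span ⟨i, hi, rfl⟩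
  have hs' : s = Set.univ := by
    -- otherwise a cone reached from the interior of `σ` in a missing direction is larger than `σ`
    by_contra hne
    obtain ⟨i, hi⟩ := (Set.ne_univ_iff_exists_notMem s).1 hne
    obtain ⟨τ, hτ, hv, j, hj⟩ := exists_cone_mem_add hs hc
      (∑ l, if l ∈ s then b l else 0) (b i)
    have hle : σ ≤ τ := by
      rw [hb]
      refine Submodule.span_le.2 ?_
      rintro _ ⟨l, hl, rfl⟩
      rw [latticeVec_sum] at hv
      have hv' : ∑ l, latticeVec (if l ∈ s then b l else 0) ∈ σ ⊓ τ := by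
        refine ⟨Submodule.sum_mem _ fun l _ => ?_, hv⟩
        split_ifs with h
        · exact hbσ l h
        · rw [latticeVec_zero]; exact zero_mem _
      have := (Δ.inf_face σ hσ.1 τ hτ).mem_of_sum_mem (fun l => by
        split_ifs with h
        · exact hbσ l h
        · rw [latticeVec_zero]; exact zero_mem _) hv' l
      rw [if_pos hl] at this
      exact this.2
    rw [← hσ.eq_of_le hτ hle, hb, mem_hull_basis_iff] at hj
    have h1 := hj.2 i hi
    rw [pairing_latticeVec, dotProduct_add, dotProduct_smul, dotProduct_sum,
      dualVec_dotProduct_basis, Finset.sum_eq_zero] at h1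
    · simp at h1
    · intro l _
      split_ifs with h
      · rw [dualVec_dotProduct_basis, if_neg (by rintro rfl; exact hi h)]
      · simp
  -- the basis has determinant `±1`; its order is chosen so that the sign is `+`
  have hd : (det (b 0) (b 1)) * det (dualVec b 0) (dualVec b 1) = 1 := by
    have h00 := dualVec_dotProduct_basis b 0 0
    have h01 := dualVec_dotProduct_basis b 0 1
    have h10 := dualVec_dotProduct_basis b 1 0
    have h11 := dualVec_dotProduct_basis b 1 1
    simp [dotProduct] at h00 h01 h10 h11
    have : det (b 0) (b 1) * det (dualVec b 0) (dualVec b 1) =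
        (dualVec b 0 0 * b 0 0 + dualVec b 0 1 * b 0 1) *
          (dualVec b 1 0 * b 1 0 + dualVec b 1 1 * b 1 1) -
        (dualVec b 0 0 * b 1 0 + dualVec b 0 1 * b 1 1) *
          (dualVec b 1 0 * b 0 0 + dualVec b 1 1 * b 0 1) := by
      simp only [det]; ring
    rw [this, h00, h01, h10, h11]; ring
  have himg : ((fun i => latticeVec (b i)) '' s) = latticeVec '' {b 0, b 1} := by
    rw [hs']
    ext z
    simp [Fin.exists_fin_two, eq_comm]
  rcases Int.isUnit_iff.1 (IsUnit.of_mul_eq_one _ hd) with h1 | h1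
  · refine ⟨b 0, b 1, ⟨h1, ?_⟩, ?_⟩
    · have := hσ.1; rw [hb, himg] at this; exact this
    · rw [hb, himg]; rfl
  · rw [Set.pair_comm] at himg
    refine ⟨b 1, b 0, ⟨?_, ?_⟩, ?_⟩
    · simp only [det] at h1 ⊢; linarith
    · have := hσ.1; rw [hb, himg] at this; exact this
    · rw [hb, himg]; rfl

lemma exists_adj_ge (hs : Δ.IsSmooth) (hc : ∀ v : Fin 2 → ℝ, ∃ σ ∈ Δ.cones, v ∈ σ)
    {σ : PointedCone ℝ (Fin 2 → ℝ)} (hσ : σ ∈ Δ.cones) :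
    ∃ u w, Δ.Adj u w ∧ σ ≤ cone₂ u w := by
  obtain ⟨τ, h, hτ⟩ := exists_le_maximal hσ
  obtain ⟨u, w, huw, rfl⟩ := exists_adj_of_maximal hs hc hτ
  exact ⟨u, w, huw, h⟩

/-- A ray of the fan that is contained in a two-dimensional cone is an edge of it. -/
lemma IsRay.eq_or_eq {v u w : Fin 2 → ℤ} (hv : Δ.IsRay v) (huw : Δ.Adj u w)
    (hmem : latticeVec v ∈ cone₂ u w) : v = u ∨ v = w := by
  obtain ⟨h1, h2⟩ := (latticeVec_mem_cone₂ huw.1).1 hmem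
  have hexp := eq_det_smul_add huw.1 v
  have hlat : latticeVec v = (det v w : ℝ) • latticeVec u + (det u v : ℝ) • latticeVec w := by
    conv_lhs => rw [hexp]
    ext i
    simp [latticeVec]
  have hskew : ∀ a b : Fin 2 → ℤ, det a b = -det b a := fun a b => by simp only [det]; ring
  -- an interior vector of the cone spans no ray: cones containing it contain both `u` and `w`
  have hzero : det v w = 0 ∨ det u v = 0 := by
    by_contra! hcon
    have p1 : 0 < det v w := lt_of_le_of_ne h1 hcon.1.symm
    have p2 : 0 < det u v := lt_of_le_of_ne h2 hcon.2.symm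
    have key : ∀ τ ∈ Δ.cones, latticeVec v ∈ τ → latticeVec u ∈ τ ∧ latticeVec w ∈ τ := by
      intro τ hτ hvτ
      have hf := Δ.inf_face _ huw.2 τ hτ
      have hm : latticeVec v ∈ cone₂ u w ⊓ τ := ⟨hmem, hvτ⟩
      rw [hlat] at hm
      have q1 : (0 : ℝ) < det v w := by exact_mod_cast p1
      have q2 : (0 : ℝ) < det u v := by exact_mod_cast p2
      exact ⟨(hf.mem_of_smul_add_smul_mem_left (left_mem_cone₂ u w) (right_mem_cone₂ u w)
        q1 q2 hm).2, (hf.mem_of_smul_add_smul_mem_right (left_mem_cone₂ u w)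
        (right_mem_cone₂ u w) q1 q2 hm).2⟩
    rcases hv with ⟨x, hx⟩ | ⟨x, hx⟩
    · have := ((latticeVec_mem_cone₂ hx.1).1 (key _ hx.2 (left_mem_cone₂ _ _)).1).2
      rw [hskew] at this; omega
    · have := ((latticeVec_mem_cone₂ hx.1).1 (key _ hx.2 (right_mem_cone₂ _ _)).2).1
      rw [hskew] at this; omega
  -- generators of edges are primitive
  have hprim : ∀ (c : ℤ) (z : Fin 2 → ℤ), 0 ≤ c → v = c • z → v = z := by
    intro c z hc0 hcz
    have hc1 : IsUnit c := by
      rcases hv with ⟨x, hx⟩ | ⟨x, hx⟩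
      · refine IsUnit.of_mul_eq_one (det z x) ?_
        rw [← hx.1, hcz]; simp [det]; ring
      · refine IsUnit.of_mul_eq_one (det x z) ?_
        rw [← hx.1, hcz]; simp [det]; ring
    rcases Int.isUnit_iff.1 hc1 with h | h
    · rw [hcz, h, one_smul]
    · omega
  rcases hzero with h | h
  · rw [h, zero_smul, zero_add] at hexp
    exact Or.inr (hprim _ _ h2 hexp)
  · rw [h, zero_smul, add_zero] at hexp
    exact Or.inl (hprim _ _ h1 hexp)

lemma det_self (u : Fin 2 → ℤ) : det u u = 0 := by simp only [det]; ring

lemma det_swap (u w : Fin 2 → ℤ) : det u w = -det w u := by simp only [det]; ring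

lemma Adj.isRay_left {u w : Fin 2 → ℤ} (h : Δ.Adj u w) : Δ.IsRay u := Or.inl ⟨w, h⟩

lemma Adj.isRay_right {u w : Fin 2 → ℤ} (h : Δ.Adj u w) : Δ.IsRay w := Or.inr ⟨u, h⟩

lemma Adj.ne {u w : Fin 2 → ℤ} (h : Δ.Adj u w) : u ≠ w := by
  rintro rfl
  have := h.1
  rw [det_self] at this
  omega

lemma IsRay.exists_adj_right (hs : Δ.IsSmooth) (hc : ∀ v : Fin 2 → ℝ, ∃ σ ∈ Δ.cones, v ∈ σ)
    {v : Fin 2 → ℤ} (hv : Δ.IsRay v) : ∃ w, Δ.Adj v w := by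
  rcases hv with h | ⟨u, hu⟩
  · exact h
  obtain ⟨τ, hτ, hvτ, j, hj⟩ := exists_cone_mem_add hs hc v (-u)
  obtain ⟨x, y, hxy, hle⟩ := exists_adj_ge hs hc hτ
  rcases IsRay.eq_or_eq hu.isRay_right hxy (hle hvτ) with rfl | rfl
  · exact ⟨y, hxy⟩
  · have h1 := ((latticeVec_mem_cone₂ hxy.1).1 (hle hj)).1
    have h2 := hu.1
    simp [det] at h1 h2
    nlinarith

lemma IsRay.exists_adj_left (hs : Δ.IsSmooth) (hc : ∀ v : Fin 2 → ℝ, ∃ σ ∈ Δ.cones, v ∈ σ)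
    {v : Fin 2 → ℤ} (hv : Δ.IsRay v) : ∃ u, Δ.Adj u v := by
  rcases hv with ⟨w, hw⟩ | h
  · obtain ⟨τ, hτ, hvτ, j, hj⟩ := exists_cone_mem_add hs hc v (-w)
    obtain ⟨x, y, hxy, hle⟩ := exists_adj_ge hs hc hτ
    rcases IsRay.eq_or_eq hw.isRay_left hxy (hle hvτ) with rfl | rfl
    · have h1 := ((latticeVec_mem_cone₂ hxy.1).1 (hle hj)).2
      have h2 := hw.1
      simp [det] at h1 h2
      nlinarith
    · exact ⟨x, hxy⟩
  · exact h

lemma Adj.right_unique {v w w' : Fin 2 → ℤ} (h : Δ.Adj v w) (h' : Δ.Adj v w') : w = w' := by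
  wlog hle : 0 ≤ det w' w generalizing w w'
  · refine (this h' h ?_).symm
    rw [det_swap] at hle; omega
  have hmem : latticeVec w' ∈ cone₂ v w :=
    (latticeVec_mem_cone₂ h.1).2 ⟨hle, by rw [h'.1]; omega⟩
  rcases h'.isRay_right.eq_or_eq h hmem with rfl | rfl
  · exact absurd rfl h'.ne
  · rfl

lemma Adj.left_unique {v w w' : Fin 2 → ℤ} (h : Δ.Adj w v) (h' : Δ.Adj w' v) : w = w' := by
  wlog hle : 0 ≤ det w w' generalizing w w'
  · refine (this h' h ?_).symm
    rw [det_swap] at hle; omega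
  have hmem : latticeVec w' ∈ cone₂ w v :=
    (latticeVec_mem_cone₂ h.1).2 ⟨by rw [h'.1]; omega, hle⟩
  rcases h'.isRay_left.eq_or_eq h hmem with rfl | rfl
  · rfl
  · exact absurd rfl h'.ne

lemma Adj.eq_of_mem {u w u' w' : Fin 2 → ℤ} (h : Δ.Adj u w) (h' : Δ.Adj u' w')
    (hu : latticeVec u ∈ cone₂ u' w') (hw : latticeVec w ∈ cone₂ u' w') : u = u' ∧ w = w' := by
  rcases h.isRay_left.eq_or_eq h' hu with rfl | rfl <;>
    rcases h.isRay_right.eq_or_eq h' hw with rfl | rfl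
  · exact absurd rfl h.ne
  · exact ⟨rfl, rfl⟩
  · have h1 := h.1
    rw [det_swap, h'.1] at h1; omega
  · exact absurd rfl h.ne

lemma Adj.maximal (hs : Δ.IsSmooth) (hc : ∀ v : Fin 2 → ℝ, ∃ σ ∈ Δ.cones, v ∈ σ)
    {u w : Fin 2 → ℤ} (h : Δ.Adj u w) : Maximal (· ∈ Δ.cones) (cone₂ u w) := by
  refine ⟨h.2, fun σ hσ hle => ?_⟩
  obtain ⟨u', w', h', hle'⟩ := exists_adj_ge hs hc hσ
  obtain ⟨rfl, rfl⟩ := h.eq_of_mem h' (hle' (hle (left_mem_cone₂ u w)))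
    (hle' (hle (right_mem_cone₂ u w)))
  exact hle'

/-- Two rays that are contained in a common cone of the fan generate it. -/
lemma adj_or_adj_of_mem (hs : Δ.IsSmooth) (hc : ∀ v : Fin 2 → ℝ, ∃ σ ∈ Δ.cones, v ∈ σ)
    {v w : Fin 2 → ℤ} (hv : Δ.IsRay v) (hw : Δ.IsRay w) (hne : v ≠ w)
    {σ : PointedCone ℝ (Fin 2 → ℝ)} (hσ : σ ∈ Δ.cones) (hvσ : latticeVec v ∈ σ)
    (hwσ : latticeVec w ∈ σ) :
    (Δ.Adj v w ∧ σ = cone₂ v w) ∨ (Δ.Adj w v ∧ σ = cone₂ w v) := by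
  obtain ⟨x, y, hxy, hle⟩ := exists_adj_ge hs hc hσ
  rcases hv.eq_or_eq hxy (hle hvσ) with rfl | rfl <;>
    rcases hw.eq_or_eq hxy (hle hwσ) with rfl | rfl
  · exact absurd rfl hne
  · exact Or.inl ⟨hxy, le_antisymm hle (cone₂_le hvσ hwσ)⟩
  · exact Or.inr ⟨hxy, le_antisymm hle (cone₂_le hwσ hvσ)⟩
  · exact absurd rfl hne

end Fan

end Plane

/-! ### Generic points of the invariant subvarieties -/

section Generic

variable {n : ℕ} {k : Type} [Field k] {σ τ : PointedCone ℝ (Fin n → ℝ)} {v : Fin n → ℤ}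

namespace AffPoints

/-- For a lattice vector `v` in `σ`, the points of the orbit of the smallest face of `σ` that contains
`v`: the character `χ^m` is `t^m` if `m` is orthogonal to `v`, and `0` otherwise. -/
def generic (hv : latticeVec v ∈ σ) (t : Multiplicative (Fin n → ℤ) →* kˣ) : AffPoints σ k := by
  classical
  exact ofFun (fun m => if (m : Fin n → ℤ) ⬝ᵥ v = 0 then
      (t (Multiplicative.ofAdd (m : Fin n → ℤ)) : k) else 0) (by simp) (by
    intro m m'
    have h := dotProduct_nonneg_of_mem m.2 hv
    have h' := dotProduct_nonneg_of_mem m'.2 hv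
    have e : (((m + m' : dualMonoid σ) : Fin n → ℤ) ⬝ᵥ v = 0) ↔
        ((m : Fin n → ℤ) ⬝ᵥ v = 0 ∧ (m' : Fin n → ℤ) ⬝ᵥ v = 0) := by
      push_cast
      rw [add_dotProduct]
      omega
    simp only [e]
    by_cases h1 : (m : Fin n → ℤ) ⬝ᵥ v = 0 <;> by_cases h2 : (m' : Fin n → ℤ) ⬝ᵥ v = 0 <;>
      simp [h1, h2])

lemma chi_generic_of_eq (hv : latticeVec v ∈ σ) (t : Multiplicative (Fin n → ℤ) →* kˣ)
    {m : dualMonoid σ} (hm : (m : Fin n → ℤ) ⬝ᵥ v = 0) :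
    (generic hv t).chi m = t (Multiplicative.ofAdd (m : Fin n → ℤ)) := by
  simp [generic, hm]

lemma chi_generic_of_ne (hv : latticeVec v ∈ σ) (t : Multiplicative (Fin n → ℤ) →* kˣ)
    {m : dualMonoid σ} (hm : (m : Fin n → ℤ) ⬝ᵥ v ≠ 0) : (generic hv t).chi m = 0 := by
  simp [generic, hm]

lemma translate_generic (hv : latticeVec v ∈ σ) (t t' : Multiplicative (Fin n → ℤ) →* kˣ) :
    (generic hv t).translate t' = generic hv (t' * t) := by
  ext m
  rw [chi_translate]
  by_cases hm : (m : Fin n → ℤ) ⬝ᵥ v = 0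
  · simp [chi_generic_of_eq hv _ hm]
  · simp [chi_generic_of_ne hv _ hm]

lemma restrict_generic (h : τ ≤ σ) (hv : latticeVec v ∈ τ)
    (t : Multiplicative (Fin n → ℤ) →* kˣ) :
    (generic hv t).restrict h = generic (h hv) t := by
  ext m
  rw [chi_restrict]
  by_cases hm : (m : Fin n → ℤ) ⬝ᵥ v = 0
  · rw [chi_generic_of_eq _ _ hm, chi_generic_of_eq hv t (m := ⟨m, _⟩) hm]
  · rw [chi_generic_of_ne _ _ hm, chi_generic_of_ne hv t (m := ⟨m, _⟩) hm]

lemma eval_apply (x : AffPoints σ k) (f : CoordRing σ k) :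
    x.eval f = ∑ m ∈ f.coeff.support, f.coeff m * x.chi m := by
  rw [eval, AddMonoidAlgebra.lift_apply]
  rfl

lemma eval_single (x : AffPoints σ k) (m : dualMonoid σ) (c : k) :
    x.eval (AddMonoidAlgebra.single m c) = c * x.chi m := by
  rw [eval, AddMonoidAlgebra.lift_single]
  rfl

end AffPoints

lemma mk_generic_mem_divisor {Δ : Fan n} (hs : Δ.IsSmooth) {σ : Δ.cones}
    (hv : latticeVec v ∈ σ.1) (t : Multiplicative (Fin n → ℤ) →* kˣ) :
    Points.mk σ (AffPoints.generic hv t) ∈ divisor Δ k v :=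
  (mk_mem_divisor hs).2 ⟨hv, fun _ hm => AffPoints.chi_generic_of_ne hv t hm⟩

lemma mk_generic_eq {Δ : Fan n} {σ τ : Δ.cones} (hσ : latticeVec v ∈ σ.1)
    (hτ : latticeVec v ∈ τ.1) (t : Multiplicative (Fin n → ℤ) →* kˣ) :
    Points.mk σ (AffPoints.generic hσ t) = Points.mk τ (AffPoints.generic hτ t) := by
  let ρ : Δ.cones := ⟨σ.1 ⊓ τ.1, Fan.inf_mem σ.2 τ.2⟩
  have hρ : latticeVec v ∈ ρ.1 := ⟨hσ, hτ⟩
  have h1 := Points.mk_restrict (τ := ρ) (σ := σ) inf_le_left (AffPoints.generic hρ t)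
  have h2 := Points.mk_restrict (τ := ρ) (σ := τ) inf_le_right (AffPoints.generic hρ t)
  rw [AffPoints.restrict_generic] at h1 h2
  rw [h1, h2]

/-- Different elements of `M` are different characters of the complex torus. -/
lemma exists_character_ne {m m' : Fin n → ℤ} (h : m ≠ m') :
    ∃ t : Multiplicative (Fin n → ℤ) →* ℂˣ,
      t (Multiplicative.ofAdd m) ≠ t (Multiplicative.ofAdd m') := by
  obtain ⟨i, hi⟩ := Function.ne_iff.1 h
  let t : Multiplicative (Fin n → ℤ) →* ℂˣ :=
    (zpowersHom ℂˣ (Units.mk0 2 two_ne_zero)).comp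
      (AddMonoidHom.toMultiplicative (Pi.evalAddMonoidHom (fun _ : Fin n => ℤ) i))
  refine ⟨t, fun e => hi ?_⟩
  have e' : ((2 : ℂ)) ^ (m i) = 2 ^ (m' i) := by
    have := congrArg (fun u : ℂˣ => (u : ℂ)) e
    simpa [t, zpowersHom_apply] using this
  have e2 := congrArg norm e'
  rw [norm_zpow, norm_zpow] at e2
  simpa using zpow_right_injective₀ (by simp) (by simp) e2

/-- A function that vanishes at all generic points of `D_v` has no terms that are orthogonal to `v`:
characters of the torus are linearly independent. -/
lemma coeff_eq_zero_of_eval_generic (hv : latticeVec v ∈ σ) {f : CoordRing σ ℂ}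
    (hf : ∀ t, (AffPoints.generic hv t).eval f = 0) (m : dualMonoid σ)
    (hm : (m : Fin n → ℤ) ⬝ᵥ v = 0) : f.coeff m = 0 := by
  classical
  let χ : dualMonoid σ → ((Multiplicative (Fin n → ℤ) →* ℂˣ) →* ℂ) := fun m =>
    { toFun := fun t => t (Multiplicative.ofAdd (m : Fin n → ℤ))
      map_one' := by simp
      map_mul' := by simp }
  have hχ : Function.Injective χ := by
    intro a b hab
    by_contra hne
    obtain ⟨t, ht⟩ := exists_character_ne (fun h => hne (Subtype.ext h) : (a : Fin n → ℤ) ≠ b)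
    exact ht (Units.ext (DFunLike.congr_fun hab t))
  have hli := (linearIndependent_monoidHom (Multiplicative (Fin n → ℤ) →* ℂˣ) ℂ).comp χ hχ
  by_contra hne
  refine hne (linearIndependent_iff'.1 hli
    (f.coeff.support.filter fun m => (m : Fin n → ℤ) ⬝ᵥ v = 0) f.coeff ?_ m (by simp [hne, hm]))
  ext t
  have h := hf t
  rw [AffPoints.eval_apply] at h
  rw [Finset.sum_apply, Finset.sum_filter, Pi.zero_apply]
  refine (Finset.sum_congr rfl fun m _ => ?_).trans h
  split_ifs with h0
  · rw [AffPoints.chi_generic_of_eq _ _ h0]; rfl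
  · rw [AffPoints.chi_generic_of_ne _ _ h0, mul_zero]

lemma eval_eq_zero_of_coeff {x : AffPoints σ k}
    (hx : ∀ m : dualMonoid σ, (m : Fin n → ℤ) ⬝ᵥ v ≠ 0 → x.chi m = 0) {f : CoordRing σ k}
    (hf : ∀ m : dualMonoid σ, (m : Fin n → ℤ) ⬝ᵥ v = 0 → f.coeff m = 0) : x.eval f = 0 := by
  rw [AffPoints.eval_apply]
  refine Finset.sum_eq_zero fun m _ => ?_
  by_cases hm : (m : Fin n → ℤ) ⬝ᵥ v = 0
  · rw [hf m hm, zero_mul]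
  · rw [hx m hm, mul_zero]

/-- The restriction of functions on `U_σ` to the torus of `D_v ∩ U_σ`: the terms that are not
orthogonal to `v` are dropped. -/
def initialForm (hv : latticeVec v ∈ σ) : CoordRing σ k →ₐ[k] AddMonoidAlgebra k (Fin n → ℤ) := by
  classical
  exact AddMonoidAlgebra.lift k _ (dualMonoid σ)
    { toFun := fun m => if (m.toAdd : Fin n → ℤ) ⬝ᵥ v = 0 then
        AddMonoidAlgebra.single (m.toAdd : Fin n → ℤ) 1 else 0
      map_one' := by simp [AddMonoidAlgebra.one_def]
      map_mul' := by
        intro m m'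
        have h := dotProduct_nonneg_of_mem m.toAdd.2 hv
        have h' := dotProduct_nonneg_of_mem m'.toAdd.2 hv
        have e : (((m * m').toAdd : Fin n → ℤ) ⬝ᵥ v = 0) ↔
            ((m.toAdd : Fin n → ℤ) ⬝ᵥ v = 0 ∧ (m'.toAdd : Fin n → ℤ) ⬝ᵥ v = 0) := by
          rw [toAdd_mul]
          push_cast
          rw [add_dotProduct]
          omega
        simp only [e]
        by_cases h1 : (m.toAdd : Fin n → ℤ) ⬝ᵥ v = 0 <;>
          by_cases h2 : (m'.toAdd : Fin n → ℤ) ⬝ᵥ v = 0 <;>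
          simp [h1, h2, AddMonoidAlgebra.single_mul_single] }

lemma initialForm_single (hv : latticeVec v ∈ σ) (m : dualMonoid σ) (c : k)
    [Decidable ((m : Fin n → ℤ) ⬝ᵥ v = 0)] :
    initialForm hv (AddMonoidAlgebra.single m c) =
      if (m : Fin n → ℤ) ⬝ᵥ v = 0 then AddMonoidAlgebra.single (m : Fin n → ℤ) c else 0 := by
  rw [initialForm, AddMonoidAlgebra.lift_single]
  simp only [MonoidHom.coe_mk, OneHom.coe_mk, toAdd_ofAdd]
  split_ifs
  · simp
  · simp

lemma eval_generic (hv : latticeVec v ∈ σ) (t : Multiplicative (Fin n → ℤ) →* kˣ)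
    (f : CoordRing σ k) :
    (AffPoints.generic hv t).eval f =
      AddMonoidAlgebra.lift k k (Fin n → ℤ) ((Units.coeHom k).comp t) (initialForm hv f) := by
  classical
  have : (AffPoints.generic hv t).eval =
      (AddMonoidAlgebra.lift k k (Fin n → ℤ) ((Units.coeHom k).comp t)).comp (initialForm hv) := by
    refine AddMonoidAlgebra.algHom_ext (fun m => ?_) (by ext)
    rw [AffPoints.eval_single, AlgHom.comp_apply, initialForm_single]
    split_ifs with h
    · rw [AffPoints.chi_generic_of_eq _ _ h]; simp
    · rw [AffPoints.chi_generic_of_ne _ _ h]; simp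
  rw [this]; rfl

lemma initialForm_eq_zero (hv : latticeVec v ∈ σ) {f : CoordRing σ k}
    (hf : ∀ m : dualMonoid σ, (m : Fin n → ℤ) ⬝ᵥ v = 0 → f.coeff m = 0) : initialForm hv f = 0 := by
  rw [initialForm, AddMonoidAlgebra.lift_apply]
  refine Finset.sum_eq_zero fun m _ => ?_
  simp only [MonoidHom.coe_mk, OneHom.coe_mk, toAdd_ofAdd]
  split_ifs with h
  · rw [hf m h, zero_smul]
  · rw [smul_zero]

/-- The ideal of `D_v ∩ U_σ` is prime. -/
lemma eval_generic_mul_ne_zero (hv : latticeVec v ∈ σ) {f g : CoordRing σ ℂ}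
    (hf : ∃ t, (AffPoints.generic hv t).eval f ≠ 0) (hg : ∃ t, (AffPoints.generic hv t).eval g ≠ 0) :
    ∃ t, (AffPoints.generic hv t).eval (f * g) ≠ 0 := by
  by_contra! hcon
  have h0 := initialForm_eq_zero hv (coeff_eq_zero_of_eval_generic hv hcon)
  rw [map_mul, mul_eq_zero] at h0
  obtain ⟨t, ht⟩ := hf
  obtain ⟨t', ht'⟩ := hg
  rcases h0 with h | h
  · exact ht (by rw [eval_generic, h, map_zero])
  · exact ht' (by rw [eval_generic, h, map_zero])

end Generic

/-! ### The Zariski topology -/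

section Zariski

variable {n : ℕ} {k : Type} [Field k] {Δ : Fan n} {v : Fin n → ℤ}

lemma AffPoints.isClosed_zariski_iff {σ : PointedCone ℝ (Fin n → ℝ)} {Z : Set (AffPoints σ k)} :
    IsClosed[AffPoints.zariski σ k] Z ↔
      ∃ S : Set (CoordRing σ k), Z = {x | ∀ f ∈ S, x.eval f = 0} := by
  rw [isClosed_induced_iff]
  constructor
  · rintro ⟨T, hT, rfl⟩
    obtain ⟨S, rfl⟩ := (PrimeSpectrum.isClosed_iff_zeroLocus _).1 hT
    exact ⟨S, rfl⟩
  · rintro ⟨S, rfl⟩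
    exact ⟨PrimeSpectrum.zeroLocus S, PrimeSpectrum.isClosed_zeroLocus S, rfl⟩

lemma Points.isClosed_zariski_iff {Z : Set (Points Δ k)} :
    IsClosed[Points.zariski Δ k] Z ↔
      ∀ σ : Δ.cones, ∃ S : Set (CoordRing σ.1 k), Points.mk σ ⁻¹' Z = {x | ∀ f ∈ S, x.eval f = 0} := by
  simp only [isClosed_iSup_iff, isClosed_coinduced, AffPoints.isClosed_zariski_iff]

lemma Points.exists_eval_ne_zero {Z : Set (Points Δ k)} (hZ : IsClosed[Points.zariski Δ k] Z)
    {σ : Δ.cones} {x : AffPoints σ.1 k} (hx : Points.mk σ x ∉ Z) :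
    ∃ f, x.eval f ≠ 0 ∧ ∀ y, Points.mk σ y ∈ Z → y.eval f = 0 := by
  obtain ⟨S, hS⟩ := Points.isClosed_zariski_iff.1 hZ σ
  have hx' : x ∉ {x | ∀ f ∈ S, x.eval f = 0} := by rw [← hS]; exact hx
  simp only [Set.mem_ofPred_eq, not_forall] at hx'
  obtain ⟨f, hf, hne⟩ := hx'
  refine ⟨f, hne, fun y hy => ?_⟩
  have hy' : y ∈ {x | ∀ f ∈ S, x.eval f = 0} := by rw [← hS]; exact hy
  exact hy' f hf

lemma isClosed_divisor (hs : Δ.IsSmooth) (v : Fin n → ℤ) :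
    IsClosed[Points.zariski Δ k] (divisor Δ k v) := by
  rw [Points.isClosed_zariski_iff]
  intro σ
  by_cases hv : latticeVec v ∈ σ.1
  · refine ⟨{f | ∃ m : dualMonoid σ.1, (m : Fin n → ℤ) ⬝ᵥ v ≠ 0 ∧
      f = AddMonoidAlgebra.single m 1}, ?_⟩
    ext x
    rw [Set.mem_preimage, mk_mem_divisor hs]
    constructor
    · rintro ⟨_, h⟩ f ⟨m, hm, rfl⟩
      rw [AffPoints.eval_single, h m hm, mul_zero]
    · intro h
      refine ⟨hv, fun m hm => ?_⟩
      have := h _ ⟨m, hm, rfl⟩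
      rwa [AffPoints.eval_single, one_mul] at this
  · refine ⟨{1}, ?_⟩
    ext x
    rw [Set.mem_preimage, mk_mem_divisor hs]
    simp [hv]

lemma isClosed_singleton_points (hs : Δ.IsSmooth) (p : Points Δ k) :
    IsClosed[Points.zariski Δ k] {p} := by
  rw [Points.isClosed_zariski_iff]
  intro σ
  by_cases hp : ∃ x, Points.mk σ x = p
  · obtain ⟨x, rfl⟩ := hp
    refine ⟨{f | x.eval f = 0}, ?_⟩
    ext y
    rw [Set.mem_preimage, Set.mem_singleton_iff, (Points.mk_injective hs σ).eq_iff]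
    constructor
    · rintro rfl f hf; exact hf
    · intro h
      ext m
      have := h (AddMonoidAlgebra.single m 1 - algebraMap k _ (x.chi m)) (by
        rw [Set.mem_ofPred_eq, map_sub, AffPoints.eval_single, AlgHom.commutes]; simp)
      rw [map_sub, AffPoints.eval_single, AlgHom.commutes, one_mul] at this
      exact sub_eq_zero.1 this
  · refine ⟨{1}, ?_⟩
    ext y
    have : Points.mk σ y ≠ p := fun h => hp ⟨y, h⟩
    simp [this]

/-- The generic points of one chart are dense in `D_v`. -/
lemma divisor_subset_of_generic_mem (hs : Δ.IsSmooth) {Z : Set (Points Δ ℂ)}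
    (hZ : IsClosed[Points.zariski Δ ℂ] Z) {σ : Δ.cones} (hv : latticeVec v ∈ σ.1)
    (h : ∀ t, Points.mk σ (AffPoints.generic hv t) ∈ Z) : divisor Δ ℂ v ⊆ Z := by
  intro p hp
  obtain ⟨τ, x, rfl⟩ := Points.exists_mk p
  obtain ⟨hvτ, hx⟩ := (mk_mem_divisor hs).1 hp
  by_contra hne
  obtain ⟨f, hf, hfZ⟩ := Points.exists_eval_ne_zero hZ hne
  refine hf (eval_eq_zero_of_coeff hx (coeff_eq_zero_of_eval_generic hvτ fun t => hfZ _ ?_))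
  rw [mk_generic_eq hvτ hv]
  exact h t

lemma isIrreducible_divisor (hs : Δ.IsSmooth) {σ : Δ.cones} (hv : latticeVec v ∈ σ.1) :
    @IsIrreducible _ (Points.zariski Δ ℂ) (divisor Δ ℂ v) := by
  let _ := Points.zariski Δ ℂ
  refine ⟨⟨_, mk_generic_mem_divisor hs hv 1⟩, isPreirreducible_iff_isClosed_union_isClosed.2 ?_⟩
  intro Z₁ Z₂ h₁ h₂ hsub
  by_contra! hcon
  have key : ∀ Z : Set (Points Δ ℂ), IsClosed[Points.zariski Δ ℂ] Z → ¬ divisor Δ ℂ v ⊆ Z →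
      ∃ f : CoordRing σ.1 ℂ, (∃ t, (AffPoints.generic hv t).eval f ≠ 0) ∧
        ∀ y, Points.mk σ y ∈ Z → y.eval f = 0 := by
    intro Z hZ hne
    have : ∃ t, Points.mk σ (AffPoints.generic hv t) ∉ Z := by
      by_contra! hall
      exact hne (divisor_subset_of_generic_mem hs hZ hv hall)
    obtain ⟨t, ht⟩ := this
    obtain ⟨f, hf, hfZ⟩ := Points.exists_eval_ne_zero hZ ht
    exact ⟨f, ⟨t, hf⟩, hfZ⟩
  obtain ⟨f, hf, hfZ⟩ := key Z₁ h₁ hcon.1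
  obtain ⟨g, hg, hgZ⟩ := key Z₂ h₂ hcon.2
  obtain ⟨t, ht⟩ := eval_generic_mul_ne_zero hv hf hg
  rw [map_mul] at ht
  rcases hsub (mk_generic_mem_divisor hs hv t) with h | h
  · exact ht (by rw [hfZ _ h, zero_mul])
  · exact ht (by rw [hgZ _ h, mul_zero])

lemma translate_mem_divisor (hs : Δ.IsSmooth) (t : Multiplicative (Fin n → ℤ) →* kˣ)
    {p : Points Δ k} (hp : p ∈ divisor Δ k v) : Points.translate t p ∈ divisor Δ k v := by
  obtain ⟨σ, x, rfl⟩ := Points.exists_mk p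
  obtain ⟨hv, hx⟩ := (mk_mem_divisor hs).1 hp
  refine (mk_mem_divisor hs (x := x.translate t)).2 ⟨hv, fun m hm => ?_⟩
  rw [AffPoints.chi_translate, hx m hm, mul_zero]

end Zariski

/-! ### Curves in a topological space -/

section Dimension

open TopologicalSpace Order

variable {X : Type*} [TopologicalSpace X]

lemma isIrreducible_preimage_val {C Z : Set X} (hZ : IsIrreducible Z) (h : Z ⊆ C) :
    IsIrreducible ((↑) ⁻¹' Z : Set C) := by
  obtain ⟨p, hp⟩ := hZ.1
  refine ⟨⟨⟨p, h hp⟩, hp⟩, isPreirreducible_iff_isClosed_union_isClosed.2 fun A B hA hB hAB => ?_⟩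
  obtain ⟨A', hA', rfl⟩ := isClosed_induced_iff.1 hA
  obtain ⟨B', hB', rfl⟩ := isClosed_induced_iff.1 hB
  have := isPreirreducible_iff_isClosed_union_isClosed.1 hZ.2 A' B' hA' hB' fun z hz =>
    hAB (show (⟨z, h hz⟩ : C) ∈ _ from hz)
  exact this.imp (fun h' z hz => h' hz) (fun h' z hz => h' hz)

/-- An irreducible closed subset of a `T₁` space is one-dimensional if and only if it has more than
one point, but no proper irreducible closed subset has. -/
lemma topologicalKrullDim_eq_one_iff [T1Space X] {C : Set X} (hC : IsClosed C)
    (hirr : IsIrreducible C) :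
    topologicalKrullDim C = 1 ↔
      C.Nontrivial ∧ ∀ Z ⊆ C, IsClosed Z → IsIrreducible Z → Z.Nontrivial → Z = C := by
  have : IrreducibleSpace C := by
    have := isIrreducible_preimage_val hirr subset_rfl
    rw [Subtype.coe_preimage_self] at this
    exact (irreducibleSpace_def C).2 this
  let pt : C → IrreducibleCloseds C := fun p => ⟨{p}, isIrreducible_singleton, isClosed_singleton⟩
  let top : IrreducibleCloseds C := ⟨Set.univ, IrreducibleSpace.isIrreducible_univ C, isClosed_univ⟩
  constructor
  · intro h
    refine ⟨?_, fun Z hZC hZ hZirr hnt => ?_⟩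
    · by_contra hsub
      rw [Set.not_nontrivial_iff] at hsub
      have : Subsingleton (IrreducibleCloseds C) := by
        refine ⟨fun A B => SetLike.coe_injective ?_⟩
        have hs : Subsingleton C := hsub.coe_sort
        have hall : ∀ A : IrreducibleCloseds C, (A : Set C) = Set.univ := fun A => by
          obtain ⟨a, ha⟩ := A.isIrreducible'.nonempty
          exact Set.eq_univ_of_forall fun b => Subsingleton.elim a b ▸ ha
        rw [hall A, hall B]
      have h0 := krullDim_nonpos_of_subsingleton (α := IrreducibleCloseds C)
      have h1 : krullDim (IrreducibleCloseds C) = 1 := h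
      rw [h1] at h0
      exact absurd h0 (by decide)
    · let Z' : IrreducibleCloseds C :=
        ⟨(↑) ⁻¹' Z, isIrreducible_preimage_val hZirr hZC, hZ.preimage continuous_subtype_val⟩
      refine subset_antisymm hZC ?_
      rcases krullDim_le_one_iff.1 (le_of_eq h) Z' with hmin | hmax
      · exfalso
        obtain ⟨p, hp, q, hq, hpq⟩ := hnt
        have h1 : pt ⟨p, hZC hp⟩ ≤ Z' := by
          intro x hx
          have : x = ⟨p, hZC hp⟩ := hx
          rw [this]; exact hp
        have h2 : (⟨q, hZC hq⟩ : C) ∈ pt ⟨p, hZC hp⟩ := hmin h1 (show (⟨q, hZC hq⟩ : C) ∈ Z' from hq)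
        exact hpq (congrArg Subtype.val (show (⟨q, hZC hq⟩ : C) = ⟨p, hZC hp⟩ from h2)).symm
      · intro x hx
        have h1 : Z' ≤ top := fun _ _ => Set.mem_univ _
        exact hmax h1 (show (⟨x, hx⟩ : C) ∈ top from Set.mem_univ _)
  · rintro ⟨⟨p, hp, q, hq, hpq⟩, h⟩
    refine le_antisymm (krullDim_le_one_iff.2 fun Z => ?_) (one_le_krullDim_iff.2 ?_)
    · by_cases hnt : ((↑) '' (Z : Set C) : Set X).Nontrivial
      · right
        have h1 := h _ (Subtype.coe_image_subset C Z)
          (hC.isClosedEmbedding_subtypeVal.isClosedMap _ Z.isClosed')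
          (Z.isIrreducible'.image _ continuous_subtype_val.continuousOn) hnt
        intro Y _ y _
        have : (y : X) ∈ ((↑) '' (Z : Set C) : Set X) := by rw [h1]; exact y.2
        obtain ⟨z, hz, e⟩ := this
        exact Subtype.ext e ▸ hz
      · left
        rw [Set.not_nontrivial_iff] at hnt
        intro Y hYZ z hz
        obtain ⟨y, hy⟩ := Y.isIrreducible'.nonempty
        have : z = y := Subtype.ext (hnt ⟨z, hz, rfl⟩ ⟨y, hYZ hy, rfl⟩)
        exact this ▸ hy
    · refine ⟨pt ⟨p, hp⟩, top, lt_of_le_of_ne (fun _ _ => Set.mem_univ _) fun e => hpq ?_⟩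
      have h2 : (⟨q, hq⟩ : C) ∈ pt ⟨p, hp⟩ := e ▸ Set.mem_univ _
      exact (congrArg Subtype.val (show (⟨q, hq⟩ : C) = ⟨p, hp⟩ from h2)).symm

lemma subsingleton_of_isIrreducible_of_finite [T1Space X] {Z : Set X} (hZ : IsIrreducible Z)
    (hfin : Z.Finite) : Z.Subsingleton := by
  classical
  obtain ⟨z, hz, hsub⟩ := isIrreducible_iff_sUnion_isClosed.1 hZ
    (hfin.toFinset.image fun p => {p}) (by simp) (fun p hp => ⟨{p}, by simpa using hp, rfl⟩)
  simp only [Finset.mem_image] at hz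
  obtain ⟨p, _, rfl⟩ := hz
  exact Set.subsingleton_singleton.anti hsub

end Dimension

/-! ### Coordinates on the two-dimensional charts -/

section Coordinates

variable {k : Type} [Field k] {u w : Fin 2 → ℤ}

/-- The coordinate of the chart of `cone₂ u w` that vanishes along the divisor of `u`. -/
def fstChar (h : det u w = 1) : dualMonoid (cone₂ u w) :=
  ⟨-perp w, mem_dualMonoid_cone₂.2 (by
    rw [neg_perp_dotProduct, neg_perp_dotProduct, h, Fan.det_self]; simp)⟩

/-- The coordinate of the chart of `cone₂ u w` that vanishes along the divisor of `w`. -/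
def sndChar (h : det u w = 1) : dualMonoid (cone₂ u w) :=
  ⟨perp u, mem_dualMonoid_cone₂.2 (by
    rw [perp_dotProduct, perp_dotProduct, h, Fan.det_self]; simp)⟩

lemma coe_fstChar (h : det u w = 1) : (fstChar h : Fin 2 → ℤ) = -perp w := rfl

lemma coe_sndChar (h : det u w = 1) : (sndChar h : Fin 2 → ℤ) = perp u := rfl

lemma fstChar_dot_left (h : det u w = 1) : (fstChar h : Fin 2 → ℤ) ⬝ᵥ u = 1 := by
  rw [coe_fstChar, neg_perp_dotProduct, h]

lemma fstChar_dot_right (h : det u w = 1) : (fstChar h : Fin 2 → ℤ) ⬝ᵥ w = 0 := by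
  rw [coe_fstChar, neg_perp_dotProduct, Fan.det_self]

lemma sndChar_dot_left (h : det u w = 1) : (sndChar h : Fin 2 → ℤ) ⬝ᵥ u = 0 := by
  rw [coe_sndChar, perp_dotProduct, Fan.det_self]

lemma sndChar_dot_right (h : det u w = 1) : (sndChar h : Fin 2 → ℤ) ⬝ᵥ w = 1 := by
  rw [coe_sndChar, perp_dotProduct, h]

lemma dot_left_nonneg (m : dualMonoid (cone₂ u w)) : 0 ≤ (m : Fin 2 → ℤ) ⬝ᵥ u :=
  dotProduct_nonneg_of_mem m.2 (left_mem_cone₂ u w)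

lemma dot_right_nonneg (m : dualMonoid (cone₂ u w)) : 0 ≤ (m : Fin 2 → ℤ) ⬝ᵥ w :=
  dotProduct_nonneg_of_mem m.2 (right_mem_cone₂ u w)

/-- The point of the chart of `cone₂ u w` with coordinates `x` and `y`. -/
def chartPt (u w : Fin 2 → ℤ) (x y : k) : AffPoints (cone₂ u w) k :=
  AffPoints.ofFun (fun m => x ^ ((m : Fin 2 → ℤ) ⬝ᵥ u).toNat * y ^ ((m : Fin 2 → ℤ) ⬝ᵥ w).toNat)
    (by simp) (fun m m' => by
      push_cast
      rw [add_dotProduct, add_dotProduct, Int.toNat_add (dot_left_nonneg m) (dot_left_nonneg m'),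
        Int.toNat_add (dot_right_nonneg m) (dot_right_nonneg m'), pow_add, pow_add]
      ring)

lemma chi_chartPt (x y : k) (m : dualMonoid (cone₂ u w)) :
    (chartPt u w x y).chi m =
      x ^ ((m : Fin 2 → ℤ) ⬝ᵥ u).toNat * y ^ ((m : Fin 2 → ℤ) ⬝ᵥ w).toNat := rfl

lemma chi_fstChar_chartPt (h : det u w = 1) (x y : k) :
    (chartPt u w x y).chi (fstChar h) = x := by
  rw [chi_chartPt, fstChar_dot_left, fstChar_dot_right]; simp

lemma chi_sndChar_chartPt (h : det u w = 1) (x y : k) :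
    (chartPt u w x y).chi (sndChar h) = y := by
  rw [chi_chartPt, sndChar_dot_left, sndChar_dot_right]; simp

/-- A point of the chart is determined by its two coordinates, since these generate the characters. -/
lemma eq_chartPt (h : det u w = 1) (p : AffPoints (cone₂ u w) k) :
    p = chartPt u w (p.chi (fstChar h)) (p.chi (sndChar h)) := by
  ext m
  have e : m = ((m : Fin 2 → ℤ) ⬝ᵥ u).toNat • fstChar h +
      ((m : Fin 2 → ℤ) ⬝ᵥ w).toNat • sndChar h := by
    ext1
    push_cast
    rw [coe_fstChar, coe_sndChar, ← natCast_zsmul, ← natCast_zsmul,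
      Int.toNat_of_nonneg (dot_left_nonneg m), Int.toNat_of_nonneg (dot_right_nonneg m)]
    exact dotProduct_perp h m
  conv_lhs => rw [e]
  rw [AffPoints.chi_add, AffPoints.chi_nsmul, AffPoints.chi_nsmul, chi_chartPt]

variable {Δ : Fan 2}

/-- The chart of the cone generated by `u` and `w`, in coordinates. -/
def Fan.Adj.pt (h : Δ.Adj u w) (x y : k) : Points Δ k :=
  Points.mk ⟨cone₂ u w, h.2⟩ (chartPt u w x y)

lemma Fan.Adj.pt_mem_divisor_left (hs : Δ.IsSmooth) (h : Δ.Adj u w) {x y : k} :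
    h.pt x y ∈ divisor Δ k u ↔ x = 0 := by
  rw [Fan.Adj.pt, mk_mem_divisor hs]
  constructor
  · intro hx
    have := hx.2 (fstChar h.1) (by rw [fstChar_dot_left]; simp)
    rwa [chi_fstChar_chartPt] at this
  · rintro rfl
    refine ⟨left_mem_cone₂ u w, fun m hm => ?_⟩
    rw [chi_chartPt, zero_pow, zero_mul]
    have := dot_left_nonneg m
    omega

lemma Fan.Adj.pt_mem_divisor_right (hs : Δ.IsSmooth) (h : Δ.Adj u w) {x y : k} :
    h.pt x y ∈ divisor Δ k w ↔ y = 0 := by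
  rw [Fan.Adj.pt, mk_mem_divisor hs]
  constructor
  · intro hx
    have := hx.2 (sndChar h.1) (by rw [sndChar_dot_right]; simp)
    rwa [chi_sndChar_chartPt] at this
  · rintro rfl
    refine ⟨right_mem_cone₂ u w, fun m hm => ?_⟩
    rw [chi_chartPt, zero_pow, mul_zero]
    have := dot_right_nonneg m
    omega

lemma Fan.Adj.pt_injective (hs : Δ.IsSmooth) (h : Δ.Adj u w) {x y x' y' : k}
    (e : h.pt x y = h.pt x' y') : x = x' ∧ y = y' := by
  have := Points.mk_injective hs _ e
  constructor
  · rw [← chi_fstChar_chartPt h.1 x y, this, chi_fstChar_chartPt]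
  · rw [← chi_sndChar_chartPt h.1 x y, this, chi_sndChar_chartPt]

lemma Points.exists_pt (hs : Δ.IsSmooth) (hc : ∀ v : Fin 2 → ℝ, ∃ σ ∈ Δ.cones, v ∈ σ)
    (p : Points Δ k) : ∃ (u w : Fin 2 → ℤ) (h : Δ.Adj u w) (x y : k), h.pt x y = p := by
  obtain ⟨⟨σ, hσ⟩, x, hmax, rfl⟩ := Points.exists_mk_maximal p
  obtain ⟨u, w, h, rfl⟩ := Fan.exists_adj_of_maximal hs hc hmax
  exact ⟨u, w, h, _, _, by rw [Fan.Adj.pt, ← eq_chartPt h.1]⟩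

/-- A point of the divisor of a ray lies in one of the two charts of the adjacent cones. -/
lemma exists_pt_of_mem_divisor (hs : Δ.IsSmooth) (hc : ∀ v : Fin 2 → ℝ, ∃ σ ∈ Δ.cones, v ∈ σ)
    {u v w : Fin 2 → ℤ} (huv : Δ.Adj u v) (hvw : Δ.Adj v w) {p : Points Δ k}
    (hp : p ∈ divisor Δ k v) : (∃ c, huv.pt c 0 = p) ∨ ∃ c, hvw.pt 0 c = p := by
  obtain ⟨a, b, h, x, y, rfl⟩ := Points.exists_pt hs hc p
  have hv := ((mk_mem_divisor hs).1 hp).1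
  rcases hvw.isRay_left.eq_or_eq h hv with rfl | rfl
  · obtain rfl := h.right_unique hvw
    rw [h.pt_mem_divisor_left hs] at hp
    exact Or.inr ⟨y, by rw [hp]⟩
  · obtain rfl := h.left_unique huv
    rw [h.pt_mem_divisor_right hs] at hp
    exact Or.inl ⟨x, by rw [hp]⟩

/-- The element of the torus with coordinates `a` and `b`. -/
def torusPt (u w : Fin 2 → ℤ) (a b : kˣ) : Multiplicative (Fin 2 → ℤ) →* kˣ where
  toFun m := a ^ (m.toAdd ⬝ᵥ u) * b ^ (m.toAdd ⬝ᵥ w)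
  map_one' := by simp
  map_mul' m m' := by
    rw [toAdd_mul, add_dotProduct, add_dotProduct, zpow_add, zpow_add, mul_mul_mul_comm]

lemma torusPt_apply (a b : kˣ) (m : dualMonoid (cone₂ u w)) :
    ((torusPt u w a b (Multiplicative.ofAdd (m : Fin 2 → ℤ)) : kˣ) : k) =
      (a : k) ^ ((m : Fin 2 → ℤ) ⬝ᵥ u).toNat * (b : k) ^ ((m : Fin 2 → ℤ) ⬝ᵥ w).toNat := by
  have e1 := Int.toNat_of_nonneg (dot_left_nonneg m)
  have e2 := Int.toNat_of_nonneg (dot_right_nonneg m)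
  generalize ((m : Fin 2 → ℤ) ⬝ᵥ u).toNat = A at e1 ⊢
  generalize ((m : Fin 2 → ℤ) ⬝ᵥ w).toNat = B at e2 ⊢
  conv_lhs => rw [torusPt]
  simp only [MonoidHom.coe_mk, OneHom.coe_mk, toAdd_ofAdd]
  rw [← e1, ← e2, zpow_natCast, zpow_natCast, Units.val_mul, Units.val_pow_eq_pow_val,
    Units.val_pow_eq_pow_val]

lemma chartPt_eq_generic_zero (h : latticeVec 0 ∈ cone₂ u w) (a b : kˣ) :
    chartPt u w (a : k) b = AffPoints.generic h (torusPt u w a b) := by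
  ext m
  rw [AffPoints.chi_generic_of_eq _ _ (by simp), torusPt_apply, chi_chartPt]

lemma chartPt_eq_generic_left (a : kˣ) :
    chartPt u w 0 (a : k) = AffPoints.generic (left_mem_cone₂ u w) (torusPt u w 1 a) := by
  ext m
  have := dot_left_nonneg m
  by_cases hm : (m : Fin 2 → ℤ) ⬝ᵥ u = 0
  · rw [AffPoints.chi_generic_of_eq _ _ hm, torusPt_apply, chi_chartPt, hm]
    simp
  · rw [AffPoints.chi_generic_of_ne _ _ hm, chi_chartPt, zero_pow (by omega), zero_mul]

lemma chartPt_eq_generic_right (a : kˣ) :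
    chartPt u w (a : k) 0 = AffPoints.generic (right_mem_cone₂ u w) (torusPt u w a 1) := by
  ext m
  have := dot_right_nonneg m
  by_cases hm : (m : Fin 2 → ℤ) ⬝ᵥ w = 0
  · rw [AffPoints.chi_generic_of_eq _ _ hm, torusPt_apply, chi_chartPt, hm]
    simp
  · rw [AffPoints.chi_generic_of_ne _ _ hm, chi_chartPt, zero_pow (by omega), mul_zero]

end Coordinates

/-! ### The invariant curves -/

section Curves

variable {Δ : Fan 2} {u v w : Fin 2 → ℤ}

lemma divisor_nontrivial (hs : Δ.IsSmooth) (hv : Δ.IsRay v) : (divisor Δ ℂ v).Nontrivial := by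
  rcases hv with ⟨w, h⟩ | ⟨w, h⟩
  · refine ⟨h.pt 0 0, (h.pt_mem_divisor_left hs).2 rfl, h.pt 0 1, (h.pt_mem_divisor_left hs).2 rfl,
      fun e => ?_⟩
    simpa using (h.pt_injective hs e).2
  · refine ⟨h.pt 0 0, (h.pt_mem_divisor_right hs).2 rfl, h.pt 1 0,
      (h.pt_mem_divisor_right hs).2 rfl, fun e => ?_⟩
    simpa using (h.pt_injective hs e).1

lemma Fan.IsRay.exists_cone_mem (hv : Δ.IsRay v) : ∃ σ : Δ.cones, latticeVec v ∈ σ.1 := by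
  rcases hv with ⟨w, h⟩ | ⟨w, h⟩
  · exact ⟨⟨_, h.2⟩, left_mem_cone₂ v w⟩
  · exact ⟨⟨_, h.2⟩, right_mem_cone₂ w v⟩

/-- A function that does not vanish identically on a coordinate axis has finitely many zeros on it. -/
lemma finite_zeros_of_monomial {σ : PointedCone ℝ (Fin 2 → ℝ)} {x : ℂ → AffPoints σ ℂ}
    {δ : dualMonoid σ → ℂ} {e : dualMonoid σ → ℕ} (hx : ∀ c m, (x c).chi m = δ m * c ^ e m)
    {f : CoordRing σ ℂ} {c₀ : ℂ} (h₀ : (x c₀).eval f ≠ 0) : {c | (x c).eval f = 0}.Finite := by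
  let P : Polynomial ℂ := ∑ m ∈ f.coeff.support, Polynomial.C (f.coeff m * δ m) * Polynomial.X ^ e m
  have hP : ∀ c, P.eval c = (x c).eval f := by
    intro c
    rw [AffPoints.eval_apply, Polynomial.eval_finsetSum]
    refine Finset.sum_congr rfl fun m _ => ?_
    rw [hx]
    simp [mul_assoc]
  have hP0 : P ≠ 0 := by
    rintro h
    rw [← hP, h, Polynomial.eval_zero] at h₀
    exact h₀ rfl
  refine (P.roots.toFinset.finite_toSet).subset fun c hc => ?_
  have hc' : (x c).eval f = 0 := hc
  simp [hP0, hP, hc']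

/-- A proper closed subset of the divisor of a ray is finite: the divisor is covered by two lines, on
which functions restrict to polynomials in one variable. -/
lemma finite_of_ssubset_divisor (hs : Δ.IsSmooth) (hc : ∀ v : Fin 2 → ℝ, ∃ σ ∈ Δ.cones, v ∈ σ)
    (hv : Δ.IsRay v) {Z : Set (Points Δ ℂ)} (hZ : IsClosed[Points.zariski Δ ℂ] Z)
    (hsub : Z ⊆ divisor Δ ℂ v) (hne : ¬ divisor Δ ℂ v ⊆ Z) : Z.Finite := by
  obtain ⟨w, hvw⟩ := hv.exists_adj_right hs hc
  obtain ⟨u, huv⟩ := hv.exists_adj_left hs hc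
  have key : ∀ (σ : Δ.cones) (x : ℂ → AffPoints σ.1 ℂ) (δ : dualMonoid σ.1 → ℂ)
      (e : dualMonoid σ.1 → ℕ) (_ : ∀ c m, (x c).chi m = δ m * c ^ e m)
      (hvσ : latticeVec v ∈ σ.1) (_ : ∀ y, Points.mk σ y ∈ divisor Δ ℂ v → ∃ c, y = x c),
      {p | p ∈ Z ∧ ∃ c, Points.mk σ (x c) = p}.Finite := by
    intro σ x δ e hx hvσ hsurj
    have : ∃ t, Points.mk σ (AffPoints.generic hvσ t) ∉ Z := by
      by_contra! hall
      exact hne (divisor_subset_of_generic_mem hs hZ hvσ hall)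
    obtain ⟨t, ht⟩ := this
    obtain ⟨f, hf, hfZ⟩ := Points.exists_eval_ne_zero hZ ht
    obtain ⟨c₀, hc₀⟩ := hsurj _ (mk_generic_mem_divisor hs hvσ t)
    rw [hc₀] at hf
    refine ((finite_zeros_of_monomial hx hf).image fun c => Points.mk σ (x c)).subset ?_
    rintro p ⟨hp, c, rfl⟩
    exact ⟨c, hfZ _ hp, rfl⟩
  have f1 := key ⟨_, hvw.2⟩ (fun c => chartPt v w 0 c) (fun m => 0 ^ ((m : Fin 2 → ℤ) ⬝ᵥ v).toNat)
    (fun m => ((m : Fin 2 → ℤ) ⬝ᵥ w).toNat) (fun c m => chi_chartPt _ _ _) (left_mem_cone₂ v w) (by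
      intro y hy
      have e := eq_chartPt hvw.1 y
      rw [e] at hy
      rw [(hvw.pt_mem_divisor_left hs).1 hy] at e
      exact ⟨_, e⟩)
  have f2 := key ⟨_, huv.2⟩ (fun c => chartPt u v c 0) (fun m => 0 ^ ((m : Fin 2 → ℤ) ⬝ᵥ v).toNat)
    (fun m => ((m : Fin 2 → ℤ) ⬝ᵥ u).toNat)
    (fun c m => by rw [chi_chartPt, mul_comm]) (right_mem_cone₂ u v) (by
      intro y hy
      have e := eq_chartPt huv.1 y
      rw [e] at hy
      rw [(huv.pt_mem_divisor_right hs).1 hy] at e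
      exact ⟨_, e⟩)
  refine (f1.union f2).subset fun p hp => ?_
  rcases exists_pt_of_mem_divisor hs hc huv hvw (hsub hp) with h | h
  · exact Or.inr ⟨hp, h⟩
  · exact Or.inl ⟨hp, h⟩

lemma t1Space_zariski {n : ℕ} {Δ : Fan n} (hs : Δ.IsSmooth) :
    @T1Space (Points Δ ℂ) (Points.zariski Δ ℂ) :=
  @T1Space.mk _ (Points.zariski Δ ℂ) (isClosed_singleton_points hs)

lemma isInvariantCurve_divisor (hs : Δ.IsSmooth) (hc : ∀ v : Fin 2 → ℝ, ∃ σ ∈ Δ.cones, v ∈ σ)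
    (hv : Δ.IsRay v) : IsInvariantCurve Δ (divisor Δ ℂ v) := by
  obtain ⟨σ, hσ⟩ := hv.exists_cone_mem
  refine ⟨isClosed_divisor hs v, isIrreducible_divisor hs hσ, ?_,
    fun t p hp => translate_mem_divisor hs t hp⟩
  refine (@topologicalKrullDim_eq_one_iff _ (Points.zariski Δ ℂ) (t1Space_zariski hs) _
    (isClosed_divisor hs v) (isIrreducible_divisor hs hσ)).2 ⟨divisor_nontrivial hs hv, ?_⟩
  intro Z hZC hZ hirr hnt
  refine subset_antisymm hZC ?_
  by_contra hne
  exact (Set.not_nontrivial_iff.2 (@subsingleton_of_isIrreducible_of_finite _ (Points.zariski Δ ℂ)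
    (t1Space_zariski hs) _ hirr (finite_of_ssubset_divisor hs hc hv hZ hZC hne))) hnt

lemma divisor_zero (Δ : Fan 2) : divisor Δ ℂ 0 = Set.univ := by
  ext p
  simp [divisor]

/-- The invariant curves are the divisors of the rays of the fan. -/
lemma IsInvariantCurve.exists_eq_divisor (hs : Δ.IsSmooth)
    (hc : ∀ v : Fin 2 → ℝ, ∃ σ ∈ Δ.cones, v ∈ σ) {C : Set (Points Δ ℂ)}
    (hC : IsInvariantCurve Δ C) : ∃ v, Δ.IsRay v ∧ C = divisor Δ ℂ v := by
  obtain ⟨hnt, hdim⟩ := (@topologicalKrullDim_eq_one_iff _ (Points.zariski Δ ℂ)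
    (t1Space_zariski hs) _ hC.isClosed hC.irreducible).1 hC.dim_eq_one
  -- an orbit that meets `C` is contained in `C`, hence so is its closure
  have horbit : ∀ (v : Fin 2 → ℤ) (σ : Δ.cones) (hv : latticeVec v ∈ σ.1)
      (t : Multiplicative (Fin 2 → ℤ) →* ℂˣ), Points.mk σ (AffPoints.generic hv t) ∈ C →
      (divisor Δ ℂ v).Nontrivial → divisor Δ ℂ v = C := by
    intro v σ hv t ht hnt'
    refine hdim _ (divisor_subset_of_generic_mem hs hC.isClosed hv fun t' => ?_)
      (isClosed_divisor hs v) (isIrreducible_divisor hs hv) hnt'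
    have h1 := hC.invariant (t' * t⁻¹) _ ht
    have h2 : Points.translate (t' * t⁻¹) (Points.mk σ (AffPoints.generic hv t)) =
        Points.mk σ ((AffPoints.generic hv t).translate (t' * t⁻¹)) := rfl
    have h3 : t' * t⁻¹ * t = t' := by ext m; simp
    rw [h2, AffPoints.translate_generic, h3] at h1
    exact h1
  by_contra! hcon
  -- so if `C` is not the divisor of a ray, it consists of fixed points, and there are only
  -- finitely many of them
  have hfix : ∀ p ∈ C, ∃ (u w : Fin 2 → ℤ) (h : Δ.Adj u w), h.pt 0 0 = p := by
    intro p hp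
    obtain ⟨u, w, h, x, y, rfl⟩ := Points.exists_pt hs hc p
    by_cases hx : x = 0 <;> by_cases hy : y = 0
    · exact ⟨u, w, h, by rw [hx, hy]⟩
    · exfalso
      obtain ⟨b, rfl⟩ : ∃ b : ℂˣ, (b : ℂ) = y := ⟨Units.mk0 y hy, rfl⟩
      rw [hx, Fan.Adj.pt, chartPt_eq_generic_left] at hp
      exact hcon u h.isRay_left (horbit u _ _ _ hp (divisor_nontrivial hs h.isRay_left)).symm
    · exfalso
      obtain ⟨a, rfl⟩ : ∃ a : ℂˣ, (a : ℂ) = x := ⟨Units.mk0 x hx, rfl⟩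
      rw [hy, Fan.Adj.pt, chartPt_eq_generic_right] at hp
      exact hcon w h.isRay_right (horbit w _ _ _ hp (divisor_nontrivial hs h.isRay_right)).symm
    · exfalso
      obtain ⟨a, rfl⟩ : ∃ a : ℂˣ, (a : ℂ) = x := ⟨Units.mk0 x hx, rfl⟩
      obtain ⟨b, rfl⟩ : ∃ b : ℂˣ, (b : ℂ) = y := ⟨Units.mk0 y hy, rfl⟩
      have h0 : latticeVec 0 ∈ cone₂ u w := by rw [latticeVec_zero]; exact zero_mem _
      rw [Fan.Adj.pt, chartPt_eq_generic_zero h0] at hp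
      have hnt' := divisor_nontrivial hs h.isRay_left
      have huniv := horbit 0 _ _ _ hp (by rw [divisor_zero]; exact hnt'.mono (Set.subset_univ _))
      rw [divisor_zero] at huniv
      refine hcon u h.isRay_left (hdim _ (huniv ▸ Set.subset_univ _) (isClosed_divisor hs u) ?_ hnt').symm
      exact isIrreducible_divisor hs (σ := ⟨_, h.2⟩) (left_mem_cone₂ u w)
  have hfin : C.Finite := by
    have : Finite Δ.cones := Δ.finite
    have hpt : ∀ (u w u' w' : Fin 2 → ℤ) (h : Δ.Adj u w) (h' : Δ.Adj u' w'), u = u' → w = w' →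
        h.pt (0 : ℂ) 0 = h'.pt 0 0 := by
      rintro u w _ _ h h' rfl rfl; rfl
    choose u w h e using hfix
    refine Set.finite_coe_iff.1 (Finite.of_injective
      (fun p : C => (⟨cone₂ (u p p.2) (w p p.2), (h p p.2).2⟩ : Δ.cones)) fun p q hpq => ?_)
    have hpq' : cone₂ (u p p.2) (w p p.2) = cone₂ (u q q.2) (w q q.2) := congrArg Subtype.val hpq
    obtain ⟨e1, e2⟩ := (h p p.2).eq_of_mem (h q q.2) (hpq' ▸ left_mem_cone₂ _ _)
      (hpq' ▸ right_mem_cone₂ _ _)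
    exact Subtype.ext ((e p p.2).symm.trans ((hpt _ _ _ _ _ _ e1 e2).trans (e q q.2)))
  exact (Set.not_nontrivial_iff.2 (@subsingleton_of_isIrreducible_of_finite _ (Points.zariski Δ ℂ)
    (t1Space_zariski hs) _ hC.irreducible hfin)) hnt

end Curves

/-! ### Orders of characters along the invariant curves -/

section Orders

variable {n : ℕ} {Δ : Fan n} {v : Fin n → ℤ}

lemma mem_idealOf_iff {C : Set (Points Δ ℂ)} {σ : Δ.cones} {f : CoordRing σ.1 ℂ} :
    f ∈ idealOf C σ ↔ ∀ x, Points.mk σ x ∈ C → x.eval f = 0 := by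
  simp [idealOf]

/-- The ideal of `D_v` is spanned by the characters that are not orthogonal to `v`. -/
lemma mem_idealOf_divisor (hs : Δ.IsSmooth) {σ : Δ.cones} (hv : latticeVec v ∈ σ.1)
    {f : CoordRing σ.1 ℂ} :
    f ∈ idealOf (divisor Δ ℂ v) σ ↔
      ∀ m : dualMonoid σ.1, (m : Fin n → ℤ) ⬝ᵥ v = 0 → f.coeff m = 0 := by
  rw [mem_idealOf_iff]
  exact ⟨fun h => coeff_eq_zero_of_eval_generic hv fun t => h _ (mk_generic_mem_divisor hs hv t),
    fun h x hx => eval_eq_zero_of_coeff ((mk_mem_divisor hs).1 hx).2 h⟩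

/-- Elements of the `j`-th power of the ideal of `D_v` only have terms of order at least `j`. -/
lemma le_dotProduct_of_mem_pow (hs : Δ.IsSmooth) {σ : Δ.cones} (hv : latticeVec v ∈ σ.1) (j : ℕ)
    {f : CoordRing σ.1 ℂ} (hf : f ∈ idealOf (divisor Δ ℂ v) σ ^ j) (m : dualMonoid σ.1)
    (hm : f.coeff m ≠ 0) : (j : ℤ) ≤ (m : Fin n → ℤ) ⬝ᵥ v := by
  classical
  induction j generalizing f m with
  | zero => simpa using dotProduct_nonneg_of_mem m.2 hv
  | succ j ih =>
    rw [pow_succ] at hf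
    induction hf using Submodule.mul_induction_on' generalizing m with
    | mem_mul_mem a ha b hb =>
      have h1 := AddMonoidAlgebra.support_coeff_mul_subset a b (Finsupp.mem_support_iff.2 hm)
      obtain ⟨m₁, h₁, m₂, h₂, rfl⟩ := Finset.mem_add.1 h1
      have h3 := ih ha m₁ (Finsupp.mem_support_iff.1 h₁)
      have h4 : (m₂ : Fin n → ℤ) ⬝ᵥ v ≠ 0 := fun h0 =>
        Finsupp.mem_support_iff.1 h₂ ((mem_idealOf_divisor hs hv).1 hb m₂ h0)
      have h5 := dotProduct_nonneg_of_mem m₂.2 hv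
      push_cast
      rw [add_dotProduct]
      omega
    | add a _ b _ iha ihb =>
      by_cases h : a.coeff m = 0
      · refine ihb m fun h' => hm ?_
        simp [h, h']
      · exact iha m h

/-- If `χ^{m₀}` is an equation of `D_v` on a chart, the characters of order `j` lie in the `j`-th
power of its ideal. -/
lemma single_mem_pow (hs : Δ.IsSmooth) {σ : Δ.cones} (hv : latticeVec v ∈ σ.1)
    {m₀ : dualMonoid σ.1} (h₀ : (m₀ : Fin n → ℤ) ⬝ᵥ v = 1)
    (hsub : ∀ m ∈ dualMonoid σ.1, m ⬝ᵥ v ≠ 0 → m - m₀ ∈ dualMonoid σ.1) (j : ℕ)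
    (m : dualMonoid σ.1) (hm : (m : Fin n → ℤ) ⬝ᵥ v = j) :
    (AddMonoidAlgebra.single m 1 : CoordRing σ.1 ℂ) ∈ idealOf (divisor Δ ℂ v) σ ^ j := by
  classical
  induction j generalizing m with
  | zero => simp
  | succ j ih =>
    have hm' := hsub m m.2 (by rw [hm]; positivity)
    have e : (AddMonoidAlgebra.single m 1 : CoordRing σ.1 ℂ) =
        AddMonoidAlgebra.single ⟨_, hm'⟩ 1 * AddMonoidAlgebra.single m₀ 1 := by
      rw [AddMonoidAlgebra.single_mul_single, one_mul]
      congr 1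
      ext1; simp
    rw [e, pow_succ]
    refine Ideal.mul_mem_mul (ih _ ?_) ((mem_idealOf_divisor hs hv).2 fun m' h' => ?_)
    · simp only [sub_dotProduct, hm, h₀]; push_cast; ring
    · rw [AddMonoidAlgebra.coeff_single, Finsupp.single_apply, if_neg]
      rintro rfl
      rw [h₀] at h'
      exact one_ne_zero h'

/-- The order of `χ^m` along `D_v` in a chart is `⟨m, v⟩`, as a power of the local equation `χ^{m₀}`
times a function that does not vanish on `D_v`. -/
lemma chartOrder_single (hs : Δ.IsSmooth) {σ : Δ.cones} (hv : latticeVec v ∈ σ.1)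
    {m₀ : dualMonoid σ.1} (h₀ : (m₀ : Fin n → ℤ) ⬝ᵥ v = 1)
    (hsub : ∀ m ∈ dualMonoid σ.1, m ⬝ᵥ v ≠ 0 → m - m₀ ∈ dualMonoid σ.1) (m : dualMonoid σ.1) :
    (chartOrder (divisor Δ ℂ v) σ (AddMonoidAlgebra.single m 1) : ℤ) = (m : Fin n → ℤ) ⬝ᵥ v := by
  obtain ⟨j, hj⟩ := Int.eq_ofNat_of_zero_le (dotProduct_nonneg_of_mem m.2 hv)
  rw [hj, Nat.cast_inj]
  refine IsGreatest.csSup_eq ⟨⟨1, ?_, ?_⟩, ?_⟩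
  · rw [mem_idealOf_divisor hs hv]
    intro h
    have := h 0 (by simp)
    simp [AddMonoidAlgebra.one_def] at this
  · rw [one_mul]; exact single_mem_pow hs hv h₀ hsub j m hj
  · rintro i ⟨s, hsI, hi⟩
    rw [mem_idealOf_divisor hs hv] at hsI
    push Not at hsI
    obtain ⟨m', h', hne⟩ := hsI
    have := le_dotProduct_of_mem_pow hs hv i hi (m' + m) (by
      rw [AddMonoidAlgebra.coeff_mul_single_add, mul_one]; exact hne)
    push_cast at this
    rw [add_dotProduct, h', hj] at this
    omega

end Orders

section PlaneOrders

variable {Δ : Fan 2} {u v w : Fin 2 → ℤ}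

/-- If `p`, `q` are coordinates dual to generators `a`, `b` of `τ`, and `a` lies in the face `σ`, then
`χ^p` divides in `ℂ[S_σ]` every character that is not orthogonal to `a`. -/
lemma exists_local_equation_of_isFaceOf {σ τ : PointedCone ℝ (Fin 2 → ℝ)} (hf : σ.IsFaceOf τ)
    {a b p q : Fin 2 → ℤ} (ha : latticeVec a ∈ τ) (hb : latticeVec b ∈ τ)
    (haσ : latticeVec a ∈ σ) (hp : p ∈ dualMonoid τ) (hq : q ∈ dualMonoid τ)
    (hexp : ∀ s : Fin 2 → ℝ, s = pairing p s • latticeVec a + pairing q s • latticeVec b)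
    (hpa : p ⬝ᵥ a = 1) :
    ∃ m₀ : dualMonoid σ, (m₀ : Fin 2 → ℤ) ⬝ᵥ a = 1 ∧
      ∀ m ∈ dualMonoid σ, m ⬝ᵥ a ≠ 0 → m - m₀ ∈ dualMonoid σ := by
  refine ⟨⟨p, dualMonoid_anti hf.le hp⟩, hpa, fun m hm hne s hs => ?_⟩
  have h1 := hp s (hf.le hs)
  have h2 := hq s (hf.le hs)
  have h3 : (1 : ℝ) ≤ (m ⬝ᵥ a : ℤ) := by
    have := dotProduct_nonneg_of_mem hm haσ
    exact_mod_cast (by omega : 1 ≤ m ⬝ᵥ a)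
  have hms : pairing m s = pairing p s * (m ⬝ᵥ a : ℤ) + pairing q s * (m ⬝ᵥ b : ℤ) := by
    conv_lhs => rw [hexp s]
    rw [pairing_add, pairing_smul, pairing_smul, pairing_latticeVec, pairing_latticeVec]
  have h4 : 0 ≤ pairing q s * (m ⬝ᵥ b : ℤ) := by
    rcases h2.eq_or_lt with h | h
    · rw [← h, zero_mul]
    · refine mul_nonneg h2 ?_
      have hbσ : latticeVec b ∈ σ := by
        refine hf.mem_of_smul_add_mem (y := pairing p s • latticeVec a) hb
          (PointedCone.smul_mem _ h1 ha) h ?_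
        rw [add_comm, ← hexp s]; exact hs
      exact_mod_cast dotProduct_nonneg_of_mem hm hbσ
  change 0 ≤ pairing (m - p) s
  rw [sub_pairing, hms]
  nlinarith

lemma eq_pairing_smul_add (h : det u w = 1) (s : Fin 2 → ℝ) :
    s = pairing (-perp w) s • latticeVec u + pairing (perp u) s • latticeVec w := by
  have h' : (u 0 : ℝ) * w 1 - u 1 * w 0 = 1 := by exact_mod_cast h
  ext i
  fin_cases i <;> simp [pairing, perp, latticeVec]
  · linear_combination (-s 0) * h'
  · linear_combination (-s 1) * h'

/-- On every chart that meets it, the divisor of a ray has a character as its equation. -/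
lemma exists_local_equation (hs : Δ.IsSmooth) (hc : ∀ v : Fin 2 → ℝ, ∃ σ ∈ Δ.cones, v ∈ σ)
    (hv : Δ.IsRay v) {σ : PointedCone ℝ (Fin 2 → ℝ)} (hσ : σ ∈ Δ.cones) (hvσ : latticeVec v ∈ σ) :
    ∃ m₀ : dualMonoid σ, (m₀ : Fin 2 → ℤ) ⬝ᵥ v = 1 ∧
      ∀ m ∈ dualMonoid σ, m ⬝ᵥ v ≠ 0 → m - m₀ ∈ dualMonoid σ := by
  obtain ⟨x, y, h, hle⟩ := Fan.exists_adj_ge hs hc hσ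
  have hf := Fan.isFaceOf_of_le h.2 hσ hle
  rcases hv.eq_or_eq h (hle hvσ) with rfl | rfl
  · exact exists_local_equation_of_isFaceOf hf (left_mem_cone₂ _ _) (right_mem_cone₂ _ _) hvσ
      (fstChar h.1).2 (sndChar h.1).2 (eq_pairing_smul_add h.1) (fstChar_dot_left h.1)
  · exact exists_local_equation_of_isFaceOf hf (right_mem_cone₂ _ _) (left_mem_cone₂ _ _) hvσ
      (sndChar h.1).2 (fstChar h.1).2
      (fun s => (eq_pairing_smul_add h.1 s).trans (add_comm _ _)) (sndChar_dot_right h.1)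

lemma hasOrder_divisor_iff (hs : Δ.IsSmooth) (hc : ∀ v : Fin 2 → ℝ, ∃ σ ∈ Δ.cones, v ∈ σ)
    (hv : Δ.IsRay v) {m : Fin 2 → ℤ} {j : ℤ} :
    HasOrder (divisor Δ ℂ v) m j ↔ j = m ⬝ᵥ v := by
  constructor
  · rintro ⟨σ, m₁, m₂, ⟨x, hx⟩, rfl, rfl⟩
    have hvσ := ((mk_mem_divisor hs).1 hx).1
    obtain ⟨m₀, h₀, hsub⟩ := exists_local_equation hs hc hv σ.2 hvσ
    rw [chartOrder_single hs hvσ h₀ hsub, chartOrder_single hs hvσ h₀ hsub, sub_dotProduct]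
  · rintro rfl
    obtain ⟨a, b, h, hvσ⟩ : ∃ (a b : Fin 2 → ℤ) (_ : Δ.Adj a b), latticeVec v ∈ cone₂ a b := by
      rcases hv with ⟨w, h⟩ | ⟨w, h⟩
      exacts [⟨v, w, h, left_mem_cone₂ _ _⟩, ⟨w, v, h, right_mem_cone₂ _ _⟩]
    obtain ⟨m₀, h₀, hsub⟩ := exists_local_equation hs hc hv h.2 hvσ
    -- the positive and negative parts of `m` in the coordinates of the chart
    let m₁ : dualMonoid (cone₂ a b) :=
      (m ⬝ᵥ a).toNat • fstChar h.1 + (m ⬝ᵥ b).toNat • sndChar h.1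
    let m₂ : dualMonoid (cone₂ a b) :=
      (-(m ⬝ᵥ a)).toNat • fstChar h.1 + (-(m ⬝ᵥ b)).toNat • sndChar h.1
    have e : m = (m₁ : Fin 2 → ℤ) - m₂ := by
      have e1 := Int.toNat_sub_toNat_neg (m ⬝ᵥ a)
      have e2 := Int.toNat_sub_toNat_neg (m ⬝ᵥ b)
      conv_lhs => rw [dotProduct_perp h.1 m, ← e1, ← e2]
      simp only [m₁, m₂, AddSubmonoid.coe_add, AddSubmonoidClass.coe_nsmul, coe_fstChar, coe_sndChar,
        sub_smul, natCast_zsmul]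
      abel
    refine ⟨⟨_, h.2⟩, m₁, m₂, ⟨_, mk_generic_mem_divisor hs (σ := ⟨_, h.2⟩) hvσ 1⟩, e, ?_⟩
    rw [chartOrder_single (σ := ⟨_, h.2⟩) hs hvσ h₀ hsub,
      chartOrder_single (σ := ⟨_, h.2⟩) hs hvσ h₀ hsub, ← sub_dotProduct, ← e]

lemma order_divisor (hs : Δ.IsSmooth) (hc : ∀ v : Fin 2 → ℝ, ∃ σ ∈ Δ.cones, v ∈ σ)
    (hv : Δ.IsRay v) (m : Fin 2 → ℤ) : order (divisor Δ ℂ v) m = m ⬝ᵥ v := by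
  have h : ∃ j, HasOrder (divisor Δ ℂ v) m j := ⟨_, (hasOrder_divisor_iff hs hc hv).2 rfl⟩
  rw [order, dif_pos h]
  exact (hasOrder_divisor_iff hs hc hv).1 h.choose_spec

/-! ### Intersection numbers -/

/-- The local ring of a complex point has residue field `ℂ`. -/
lemma finrank_quotient_localization {n : ℕ} {σ : PointedCone ℝ (Fin n → ℝ)} (x : AffPoints σ ℂ)
    [hP : (RingHom.ker x.eval).IsPrime] {I : Ideal (CoordRing σ ℂ)} (hI : I = RingHom.ker x.eval) :
    Module.finrank ℂ (Localization.AtPrime (RingHom.ker x.eval) ⧸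
      I.map (algebraMap (CoordRing σ ℂ)
        (Localization.AtPrime (RingHom.ker x.eval)))) = 1 := by
  subst hI
  have hsurj : Function.Surjective x.eval := fun c => ⟨algebraMap ℂ _ c, x.eval.commutes c⟩
  have hmax : (RingHom.ker x.eval).IsMaximal :=
    RingHom.ker_isMaximal_of_surjective (x.eval : CoordRing σ ℂ →+* ℂ) hsurj
  set P := RingHom.ker x.eval with hPdef
  let O := Localization.AtPrime P
  have hmap : P.map (algebraMap (CoordRing σ ℂ) O) = IsLocalRing.maximalIdeal O :=
    IsLocalization.AtPrime.map_eq_maximalIdeal P O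
  rw [hmap]
  have hne : Nontrivial (O ⧸ IsLocalRing.maximalIdeal O) :=
    Ideal.Quotient.nontrivial_iff.2 (IsLocalRing.maximalIdeal.isMaximal O).ne_top
  refine finrank_eq_one (1 : O ⧸ IsLocalRing.maximalIdeal O) one_ne_zero fun z => ?_
  obtain ⟨r, rfl⟩ := (IsLocalization.AtPrime.equivQuotMaximalIdeal P O).surjective z
  obtain ⟨r, rfl⟩ := Ideal.Quotient.mk_surjective r
  refine ⟨x.eval r, ?_⟩
  have h1 : (Ideal.Quotient.mk P r) = Ideal.Quotient.mk P (algebraMap ℂ _ (x.eval r)) := by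
    rw [Ideal.Quotient.eq, hPdef, RingHom.mem_ker, map_sub, AlgHom.commutes]
    exact sub_self _
  rw [h1, IsLocalization.AtPrime.equivQuotMaximalIdeal_apply_mk, Algebra.smul_def, mul_one]
  rfl

/-- The divisors of two rays meet transversally: at a common point, their ideals span the maximal
ideal. -/
lemma localIntersection_divisor (hs : Δ.IsSmooth) (hc : ∀ v : Fin 2 → ℝ, ∃ σ ∈ Δ.cones, v ∈ σ)
    (hv : Δ.IsRay v) (hw : Δ.IsRay w) (hne : v ≠ w) {p : Points Δ ℂ}
    (hpv : p ∈ divisor Δ ℂ v) (hpw : p ∈ divisor Δ ℂ w) :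
    localIntersection (divisor Δ ℂ v) (divisor Δ ℂ w) p = 1 := by
  have key : ∀ q : Σ σ : Δ.cones, AffPoints σ.1 ℂ, Points.mk q.1 q.2 = p →
      idealOf (divisor Δ ℂ v) q.1 ⊔ idealOf (divisor Δ ℂ w) q.1 = RingHom.ker q.2.eval := by
    rintro ⟨σ, x⟩ rfl
    obtain ⟨hvσ, hxv⟩ := (mk_mem_divisor hs).1 hpv
    obtain ⟨hwσ, hxw⟩ := (mk_mem_divisor hs).1 hpw
    -- `v` and `w` form a basis, so only the constant term can be nonzero at the common point
    have hzero : ∀ m : dualMonoid σ.1, (m : Fin 2 → ℤ) ⬝ᵥ v = 0 → (m : Fin 2 → ℤ) ⬝ᵥ w = 0 →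
        m = 0 := by
      intro m h1 h2
      ext1
      rcases Fan.adj_or_adj_of_mem hs hc hv hw hne σ.2 hvσ hwσ with ⟨h, _⟩ | ⟨h, _⟩
      · rw [dotProduct_perp h.1 (m : Fin 2 → ℤ), h1, h2]; simp
      · rw [dotProduct_perp h.1 (m : Fin 2 → ℤ), h1, h2]; simp
    refine le_antisymm (sup_le ?_ ?_) fun f hf => ?_
    · exact fun f hf => mem_idealOf_iff.1 hf x hpv
    · exact fun f hf => mem_idealOf_iff.1 hf x hpw
    · have hf0 : f.coeff 0 = 0 := by
        have h1 : x.eval f = 0 := hf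
        rw [AffPoints.eval_apply] at h1
        by_contra h0
        rw [Finset.sum_eq_single 0] at h1
        · rw [x.chi_zero, mul_one] at h1
          exact h0 h1
        · intro m _ hm
          by_cases h2 : (m : Fin 2 → ℤ) ⬝ᵥ v = 0
          · rw [hxw m fun h3 => hm (hzero m h2 h3), mul_zero]
          · rw [hxv m h2, mul_zero]
        · intro h2
          exact absurd (Finsupp.mem_support_iff.2 h0) h2
      rw [← AddMonoidAlgebra.sum_coeff_single f]
      refine Submodule.sum_mem _ fun m hm => ?_
      have hm0 : m ≠ 0 := by
        rintro rfl
        exact Finsupp.mem_support_iff.1 hm hf0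
      have hsingle : ∀ (z : Fin 2 → ℤ) (_ : latticeVec z ∈ σ.1) (_ : (m : Fin 2 → ℤ) ⬝ᵥ z ≠ 0),
          AddMonoidAlgebra.single m (f.coeff m) ∈ idealOf (divisor Δ ℂ z) σ := by
        intro z hz hmz
        rw [mem_idealOf_divisor hs hz]
        intro m' hm'
        rw [AddMonoidAlgebra.coeff_single, Finsupp.single_apply, if_neg]
        rintro rfl
        exact hmz hm'
      by_cases h2 : (m : Fin 2 → ℤ) ⬝ᵥ v = 0
      · exact Ideal.mem_sup_right (hsingle w hwσ fun h3 => hm0 (hzero m h2 h3))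
      · exact Ideal.mem_sup_left (hsingle v hvσ h2)
  have hq := key (Quot.out p) (Quot.out_eq p)
  have : (RingHom.ker (Quot.out p).2.eval).IsPrime := RingHom.ker_isPrime _
  exact finrank_quotient_localization (Quot.out p).2 hq

lemma divisor_inter_of_adj (hs : Δ.IsSmooth) (hc : ∀ v : Fin 2 → ℝ, ∃ σ ∈ Δ.cones, v ∈ σ)
    (h : Δ.Adj v w) : divisor Δ ℂ v ∩ divisor Δ ℂ w = {h.pt 0 0} := by
  ext p
  rw [Set.mem_singleton_iff]
  constructor
  · rintro ⟨hpv, hpw⟩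
    obtain ⟨a, b, h', x, y, rfl⟩ := Points.exists_pt hs hc p
    obtain ⟨rfl, rfl⟩ := h.eq_of_mem h' ((mk_mem_divisor hs).1 hpv).1 ((mk_mem_divisor hs).1 hpw).1
    rw [(h'.pt_mem_divisor_left hs).1 hpv, (h'.pt_mem_divisor_right hs).1 hpw]
  · rintro rfl
    exact ⟨(h.pt_mem_divisor_left hs).2 rfl, (h.pt_mem_divisor_right hs).2 rfl⟩

lemma divisor_injOn (hs : Δ.IsSmooth) (hv : Δ.IsRay v) (hw : Δ.IsRay w)
    (e : divisor Δ ℂ v = divisor Δ ℂ w) : v = w := by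
  rcases hv with ⟨x, h⟩ | ⟨x, h⟩
  · have h1 : h.pt (0 : ℂ) 1 ∈ divisor Δ ℂ w := e ▸ (h.pt_mem_divisor_left hs).2 rfl
    rcases hw.eq_or_eq h ((mk_mem_divisor hs).1 h1).1 with rfl | rfl
    · rfl
    · exact absurd ((h.pt_mem_divisor_right hs).1 h1) one_ne_zero
  · have h1 : h.pt (1 : ℂ) 0 ∈ divisor Δ ℂ w := e ▸ (h.pt_mem_divisor_right hs).2 rfl
    rcases hw.eq_or_eq h ((mk_mem_divisor hs).1 h1).1 with rfl | rfl
    · exact absurd ((h.pt_mem_divisor_left hs).1 h1) one_ne_zero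
    · rfl

lemma intersectionNumber_of_inter_eq (hs : Δ.IsSmooth)
    (hc : ∀ v : Fin 2 → ℝ, ∃ σ ∈ Δ.cones, v ∈ σ) (hv : Δ.IsRay v) (hw : Δ.IsRay w) (hne : v ≠ w)
    {p : Points Δ ℂ} (h : divisor Δ ℂ v ∩ divisor Δ ℂ w = {p}) :
    intersectionNumber (divisor Δ ℂ v) (divisor Δ ℂ w) = 1 := by
  have hp : p ∈ divisor Δ ℂ v ∩ divisor Δ ℂ w := h ▸ rfl
  rw [intersectionNumber, h, finsum_mem_singleton]
  exact localIntersection_divisor hs hc hv hw hne hp.1 hp.2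

/-- The self-intersection number of the divisor of a ray `v` with neighbours `u` and `w` is `-a`,
where `u + w = a v`: an auxiliary character `χ^m` of order `-1` along it has order `⟨m, u⟩` and
`⟨m, w⟩` along the two invariant curves that meet it. -/
lemma selfIntersection_divisor (hs : Δ.IsSmooth) (hc : ∀ v : Fin 2 → ℝ, ∃ σ ∈ Δ.cones, v ∈ σ)
    (huv : Δ.Adj u v) (hvw : Δ.Adj v w) :
    selfIntersection (divisor Δ ℂ v) = -det u w := by
  have hv := hvw.isRay_left
  have huw : u ≠ w := by
    rintro rfl
    have h1 := hvw.1
    rw [Fan.det_swap, huv.1] at h1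
    omega
  have hex : ∃ m : Fin 2 → ℤ, order (divisor Δ ℂ v) m = -1 :=
    ⟨-(fstChar hvw.1 : Fin 2 → ℤ), by
      rw [order_divisor hs hc hv, neg_dotProduct, fstChar_dot_left]⟩
  rw [selfIntersection, dif_pos hex]
  have hm := hex.choose_spec
  set m := hex.choose
  rw [order_divisor hs hc hv] at hm
  have hDu := isInvariantCurve_divisor hs hc huv.isRay_left
  have hDw := isInvariantCurve_divisor hs hc hvw.isRay_right
  have hiu : intersectionNumber (divisor Δ ℂ u) (divisor Δ ℂ v) = 1 :=
    intersectionNumber_of_inter_eq hs hc huv.isRay_left hv huv.ne (divisor_inter_of_adj hs hc huv)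
  have hiw : intersectionNumber (divisor Δ ℂ w) (divisor Δ ℂ v) = 1 :=
    intersectionNumber_of_inter_eq hs hc hvw.isRay_right hv hvw.ne.symm
      ((Set.inter_comm _ _).trans (divisor_inter_of_adj hs hc hvw))
  rw [finsum_mem_inter_support_eq' _ _ {divisor Δ ℂ u, divisor Δ ℂ w}, finsum_mem_pair,
    hiu, hiw, order_divisor hs hc huv.isRay_left, order_divisor hs hc hvw.isRay_right]
  · -- the relation `u + w = a v`
    have e : u = det u w • v - w := by
      have h1 := eq_det_smul_add hvw.1 u
      have h2 := huv.1
      rw [Fan.det_swap v u, h2] at h1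
      conv_lhs => rw [h1]
      simp [sub_eq_add_neg]
    have e2 : m ⬝ᵥ u = det u w * (m ⬝ᵥ v) - m ⬝ᵥ w := by
      conv_lhs => rw [e]
      rw [dotProduct_sub, dotProduct_smul, smul_eq_mul]
    rw [e2, hm]
    push_cast
    ring
  · exact fun e => huw (divisor_injOn hs huv.isRay_left hvw.isRay_right e)
  · intro D hD
    constructor
    · rintro ⟨hDinv, hDne⟩
      obtain ⟨z, hz, rfl⟩ := hDinv.exists_eq_divisor hs hc
      have hzv : z ≠ v := by rintro rfl; exact hDne rfl
      by_cases hemp : divisor Δ ℂ z ∩ divisor Δ ℂ v = ∅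
      · have h0 : intersectionNumber (divisor Δ ℂ z) (divisor Δ ℂ v) = 0 := by
          rw [intersectionNumber, hemp, finsum_mem_empty]
        exact absurd (by simp [h0]) hD
      · obtain ⟨p, hpz, hpv⟩ := Set.nonempty_iff_ne_empty.2 hemp
        obtain ⟨σ, x, rfl⟩ := Points.exists_mk p
        rcases Fan.adj_or_adj_of_mem hs hc hz hv hzv σ.2 ((mk_mem_divisor hs).1 hpz).1
          ((mk_mem_divisor hs).1 hpv).1 with ⟨h, _⟩ | ⟨h, _⟩
        · exact Or.inl (by rw [h.left_unique huv])
        · exact Or.inr (by rw [h.right_unique hvw]; rfl)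
    · rintro (rfl | rfl)
      · exact ⟨hDu, fun e => huv.ne (divisor_injOn hs huv.isRay_left hv e)⟩
      · exact ⟨hDw, fun e => hvw.ne (divisor_injOn hs hv hvw.isRay_right e.symm)⟩

end PlaneOrders

/-! ### The analytic topology on the real points -/

section RealCharts

variable {n : ℕ} {Δ : Fan n} {k : Type} [Field k]

lemma Points.hasVal_zero (p : Points Δ k) : p.HasVal 0 1 := by
  obtain ⟨σ, x, rfl⟩ := Points.exists_mk p
  have := Points.hasVal_mk_chi σ x 0
  rwa [x.chi_zero] at this

lemma Points.HasVal.nsmul (hs : Δ.IsSmooth) {p : Points Δ k} {m : Fin n → ℤ} {c : k}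
    (h : p.HasVal m c) (j : ℕ) : p.HasVal (j • m) (c ^ j) := by
  induction j with
  | zero =>
    rw [zero_smul, pow_zero]; exact p.hasVal_zero
  | succ j ih =>
    rw [succ_nsmul, pow_succ]
    exact ih.add hs h

lemma Points.HasVal.neg (hs : Δ.IsSmooth) {p : Points Δ k} {m : Fin n → ℤ} {c : k}
    (h : p.HasVal m c) (hc : c ≠ 0) : p.HasVal (-m) c⁻¹ := by
  obtain ⟨σ, x, rfl⟩ := Points.exists_mk p
  rw [Points.hasVal_mk hs] at h ⊢
  obtain ⟨m₁, m₂, rfl, h0, e⟩ := h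
  refine ⟨m₂, m₁, by simp, ?_, ?_⟩
  · rw [← e]; exact mul_ne_zero hc h0
  · rw [← e, inv_mul_cancel_left₀ hc]

lemma Points.HasVal.zsmul (hs : Δ.IsSmooth) {p : Points Δ k} {m : Fin n → ℤ} {c : k}
    (h : p.HasVal m c) (hc : c ≠ 0) (j : ℤ) : p.HasVal (j • m) (c ^ j) := by
  obtain ⟨j, rfl | rfl⟩ := j.eq_nat_or_neg
  · rw [natCast_zsmul, zpow_natCast]; exact h.nsmul hs j
  · rw [neg_smul, natCast_zsmul, zpow_neg, zpow_natCast]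
    exact (h.nsmul hs j).neg hs (pow_ne_zero _ hc)

open Classical in
/-- The value of the rational function `χ^m` at `p`, and `0` where it is not regular. -/
def Points.value (m : Fin n → ℤ) (p : Points Δ k) : k :=
  if h : ∃ c, p.HasVal m c then h.choose else 0

lemma Points.HasVal.value_eq (hs : Δ.IsSmooth) {p : Points Δ k} {m : Fin n → ℤ} {c : k}
    (h : p.HasVal m c) : p.value m = c := by
  have hex : ∃ c, p.HasVal m c := ⟨c, h⟩
  rw [Points.value, dif_pos hex]
  exact hex.choose_spec.unique hs h

variable [TopologicalSpace k]

lemma AffPoints.continuous_chi {σ : PointedCone ℝ (Fin n → ℝ)} (m : dualMonoid σ) :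
    Continuous fun x : AffPoints σ k => x.chi m :=
  (continuous_apply m).comp continuous_induced_dom

lemma AffPoints.continuous_of_chi {Y : Type*} [TopologicalSpace Y]
    {σ : PointedCone ℝ (Fin n → ℝ)} {f : Y → AffPoints σ k}
    (h : ∀ m, Continuous fun y => (f y).chi m) : Continuous f :=
  continuous_induced_rng.2 (continuous_pi h)

lemma Points.continuous_mk (σ : Δ.cones) : Continuous (Points.mk σ : AffPoints σ.1 k → Points Δ k) :=
  (continuous_quot_mk (r := GlueRel Δ k)).comp continuous_sigmaMk

lemma Points.isOpen_iff {s : Set (Points Δ k)} :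
    IsOpen s ↔ ∀ σ : Δ.cones, IsOpen (Points.mk σ ⁻¹' s) := by
  refine ⟨fun h σ => h.preimage (Points.continuous_mk σ), fun h => ?_⟩
  exact isOpen_coinduced.2 (isOpen_sigma_iff.2 h)

variable [IsTopologicalDivisionRing k] [T1Space k]

/-- The locus where `χ^m` is regular with a value in a given open set is open. -/
lemma Points.isOpen_setOf_hasVal (hs : Δ.IsSmooth) (m : Fin n → ℤ) {V : Set k} (hV : IsOpen V) :
    IsOpen {p : Points Δ k | ∃ c ∈ V, p.HasVal m c} := by
  rw [Points.isOpen_iff]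
  intro σ
  have : Points.mk σ ⁻¹' {p : Points Δ k | ∃ c ∈ V, p.HasVal m c} =
      ⋃ (m₁ : dualMonoid σ.1) (m₂ : dualMonoid σ.1) (_ : m = (m₁ : Fin n → ℤ) - m₂),
        {x | x.chi m₂ ≠ 0} ∩ (fun x => x.chi m₁ / x.chi m₂) ⁻¹' V := by
    ext x
    simp only [Set.mem_preimage, Set.mem_ofPred_eq, Points.hasVal_mk hs, AffPoints.HasVal,
      Set.mem_iUnion, Set.mem_inter_iff]
    constructor
    · rintro ⟨c, hc, m₁, m₂, e, h0, hv⟩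
      exact ⟨m₁, m₂, e, h0, by rwa [← hv, mul_div_cancel_right₀ _ h0]⟩
    · rintro ⟨m₁, m₂, e, h0, hv⟩
      exact ⟨_, hv, m₁, m₂, e, h0, div_mul_cancel₀ _ h0⟩
  rw [this]
  refine isOpen_iUnion fun m₁ => isOpen_iUnion fun m₂ => isOpen_iUnion fun _ => ?_
  have ho : IsOpen {x : AffPoints σ.1 k | x.chi m₂ ≠ 0} :=
    isOpen_ne.preimage (AffPoints.continuous_chi m₂)
  refine ContinuousOn.isOpen_inter_preimage ?_ ho hV
  exact (AffPoints.continuous_chi m₁).continuousOn.div (AffPoints.continuous_chi m₂).continuousOn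
    fun x hx => hx

lemma Points.continuousOn_value (hs : Δ.IsSmooth) (m : Fin n → ℤ) :
    ContinuousOn (Points.value m) {p : Points Δ k | ∃ c, p.HasVal m c} := by
  have ho : IsOpen {p : Points Δ k | ∃ c, p.HasVal m c} := by
    simpa using Points.isOpen_setOf_hasVal hs m (isOpen_univ (X := k))
  rw [continuousOn_open_iff ho]
  intro V hV
  convert Points.isOpen_setOf_hasVal hs m hV using 1
  ext p
  constructor
  · rintro ⟨⟨c, hc⟩, hp⟩
    exact ⟨c, by rwa [Set.mem_preimage, hc.value_eq hs] at hp, hc⟩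
  · rintro ⟨c, hcV, hc⟩
    exact ⟨⟨c, hc⟩, by rwa [Set.mem_preimage, hc.value_eq hs]⟩

end RealCharts

section PlaneCharts

variable {Δ : Fan 2} {k : Type} [Field k] {u v w : Fin 2 → ℤ}

lemma Fan.Adj.hasVal_fst (h : Δ.Adj u w) (x y : k) : (h.pt x y).HasVal (-perp w) x := by
  have := Points.hasVal_mk_chi (⟨_, h.2⟩ : Δ.cones) (chartPt u w x y) (fstChar h.1)
  rwa [chi_fstChar_chartPt] at this

lemma Fan.Adj.hasVal_snd (h : Δ.Adj u w) (x y : k) : (h.pt x y).HasVal (perp u) y := by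
  have := Points.hasVal_mk_chi (⟨_, h.2⟩ : Δ.cones) (chartPt u w x y) (sndChar h.1)
  rwa [chi_sndChar_chartPt] at this

/-- The chart of `cone₂ u w` is the locus where its two coordinates are regular. -/
lemma Fan.Adj.pt_eq_of_hasVal (hs : Δ.IsSmooth) (hp : Δ.IsProjective) (h : Δ.Adj u w)
    {p : Points Δ k} {x y : k} (hx : p.HasVal (-perp w) x) (hy : p.HasVal (perp u) y) :
    h.pt x y = p := by
  obtain ⟨z, rfl⟩ := Points.exists_mk_of_regular hs hp (σ := ⟨_, h.2⟩)
    (h.maximal hs hp.complete) (p := p) fun m hm => by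
      have h1 := Int.toNat_of_nonneg (dot_left_nonneg ⟨m, hm⟩)
      have h2 := Int.toNat_of_nonneg (dot_right_nonneg ⟨m, hm⟩)
      have e := dotProduct_perp h.1 m
      simp only at h1 h2
      rw [← h1, ← h2, natCast_zsmul, natCast_zsmul] at e
      rw [e]
      exact ⟨_, (hx.nsmul hs _).add hs (hy.nsmul hs _)⟩
  have e := eq_chartPt h.1 z
  rw [(Points.hasVal_mk_chi ⟨_, h.2⟩ z (fstChar h.1)).unique hs hx,
    (Points.hasVal_mk_chi ⟨_, h.2⟩ z (sndChar h.1)).unique hs hy] at e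
  rw [e, Fan.Adj.pt]

/-- The coordinate change between the charts of two adjacent cones that share the ray `v`. -/
lemma Fan.Adj.pt_eq_pt (hs : Δ.IsSmooth) (hp : Δ.IsProjective) (huv : Δ.Adj u v)
    (hvw : Δ.Adj v w) {x y : k} (hy : y ≠ 0) :
    hvw.pt x y = huv.pt y⁻¹ (x * y ^ det u w) := by
  refine (huv.pt_eq_of_hasVal hs hp ((hvw.hasVal_snd x y).neg hs hy) ?_).symm
  have e : perp u = -perp w + det u w • perp v := by
    have h1 := eq_det_smul_add hvw.1 u
    have h2 := huv.1
    rw [Fan.det_swap v u, h2] at h1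
    have h10 := congrFun h1 0
    have h11 := congrFun h1 1
    simp at h10 h11
    ext i
    fin_cases i <;> simp [perp, h10, h11]
    ring
  rw [e]
  exact (hvw.hasVal_fst x y).add hs ((hvw.hasVal_snd x y).zsmul hs hy _)

lemma Fan.Adj.ne_zero_of_pt_eq_pt (hs : Δ.IsSmooth) (huv : Δ.Adj u v)
    (hvw : Δ.Adj v w) {x y x' y' : k} (e : hvw.pt x y = huv.pt x' y') : y ≠ 0 := by
  have h1 := (hvw.hasVal_snd x y).add hs (e ▸ huv.hasVal_fst x' y')
  rw [add_neg_cancel] at h1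
  exact left_ne_zero_of_mul_eq_one (h1.unique hs (Points.hasVal_zero _))

variable [TopologicalSpace k] [IsTopologicalDivisionRing k] [T1Space k]

/-- The chart of a two-dimensional cone is an open embedding of the plane: its inverse is given by the
values of two rational functions, and its image is the locus where they are regular. -/
lemma Fan.Adj.isOpenEmbedding_pt (hs : Δ.IsSmooth) (hp : Δ.IsProjective) (h : Δ.Adj u w) :
    Topology.IsOpenEmbedding fun z : k × k => h.pt z.1 z.2 := by
  have hrange : ∀ p : Points Δ k, ((∃ c, p.HasVal (-perp w) c) ∧ ∃ c, p.HasVal (perp u) c) →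
      h.pt (p.value (-perp w)) (p.value (perp u)) = p := by
    rintro p ⟨⟨x, hx⟩, ⟨y, hy⟩⟩
    rw [hx.value_eq hs, hy.value_eq hs, h.pt_eq_of_hasVal hs hp hx hy]
  refine Topology.IsOpenEmbedding.of_continuous_injective_isOpenMap ?_ ?_ ?_
  · refine (Points.continuous_mk _).comp (AffPoints.continuous_of_chi fun m => ?_)
    simp only [chi_chartPt]
    fun_prop
  · rintro ⟨x, y⟩ ⟨x', y'⟩ e
    obtain ⟨rfl, rfl⟩ := h.pt_injective hs e
    rfl
  · intro V hV
    have e : (fun z : k × k => h.pt z.1 z.2) '' V =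
        ({p | ∃ c, p.HasVal (-perp w) c} ∩ {p | ∃ c, p.HasVal (perp u) c}) ∩
          (fun p => (Points.value (-perp w) p, Points.value (perp u) p)) ⁻¹' V := by
      ext p
      constructor
      · rintro ⟨⟨x, y⟩, hxy, rfl⟩
        refine ⟨⟨⟨x, h.hasVal_fst x y⟩, ⟨y, h.hasVal_snd x y⟩⟩, ?_⟩
        rw [Set.mem_preimage, (h.hasVal_fst x y).value_eq hs, (h.hasVal_snd x y).value_eq hs]
        exact hxy
      · rintro ⟨hreg, hV'⟩
        exact ⟨_, hV', hrange p hreg⟩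
    rw [e]
    refine ContinuousOn.isOpen_inter_preimage ?_ ?_ hV
    · exact ((Points.continuousOn_value hs _).mono Set.inter_subset_left).prodMk
        ((Points.continuousOn_value hs _).mono Set.inter_subset_right)
    · have h1 := Points.isOpen_setOf_hasVal hs (-perp w) (isOpen_univ (X := k)) (Δ := Δ)
      have h2 := Points.isOpen_setOf_hasVal hs (perp u) (isOpen_univ (X := k)) (Δ := Δ)
      simp only [Set.mem_univ, true_and] at h1 h2
      exact h1.inter h2

end PlaneCharts

/-! ### Real line bundles along a path -/

section LineBundle

open Bundle unitInterval

variable {B : Type} {E : B → Type}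

section SMul

variable [∀ x, AddCommGroup (E x)] [∀ x, Module ℝ (E x)]

/-- Scalar multiplication on the total space of a real line bundle. -/
def fiberSMul (r : ℝ) (z : TotalSpace ℝ E) : TotalSpace ℝ E := ⟨z.proj, r • z.2⟩

lemma fiberSMul_fiberSMul (r s : ℝ) (z : TotalSpace ℝ E) :
    fiberSMul r (fiberSMul s z) = fiberSMul (r * s) z :=
  congrArg (TotalSpace.mk z.proj) (smul_smul r s z.2)

lemma fiberSMul_zero (z : TotalSpace ℝ E) : fiberSMul 0 z = ⟨z.proj, 0⟩ := by
  simp [fiberSMul]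

lemma fiberSMul_injective {z : TotalSpace ℝ E} (hz : z.2 ≠ 0) :
    Function.Injective fun r => fiberSMul r z := by
  intro r s h
  have h2 : r • z.2 = s • z.2 := by
    have := (TotalSpace.mk.injEq _ _ _ _).mp h
    exact eq_of_heq this.2
  exact smul_left_injective ℝ hz h2

end SMul

variable [TopologicalSpace B] [TopologicalSpace (TotalSpace ℝ E)]

lemma trivialization_ext (e : Trivialization ℝ (π ℝ E))
    {z w : TotalSpace ℝ E} (hz : z.proj ∈ e.baseSet) (hp : w.proj = z.proj)
    (h : (e w).2 = (e z).2) : w = z := by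
  have hz' : z ∈ e.source := e.mem_source.2 hz
  have hw' : w ∈ e.source := e.mem_source.2 (hp ▸ hz)
  apply e.toOpenPartialHomeomorph.injOn hw' hz'
  exact Prod.ext (by rw [e.coe_coe, e.coe_fst hw', e.coe_fst hz', hp]) h

variable [∀ x, AddCommGroup (E x)] [∀ x, Module ℝ (E x)] [∀ x, TopologicalSpace (E x)]
  [FiberBundle ℝ E] [VectorBundle ℝ ℝ E]

lemma trivialization_apply_fiberSMul (e : Trivialization ℝ (π ℝ E)) [MemTrivializationAtlas e]
    {z : TotalSpace ℝ E} (hz : z.proj ∈ e.baseSet) (r : ℝ) :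
    (e (fiberSMul r z)).2 = r * (e z).2 :=
  (e.linear ℝ hz).map_smul r z.2

lemma trivialization_apply_snd_eq_zero (e : Trivialization ℝ (π ℝ E)) [MemTrivializationAtlas e]
    {z : TotalSpace ℝ E} (hz : z.proj ∈ e.baseSet) : (e z).2 = 0 ↔ z.2 = 0 := by
  constructor
  · intro h
    have := (e.continuousLinearEquivAt ℝ z.proj hz).map_eq_zero_iff (x := z.2)
    rw [← this]
    simpa using h
  · intro h
    have h0 : fiberSMul 0 z = z := by simp [fiberSMul, ← h]
    simpa [h0] using trivialization_apply_fiberSMul e hz 0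

lemma exists_fiberSMul_eq {z w : TotalSpace ℝ E} (hz : z.2 ≠ 0) (hp : w.proj = z.proj) :
    ∃ r, w = fiberSMul r z := by
  let e := trivializationAt ℝ E z.proj
  have hb : z.proj ∈ e.baseSet := FiberBundle.mem_baseSet_trivializationAt' z.proj
  have h0 : (e z).2 ≠ 0 := fun h => hz ((trivialization_apply_snd_eq_zero e hb).1 h)
  refine ⟨(e w).2 / (e z).2, trivialization_ext e (by exact hb) hp ?_⟩
  rw [trivialization_apply_fiberSMul e hb, div_mul_cancel₀ _ h0]

lemma continuous_fiberSMul :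
    Continuous fun q : ℝ × TotalSpace ℝ E => fiberSMul q.1 q.2 := by
  rw [continuous_iff_continuousAt]
  rintro ⟨r, z⟩
  rw [FiberBundle.continuousAt_totalSpace]
  have hproj : Continuous fun q : ℝ × TotalSpace ℝ E => q.2.proj :=
    (FiberBundle.continuous_proj ℝ E).comp continuous_snd
  refine ⟨hproj.continuousAt, ?_⟩
  set e := trivializationAt ℝ E z.proj with he
  have hb : z.proj ∈ e.baseSet := FiberBundle.mem_baseSet_trivializationAt' z.proj
  have hev : ∀ᶠ q : ℝ × TotalSpace ℝ E in 𝓝 (r, z), q.2.proj ∈ e.baseSet :=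
    hproj.continuousAt.eventually (e.open_baseSet.mem_nhds hb)
  have hc : ContinuousAt (fun q : ℝ × TotalSpace ℝ E => q.1 * (e q.2).2) (r, z) := by
    refine continuousAt_fst.mul (continuous_snd.continuousAt.comp ?_)
    exact ContinuousAt.comp (x := (r, z)) (g := e)
      (e.toOpenPartialHomeomorph.continuousAt (e.mem_source.2 hb)) continuousAt_snd
  refine hc.congr ?_
  filter_upwards [hev] with q hq
  exact (trivialization_apply_fiberSMul e hq q.1).symm

/-- A nowhere vanishing section over a path, obtained by patching constant sections of finitely many
trivializations. -/
lemma exists_section_along {p : I → B} (hp : Continuous p) :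
    ∃ G : I → TotalSpace ℝ E, Continuous G ∧ ∀ s, (G s).proj = p s ∧ (G s).2 ≠ 0 := by
  obtain ⟨t, ht0, htm, ⟨N, hN⟩, hsub⟩ := exists_monotone_Icc_subset_open_cover_unitInterval
    (c := fun b : B => p ⁻¹' (trivializationAt ℝ E b).baseSet)
    (fun b => (trivializationAt ℝ E b).open_baseSet.preimage hp)
    (fun s _ => Set.mem_iUnion.2 ⟨p s, FiberBundle.mem_baseSet_trivializationAt' (p s)⟩)
  have key : ∀ n, ∃ G : I → TotalSpace ℝ E, ContinuousOn G (Set.Icc 0 (t n)) ∧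
      ∀ s ∈ Set.Icc 0 (t n), (G s).proj = p s ∧ (G s).2 ≠ 0 := by
    intro n
    induction n with
    | zero =>
      let e := trivializationAt ℝ E (p 0)
      have hb : p 0 ∈ e.baseSet := FiberBundle.mem_baseSet_trivializationAt' (p 0)
      have hb' : ((p 0, (1 : ℝ)) : B × ℝ) ∈ e.target := e.mem_target.2 hb
      let g : TotalSpace ℝ E := e.toOpenPartialHomeomorph.symm (p 0, 1)
      have hg : g.proj = p 0 := e.proj_symm_apply' hb
      have hg2 : (e g).2 = 1 := by
        have := e.apply_symm_apply' (x := (1 : ℝ)) hb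
        exact congrArg Prod.snd this
      refine ⟨fun _ => g, continuousOn_const, fun s hs => ?_⟩
      rw [ht0, Set.Icc_self, Set.mem_singleton_iff] at hs
      subst hs
      refine ⟨hg, fun h => ?_⟩
      rw [← trivialization_apply_snd_eq_zero e (hg ▸ hb), hg2] at h
      exact one_ne_zero h
    | succ n ih =>
      obtain ⟨G, hGc, hG⟩ := ih
      obtain ⟨b, hbs⟩ := hsub n
      set e := trivializationAt ℝ E b with he
      have hle : t n ≤ t (n + 1) := htm n.le_succ
      have hmem : t n ∈ Set.Icc 0 (t n) := ⟨nonneg', le_rfl⟩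
      obtain ⟨hGp, hG0⟩ := hG (t n) hmem
      have hbn : p (t n) ∈ e.baseSet := hbs ⟨le_rfl, hle⟩
      set c := (e (G (t n))).2 with hc
      have hc0 : c ≠ 0 := fun h => hG0 ((trivialization_apply_snd_eq_zero e (hGp ▸ hbn)).1 h)
      let S : I → TotalSpace ℝ E := fun s => e.toOpenPartialHomeomorph.symm (p s, c)
      have hSc : ContinuousOn S (Set.Icc (t n) (t (n + 1))) :=
        e.continuousOn_symm_prodMk_left.comp hp.continuousOn hbs
      have hS : ∀ s ∈ Set.Icc (t n) (t (n + 1)), (S s).proj = p s ∧ (e (S s)).2 = c := by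
        intro s hs
        refine ⟨e.proj_symm_apply' (hbs hs), ?_⟩
        have h2 : e (S s) = (p s, c) := e.apply_symm_apply' (hbs hs)
        rw [h2]
      have hglue : S (t n) = G (t n) :=
        trivialization_ext e (hGp ▸ hbn) ((hS _ ⟨le_rfl, hle⟩).1.trans hGp.symm)
          (hS _ ⟨le_rfl, hle⟩).2
      classical
      refine ⟨fun s => if s ≤ t n then G s else S s, ?_, fun s hs => ?_⟩
      · have h1 : Set.Icc 0 (t (n + 1)) = Set.Icc 0 (t n) ∪ Set.Icc (t n) (t (n + 1)) :=
          (Set.Icc_union_Icc_eq_Icc nonneg' hle).symm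
        rw [h1]
        refine ContinuousOn.union_of_isClosed ?_ ?_ isClosed_Icc isClosed_Icc
        · exact hGc.congr fun s hs => if_pos hs.2
        · refine hSc.congr fun s hs => ?_
          by_cases h : s ≤ t n
          · obtain rfl : s = t n := le_antisymm h hs.1
            simp [hglue]
          · exact if_neg h
      · have hS0 : ∀ s ∈ Set.Icc (t n) (t (n + 1)), (S s).2 ≠ 0 := fun s hs' h0 => hc0 <| by
          rw [← (hS s hs').2]
          exact (trivialization_apply_snd_eq_zero e ((hS s hs').1 ▸ hbs hs')).2 h0
        have transfer : ∀ v w : TotalSpace ℝ E, v = w → (w.proj = p s ∧ w.2 ≠ 0) →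
            (v.proj = p s ∧ v.2 ≠ 0) := by
          rintro v w rfl h
          exact h
        by_cases h : s ≤ t n
        · exact transfer _ _ (if_pos h) (hG s ⟨hs.1, h⟩)
        · have hs' : s ∈ Set.Icc (t n) (t (n + 1)) := ⟨(not_le.1 h).le, hs.2⟩
          exact transfer _ _ (if_neg h) ⟨(hS s hs').1, hS0 s hs'⟩
  obtain ⟨G, hGc, hG⟩ := key N
  rw [hN N le_rfl] at hGc hG
  have huniv : Set.Icc (0 : I) 1 = Set.univ := Set.eq_univ_of_forall fun s => ⟨nonneg', le_one'⟩
  rw [huniv] at hGc hG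
  exact ⟨G, continuousOn_univ.1 hGc, fun s => hG s trivial⟩

/-- Over a closed path, a nowhere vanishing section can be chosen so that its two end values agree
up to sign. -/
lemma exists_section_along_loop {p : I → B} (hp : Continuous p) (h01 : p 0 = p 1) :
    ∃ (G : I → TotalSpace ℝ E) (ε : ℝ), Continuous G ∧ (∀ s, (G s).proj = p s ∧ (G s).2 ≠ 0) ∧
      (ε = 1 ∨ ε = -1) ∧ G 1 = fiberSMul ε (G 0) := by
  obtain ⟨G, hGc, hG⟩ := exists_section_along (E := E) hp
  have hp10 : (G 1).proj = (G 0).proj := by rw [(hG 1).1, (hG 0).1, h01]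
  obtain ⟨c, hc⟩ := exists_fiberSMul_eq (hG 0).2 hp10
  have hc0 : c ≠ 0 := by
    rintro rfl
    exact (hG 1).2 (by rw [hc]; exact zero_smul ℝ _)
  -- the interpolating factor is `1` at the start and `|c|⁻¹` at the end of the path
  let ρ : I → ℝ := fun s => 1 - (s : ℝ) + s * |c|⁻¹
  have hρc : Continuous ρ := by fun_prop
  have hρ : ∀ s, ρ s ≠ 0 := fun s => by
    have h1 : 0 < |c|⁻¹ := inv_pos.2 (abs_pos.2 hc0)
    have h2 := s.2.1
    have h3 := s.2.2
    have : 0 < ρ s := by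
      rcases h2.eq_or_lt with h | h
      · simp [ρ, ← h]
      · have := mul_pos h h1
        simp only [ρ]
        linarith
    exact this.ne'
  refine ⟨fun s => fiberSMul (ρ s) (G s), c * |c|⁻¹, ?_, fun s => ⟨(hG s).1, ?_⟩, ?_, ?_⟩
  · exact continuous_fiberSMul.comp (hρc.prodMk hGc)
  · exact smul_ne_zero (hρ s) (hG s).2
  · rcases lt_or_gt_of_ne hc0 with h | h
    · right
      rw [abs_of_neg h, inv_neg, mul_neg, mul_inv_cancel₀ hc0]
    · left
      rw [abs_of_pos h, mul_inv_cancel₀ hc0]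
  · have h0 : ρ 0 = 1 := by simp [ρ]
    have h1 : ρ 1 = |c|⁻¹ := by simp [ρ]
    simp only [h0, h1, hc, fiberSMul_fiberSMul]
    ring_nf

end LineBundle

/-! ### Line bundles over a closed curve -/

section Models

open Bundle unitInterval Topology

/-- Quotient maps with the same fibres have homeomorphic targets. -/
lemma nonempty_homeomorph_of_isQuotientMap {X Y Z : Type} [TopologicalSpace X]
    [TopologicalSpace Y] [TopologicalSpace Z] {f : Z → X} {g : Z → Y}
    (hf : IsQuotientMap f) (hg : IsQuotientMap g) (h : ∀ x y, f x = f y ↔ g x = g y) :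
    Nonempty (X ≃ₜ Y) := by
  have hker : Setoid.ker f = Setoid.ker g := Setoid.ext h
  have e1 := Topology.IsQuotientMap.homeomorph (f := ⟨f, hf.continuous⟩) hf
  have e2 := Topology.IsQuotientMap.homeomorph (f := ⟨g, hg.continuous⟩) hg
  change Quotient (Setoid.ker f) ≃ₜ X at e1
  change Quotient (Setoid.ker g) ≃ₜ Y at e2
  rw [hker] at e1
  exact ⟨e1.symm.trans e2⟩

/-- The line as the open interval `(0, 1)`; changing the sign becomes reflection in the midpoint. -/
lemma exists_homeomorph_Ioo :
    ∃ φ : ℝ ≃ₜ Set.Ioo (0 : ℝ) 1, ∀ r, (φ (-r) : ℝ) = 1 - φ r := by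
  let e : ℝ ≃o Set.range Real.sigmoid := Real.sigmoid_strictMono.orderIso _
  have : (Set.range Real.sigmoid).OrdConnected := by
    rw [Real.range_sigmoid]
    exact Set.ordConnected_Ioo
  exact ⟨e.toHomeomorph.trans (Homeomorph.setCongr Real.range_sigmoid),
    fun r => Real.sigmoid_neg r⟩

/-- Two parameters of a closed path agree or are the two ends. -/
lemma circleExp_eq_iff (s t : I) :
    Circle.exp (2 * Real.pi * s) = Circle.exp (2 * Real.pi * t) ↔
      s = t ∨ (s = 0 ∧ t = 1) ∨ (s = 1 ∧ t = 0) := by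
  have hpi := Real.pi_pos
  rw [Circle.exp_eq_exp]
  constructor
  · rintro ⟨m, hm⟩
    have h1 : (s : ℝ) = t + m := by
      have : 2 * Real.pi * ((s : ℝ) - t - m) = 0 := by linarith
      have := (mul_eq_zero.1 this).resolve_left (by positivity)
      linarith
    have hm1 : m ≤ 1 := by
      have : (m : ℝ) ≤ 1 := by linarith [s.2.2, t.2.1]
      exact_mod_cast this
    have hm2 : -1 ≤ m := by
      have : (-1 : ℝ) ≤ m := by linarith [t.2.2, s.2.1]
      exact_mod_cast this
    interval_cases m
    · right; left
      push_cast at h1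
      constructor <;> apply Subtype.ext <;> simp only [Set.Icc.coe_zero, Set.Icc.coe_one] <;>
        linarith [t.2.2, s.2.1]
    · left
      exact Subtype.ext (by simpa using h1)
    · right; right
      push_cast at h1
      constructor <;> apply Subtype.ext <;> simp only [Set.Icc.coe_zero, Set.Icc.coe_one] <;>
        linarith [s.2.2, t.2.1]
  · rintro (rfl | ⟨rfl, rfl⟩ | ⟨rfl, rfl⟩)
    · exact ⟨0, by simp⟩
    · exact ⟨-1, by simp⟩
    · exact ⟨1, by simp⟩

lemma circleExp_surjective : Function.Surjective fun t : I => Circle.exp (2 * Real.pi * t) := by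
  intro z
  have hpi := Real.pi_pos
  obtain ⟨x, hx⟩ : ∃ x, Circle.exp x = z := ⟨_, Circle.exp_arg z⟩
  refine ⟨⟨Int.fract (x / (2 * Real.pi)), Int.fract_nonneg _, (Int.fract_lt_one _).le⟩, ?_⟩
  rw [← hx, Circle.exp_eq_exp]
  refine ⟨-⌊x / (2 * Real.pi)⌋, ?_⟩
  simp only [Int.fract]
  push_cast
  field_simp
  ring

variable {B : Type} {E : B → Type} [∀ x, AddCommGroup (E x)] [∀ x, Module ℝ (E x)]

/-- The strip `[0, 1] × ℝ` over a path, mapped to the total space by the multiples of a section. -/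
def strip (G : I → TotalSpace ℝ E) (x : I × ℝ) : TotalSpace ℝ E := fiberSMul x.2 (G x.1)

lemma strip_eq_iff {p : I → B} (hp : ∀ s t, p s = p t ↔ s = t ∨ (s = 0 ∧ t = 1) ∨ (s = 1 ∧ t = 0))
    {G : I → TotalSpace ℝ E} (hG : ∀ s, (G s).proj = p s ∧ (G s).2 ≠ 0) {ε : ℝ}
    (hε : G 1 = fiberSMul ε (G 0)) (x y : I × ℝ) :
    strip G x = strip G y ↔ x = y ∨ (x.1 = 0 ∧ y.1 = 1 ∧ x.2 = y.2 * ε) ∨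
      (x.1 = 1 ∧ y.1 = 0 ∧ y.2 = x.2 * ε) := by
  obtain ⟨s, r⟩ := x
  obtain ⟨t, q⟩ := y
  have h0 := fiberSMul_injective (hG 0).2
  simp only [strip, Prod.mk.injEq]
  constructor
  · intro h
    have hpr : p s = p t := by
      rw [← (hG s).1, ← (hG t).1]
      change (fiberSMul r (G s)).proj = (fiberSMul q (G t)).proj
      rw [h]
    rcases (hp s t).1 hpr with rfl | ⟨rfl, rfl⟩ | ⟨rfl, rfl⟩
    · exact Or.inl ⟨rfl, fiberSMul_injective (hG s).2 h⟩
    · rw [hε, fiberSMul_fiberSMul] at h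
      exact Or.inr (Or.inl ⟨rfl, rfl, h0 h⟩)
    · rw [hε, fiberSMul_fiberSMul] at h
      exact Or.inr (Or.inr ⟨rfl, rfl, (h0 h).symm⟩)
  · rintro (⟨rfl, rfl⟩ | ⟨rfl, rfl, rfl⟩ | ⟨rfl, rfl, rfl⟩)
    · rfl
    · rw [hε, fiberSMul_fiberSMul]
    · rw [hε, fiberSMul_fiberSMul]

variable [TopologicalSpace B] [∀ x, TopologicalSpace (E x)] [TopologicalSpace (TotalSpace ℝ E)]
  [FiberBundle ℝ E] [VectorBundle ℝ ℝ E]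

lemma continuous_strip {G : I → TotalSpace ℝ E} (hG : Continuous G) : Continuous (strip G) :=
  continuous_fiberSMul.comp (continuous_snd.prodMk (hG.comp continuous_fst))

lemma isProperMap_strip [T2Space B] {p : I → B} (hp : Continuous p) {G : I → TotalSpace ℝ E}
    (hGc : Continuous G) (hG : ∀ s, (G s).proj = p s ∧ (G s).2 ≠ 0) :
    IsProperMap (strip G) := by
  rw [isProperMap_iff_ultrafilter]
  refine ⟨continuous_strip hGc, fun 𝒰 z hz => ?_⟩
  obtain ⟨t, -, ht⟩ := isCompact_univ.ultrafilter_le_nhds (𝒰.map Prod.fst) (by simp)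
  have ht' : Filter.Tendsto Prod.fst (𝒰 : Filter (I × ℝ)) (𝓝 t) := ht
  have hproj : p t = z.proj := by
    refine tendsto_nhds_unique ((hp.tendsto t).comp ht') ?_
    refine (((FiberBundle.continuous_proj ℝ E).tendsto z).comp hz).congr fun x => ?_
    exact (hG x.1).1
  set e := trivializationAt ℝ E z.proj with he
  have hb : z.proj ∈ e.baseSet := FiberBundle.mem_baseSet_trivializationAt' z.proj
  have hGt : (G t).proj ∈ e.baseSet := by rw [(hG t).1, hproj]; exact hb
  have hc0 : (e (G t)).2 ≠ 0 :=
    fun h => (hG t).2 ((trivialization_apply_snd_eq_zero e hGt).1 h)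
  have hzs : Filter.Tendsto (fun x => (e (strip G x)).2) 𝒰 (𝓝 (e z).2) :=
    (continuous_snd.tendsto _).comp
      ((e.toOpenPartialHomeomorph.continuousAt (e.mem_source.2 hb)).tendsto.comp hz)
  have hcs : Filter.Tendsto (fun x : I × ℝ => (e (G x.1)).2) 𝒰 (𝓝 (e (G t)).2) :=
    (continuous_snd.tendsto _).comp
      ((e.toOpenPartialHomeomorph.continuousAt (e.mem_source.2 hGt)).tendsto.comp
        ((hGc.tendsto t).comp ht'))
  have hbase : ∀ᶠ x : I × ℝ in 𝒰, (G x.1).proj ∈ e.baseSet := by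
    have h1 : ContinuousAt (fun s => (G s).proj) t :=
      ((FiberBundle.continuous_proj ℝ E).comp hGc).continuousAt
    exact ht'.eventually (h1.eventually (e.open_baseSet.mem_nhds hGt))
  have hr : Filter.Tendsto Prod.snd (𝒰 : Filter (I × ℝ)) (𝓝 ((e z).2 / (e (G t)).2)) := by
    refine (hzs.div hcs hc0).congr' ?_
    filter_upwards [hbase, hcs.eventually_ne hc0] with x hx hx0
    change (e (fiberSMul x.2 (G x.1))).2 / _ = _
    rw [trivialization_apply_fiberSMul e hx, mul_div_cancel_right₀ _ hx0]
  refine ⟨(t, (e z).2 / (e (G t)).2), ?_, ?_⟩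
  · refine trivialization_ext e hb ((hG t).1.trans hproj) ?_
    change (e (fiberSMul _ (G t))).2 = _
    rw [trivialization_apply_fiberSMul e hGt, div_mul_cancel₀ _ hc0]
  · rw [nhds_prod_eq]
    exact Filter.le_prod.2 ⟨ht', hr⟩

lemma strip_surjective {p : I → B} (hp : Function.Surjective p) {G : I → TotalSpace ℝ E}
    (hG : ∀ s, (G s).proj = p s ∧ (G s).2 ≠ 0) : Function.Surjective (strip G) := by
  intro z
  obtain ⟨s, hs⟩ := hp z.proj
  obtain ⟨r, hr⟩ := exists_fiberSMul_eq (hG s).2 (w := z) (by rw [(hG s).1, hs])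
  exact ⟨(s, r), hr.symm⟩

/-- A quotient of the strip identifying the two ends without a flip is a cylinder. -/
lemma nonempty_homeomorph_cylinder {X : Type} [TopologicalSpace X] {Φ : I × ℝ → X}
    (hΦ : IsQuotientMap Φ)
    (h : ∀ x y, Φ x = Φ y ↔ x = y ∨ (x.1 = 0 ∧ y.1 = 1 ∧ x.2 = y.2 * 1) ∨
      (x.1 = 1 ∧ y.1 = 0 ∧ y.2 = x.2 * 1)) : Nonempty (X ≃ₜ Cylinder) := by
  obtain ⟨φ, -⟩ := exists_homeomorph_Ioo
  let c : I → Circle := fun t => Circle.exp (2 * Real.pi * t)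
  have hcc : Continuous c := by fun_prop
  have hc : IsProperMap c := hcc.isProperMap
  have hq : IsProperMap (Prod.map c φ) := hc.prodMap φ.isProperMap
  have hs : Function.Surjective (Prod.map c φ) := circleExp_surjective.prodMap φ.surjective
  refine nonempty_homeomorph_of_isQuotientMap hΦ
    (hq.isClosedMap.isQuotientMap hq.continuous hs) fun x y => ?_
  have hfib : Prod.map c φ x = Prod.map c φ y ↔ c x.1 = c y.1 ∧ φ x.2 = φ y.2 := Prod.ext_iff
  rw [h, hfib, circleExp_eq_iff, φ.injective.eq_iff, Prod.ext_iff, mul_one, mul_one]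
  tauto

/-- A quotient of the strip identifying the two ends with a flip is a Möbius band. -/
lemma nonempty_homeomorph_moebiusBand {X : Type} [TopologicalSpace X] {Φ : I × ℝ → X}
    (hΦ : IsQuotientMap Φ)
    (h : ∀ x y, Φ x = Φ y ↔ x = y ∨ (x.1 = 0 ∧ y.1 = 1 ∧ x.2 = y.2 * -1) ∨
      (x.1 = 1 ∧ y.1 = 0 ∧ y.2 = x.2 * -1)) : Nonempty (X ≃ₜ MoebiusBand) := by
  obtain ⟨φ, hφ⟩ := exists_homeomorph_Ioo
  let τ : Set.Icc (0 : ℝ) 1 × Set.Ioo (0 : ℝ) 1 ≃ₜ I × ℝ :=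
    (Homeomorph.refl I).prodCongr φ.symm
  have hflip : ∀ y y' : Set.Ioo (0 : ℝ) 1,
      (y' : ℝ) = 1 - y ↔ φ.symm y = φ.symm y' * -1 := by
    intro y y'
    obtain ⟨r, rfl⟩ := φ.surjective y
    obtain ⟨r', rfl⟩ := φ.surjective y'
    rw [← hφ, Subtype.coe_inj, φ.injective.eq_iff, φ.symm_apply_apply, φ.symm_apply_apply]
    constructor <;> intro h <;> linarith
  let f : MoebiusBand → X := Quot.lift (Φ ∘ τ) (by
    rintro ⟨s, y⟩ ⟨t, y'⟩ ⟨hs, ht, hy⟩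
    refine (h _ _).2 (Or.inr (Or.inl ⟨Subtype.ext hs, Subtype.ext ht, ?_⟩))
    exact (hflip y y').1 hy)
  have hcomp : f ∘ Quot.mk _ = Φ ∘ τ := rfl
  have hfc : Continuous f := continuous_quot_lift _ (hΦ.continuous.comp τ.continuous)
  have hfq : IsQuotientMap f := by
    refine IsQuotientMap.of_comp continuous_quot_mk hfc ?_
    rw [hcomp]
    exact hΦ.comp τ.isQuotientMap
  have hinj : Function.Injective f := by
    rintro ⟨s, y⟩ ⟨t, y'⟩ hxy
    rcases (h _ _).1 hxy with h1 | ⟨hs, ht, hy⟩ | ⟨hs, ht, hy⟩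
    · rw [τ.injective h1]
    · refine Quot.sound ⟨congrArg Subtype.val hs, congrArg Subtype.val ht, (hflip y y').2 hy⟩
    · refine (Quot.sound ⟨congrArg Subtype.val ht, congrArg Subtype.val hs, (hflip y' y).2 hy⟩).symm
  exact ⟨((isHomeomorph_iff_isQuotientMap_injective.2 ⟨hfq, hinj⟩).homeomorph f).symm⟩

end Models

/-! ### Two charts along a closed curve -/

section Gluing

open unitInterval

/-- Two planar charts of a space, which overlap exactly where `y ≠ 0` in the first chart, with the
coordinate change `(x, y) ↦ (y⁻¹, x * y ^ a)`. The axis `x = 0` of the first chart and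
the axis `y = 0` of the second one fit together to a closed curve. -/
structure GluedCharts (X : Type) [TopologicalSpace X] (a : ℤ) where
  /-- The first chart. -/
  fst : ℝ × ℝ → X
  /-- The second chart. -/
  snd : ℝ × ℝ → X
  isOpenEmbedding_fst : Topology.IsOpenEmbedding fst
  isOpenEmbedding_snd : Topology.IsOpenEmbedding snd
  glue : ∀ x y, y ≠ 0 → fst (x, y) = snd (y⁻¹, x * y ^ a)
  ne_zero : ∀ z w, fst z = snd w → z.2 ≠ 0

namespace GluedCharts

variable {X : Type} [TopologicalSpace X] {a : ℤ} (D : GluedCharts X a)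

/-- The closed curve formed by the two axes. -/
def curve : Set X := {q | (∃ c, D.fst (0, c) = q) ∨ ∃ c, D.snd (c, 0) = q}

lemma fst_zero_mem_curve (c : ℝ) : D.fst (0, c) ∈ D.curve := Or.inl ⟨c, rfl⟩

lemma snd_zero_mem_curve (c : ℝ) : D.snd (c, 0) ∈ D.curve := Or.inr ⟨c, rfl⟩

lemma fst_zero_eq_snd {c : ℝ} (hc : c ≠ 0) : D.fst (0, c) = D.snd (c⁻¹, 0) := by
  rw [D.glue 0 c hc, zero_mul]

lemma eq_of_fst_eq_snd {z w : ℝ × ℝ} (h : D.fst z = D.snd w) :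
    w = (z.2⁻¹, z.1 * z.2 ^ a) := by
  refine D.isOpenEmbedding_snd.injective ?_
  rw [← h, ← D.glue _ _ (D.ne_zero z w h)]

lemma fst_mem_curve_iff {z : ℝ × ℝ} : D.fst z ∈ D.curve ↔ z.1 = 0 := by
  constructor
  · rintro (⟨c, hc⟩ | ⟨c, hc⟩)
    · rw [← D.isOpenEmbedding_fst.injective hc]
    · have h0 := congrArg Prod.snd (D.eq_of_fst_eq_snd hc.symm)
      exact (mul_eq_zero.1 h0.symm).resolve_right (zpow_ne_zero _ (D.ne_zero _ _ hc.symm))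
  · intro h
    rw [← Prod.mk.eta (p := z), h]
    exact D.fst_zero_mem_curve _

lemma snd_mem_curve_iff {z : ℝ × ℝ} : D.snd z ∈ D.curve ↔ z.2 = 0 := by
  constructor
  · rintro (⟨c, hc⟩ | ⟨c, hc⟩)
    · rw [D.eq_of_fst_eq_snd hc]
      exact zero_mul _
    · rw [← D.isOpenEmbedding_snd.injective hc]
  · intro h
    rw [← Prod.mk.eta (p := z), h]
    exact D.snd_zero_mem_curve _

/-- The curve is Hausdorff, although no separation is assumed of the space. -/
instance t2Space_curve : T2Space D.curve := by
  have chart : ∀ {f : ℝ × ℝ → X}, Topology.IsOpenEmbedding f → ∀ z w, z ≠ w →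
      SeparatedNhds {f z} {f w} := by
    intro f hf z w hzw
    obtain ⟨u, v, hu, hv, hzu, hwv, huv⟩ := t2_separation hzw
    refine ⟨f '' u, f '' v, hf.isOpenMap u hu, hf.isOpenMap v hv, ?_, ?_, ?_⟩
    · rintro _ rfl; exact ⟨z, hzu, rfl⟩
    · rintro _ rfl; exact ⟨w, hwv, rfl⟩
    · exact Set.disjoint_image_of_injective hf.injective huv
  -- each origin lies in one chart only; as `y` becomes `y⁻¹`, the strips `|y| < 1` are disjoint
  have origins : SeparatedNhds {D.fst (0, 0)} {D.snd (0, 0)} := by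
    refine ⟨D.fst '' {z | |z.2| < 1}, D.snd '' {z | |z.1| < 1},
      D.isOpenEmbedding_fst.isOpenMap _ (isOpen_lt (by fun_prop) continuous_const),
      D.isOpenEmbedding_snd.isOpenMap _ (isOpen_lt (by fun_prop) continuous_const), ?_, ?_, ?_⟩
    · rintro _ rfl; exact ⟨_, by simp, rfl⟩
    · rintro _ rfl; exact ⟨_, by simp, rfl⟩
    · rw [Set.disjoint_left]
      rintro _ ⟨z, hz, rfl⟩ ⟨w, hw, hwz⟩
      have h1 := congrArg Prod.fst (D.eq_of_fst_eq_snd hwz.symm)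
      have h0 : 0 < |z.2| := abs_pos.2 (D.ne_zero _ _ hwz.symm)
      have hw' : |w.1| < 1 := hw
      have hz' : |z.2| < 1 := hz
      rw [h1, abs_inv] at hw'
      exact absurd hw' (not_lt.2 (one_le_inv_iff₀.2 ⟨h0, hz'.le⟩))
  have key : ∀ q ∈ D.curve, ∀ q' ∈ D.curve, q ≠ q' → SeparatedNhds {q} {q'} := by
    have cases : ∀ q ∈ D.curve, q = D.snd (0, 0) ∨ ∃ c, D.fst (0, c) = q := by
      rintro q (h | ⟨c, rfl⟩)
      · exact Or.inr h
      · rcases eq_or_ne c 0 with rfl | hc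
        · exact Or.inl rfl
        · exact Or.inr ⟨c⁻¹, by rw [D.fst_zero_eq_snd (inv_ne_zero hc), inv_inv]⟩
    have mixed : ∀ c, SeparatedNhds {D.fst (0, c)} {D.snd (0, 0)} := by
      intro c
      rcases eq_or_ne c 0 with rfl | hc
      · exact origins
      · rw [D.fst_zero_eq_snd hc]
        exact chart D.isOpenEmbedding_snd _ _ (by simpa using hc)
    intro q hq q' hq' hne
    rcases cases q hq with rfl | ⟨c, rfl⟩ <;> rcases cases q' hq' with rfl | ⟨c', rfl⟩
    · exact absurd rfl hne
    · exact (mixed c').symm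
    · exact mixed c
    · exact chart D.isOpenEmbedding_fst _ _ fun h => hne (by rw [h])
  refine ⟨fun q q' hne => ?_⟩
  obtain ⟨u, v, hu, hv, hqu, hqv, huv⟩ := key q q.2 q' q'.2 fun h => hne (Subtype.ext h)
  exact ⟨_, _, hu.preimage continuous_subtype_val, hv.preimage continuous_subtype_val,
    hqu rfl, hqv rfl, huv.preimage _⟩

/-- The closed curve as a path: the coordinate `c` on the axis of the first chart is
`(2t - 1) / (t (1 - t))`, and both ends are the origin of the second chart. -/
def path (t : ℝ) : X :=
  if t * (1 - t) = 0 then D.snd (0, 0) else D.fst (0, (2 * t - 1) / (t * (1 - t)))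

lemma path_eq_fst {t : ℝ} (ht : t * (1 - t) ≠ 0) :
    D.path t = D.fst (0, (2 * t - 1) / (t * (1 - t))) := if_neg ht

lemma path_eq_snd {t : ℝ} (ht : 2 * t - 1 ≠ 0) :
    D.path t = D.snd (t * (1 - t) / (2 * t - 1), 0) := by
  by_cases h : t * (1 - t) = 0
  · rw [path, if_pos h, h, zero_div]
  · rw [D.path_eq_fst h, D.fst_zero_eq_snd (div_ne_zero ht h), inv_div]

lemma path_mem_curve (t : ℝ) : D.path t ∈ D.curve := by
  rw [path]
  split_ifs
  · exact D.snd_zero_mem_curve _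
  · exact D.fst_zero_mem_curve _

lemma continuous_path : Continuous D.path := by
  rw [continuous_iff_continuousAt]
  intro t
  by_cases h : 2 * t - 1 = 0
  · have ht : t * (1 - t) ≠ 0 := by
      have : t = 1 / 2 := by linarith
      norm_num [this]
    have hc : ContinuousAt (fun t : ℝ => D.fst (0, (2 * t - 1) / (t * (1 - t)))) t :=
      D.isOpenEmbedding_fst.continuous.continuousAt.comp
        (continuousAt_const.prodMk (ContinuousAt.div (f := fun t : ℝ => 2 * t - 1)
          (g := fun t : ℝ => t * (1 - t)) (by fun_prop) (by fun_prop) ht))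
    refine hc.congr ?_
    have : ∀ᶠ s : ℝ in 𝓝 t, s * (1 - s) ≠ 0 :=
      (show Continuous fun s : ℝ => s * (1 - s) by fun_prop).continuousAt.eventually_ne ht
    filter_upwards [this] with s hs
    exact (D.path_eq_fst hs).symm
  · have hc : ContinuousAt (fun t : ℝ => D.snd (t * (1 - t) / (2 * t - 1), 0)) t :=
      D.isOpenEmbedding_snd.continuous.continuousAt.comp
        ((ContinuousAt.div (f := fun t : ℝ => t * (1 - t))
          (g := fun t : ℝ => 2 * t - 1) (by fun_prop) (by fun_prop) h).prodMk continuousAt_const)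
    refine hc.congr ?_
    have : ∀ᶠ s : ℝ in 𝓝 t, 2 * s - 1 ≠ 0 :=
      (show Continuous fun s : ℝ => 2 * s - 1 by fun_prop).continuousAt.eventually_ne h
    filter_upwards [this] with s hs
    exact (D.path_eq_snd hs).symm

lemma mul_one_sub_eq_zero_iff (s : I) : (s : ℝ) * (1 - s) = 0 ↔ s = 0 ∨ s = 1 := by
  rw [mul_eq_zero, sub_eq_zero, ← Set.Icc.coe_eq_zero, ← Set.Icc.coe_eq_one, eq_comm (a := (1 : ℝ))]

lemma path_eq_iff (s t : I) :
    D.path s = D.path t ↔ s = t ∨ (s = 0 ∧ t = 1) ∨ (s = 1 ∧ t = 0) := by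
  have ends : ∀ s : I, (s : ℝ) * (1 - s) = 0 → D.path s = D.snd (0, 0) := fun s h => if_pos h
  have inner : ∀ s : I, (s : ℝ) * (1 - s) ≠ 0 → D.path s ≠ D.snd (0, 0) := by
    intro s hs h
    rw [D.path_eq_fst hs] at h
    have h1 := congrArg Prod.fst (D.eq_of_fst_eq_snd h)
    exact inv_ne_zero (D.ne_zero _ _ h) h1.symm
  constructor
  · intro h
    by_cases hs : (s : ℝ) * (1 - s) = 0 <;> by_cases ht : (t : ℝ) * (1 - t) = 0
    · rcases (mul_one_sub_eq_zero_iff s).1 hs with rfl | rfl <;>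
        rcases (mul_one_sub_eq_zero_iff t).1 ht with rfl | rfl <;> simp
    · exact absurd (h.symm.trans (ends s hs)) (inner t ht)
    · exact absurd (h.trans (ends t ht)) (inner s hs)
    · left
      rw [D.path_eq_fst hs, D.path_eq_fst ht] at h
      have h1 := congrArg Prod.snd (D.isOpenEmbedding_fst.injective h)
      simp only at h1
      rw [div_eq_div_iff hs ht] at h1
      have h2 : ((s : ℝ) - t) * (s * t + (1 - s) * (1 - t)) = 0 := by linear_combination h1
      have hs0 : 0 < (s : ℝ) := lt_of_le_of_ne s.2.1 fun h => hs (by rw [← h, zero_mul])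
      have ht0 : 0 < (t : ℝ) := lt_of_le_of_ne t.2.1 fun h => ht (by rw [← h, zero_mul])
      have h3 : 0 < (s : ℝ) * t + (1 - s) * (1 - t) :=
        add_pos_of_pos_of_nonneg (mul_pos hs0 ht0)
          (mul_nonneg (sub_nonneg.2 s.2.2) (sub_nonneg.2 t.2.2))
      exact Subtype.ext (sub_eq_zero.1 ((mul_eq_zero.1 h2).resolve_right h3.ne'))
  · rintro (rfl | ⟨rfl, rfl⟩ | ⟨rfl, rfl⟩)
    · rfl
    · rw [ends 0 (by simp), ends 1 (by simp)]
    · rw [ends 0 (by simp), ends 1 (by simp)]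

lemma exists_path_eq {q : X} (hq : q ∈ D.curve) : ∃ t : I, D.path t = q := by
  have axis : ∀ c, ∃ t : I, D.path t = D.fst (0, c) := by
    intro c
    -- the parameter of `c` is a root of `c t (1 - t) - (2t - 1)`
    have hcont : ContinuousOn (fun t : ℝ => c * (t * (1 - t)) - (2 * t - 1)) (Set.Icc 0 1) := by
      fun_prop
    obtain ⟨t, ht, h0⟩ := intermediate_value_Icc' zero_le_one hcont
      (show (0 : ℝ) ∈ Set.Icc _ _ by norm_num)
    have ht0 : t * (1 - t) ≠ 0 := by
      intro h
      simp only [h] at h0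
      rcases mul_eq_zero.1 h with h | h
      · rw [h] at h0; norm_num at h0
      · rw [show t = 1 by linarith] at h0; norm_num at h0
    refine ⟨⟨t, ht⟩, ?_⟩
    rw [D.path_eq_fst ht0, (div_eq_iff ht0).2 (show 2 * t - 1 = c * (t * (1 - t)) by linarith)]
  rcases hq with ⟨c, rfl⟩ | ⟨c, rfl⟩
  · exact axis c
  · rcases eq_or_ne c 0 with rfl | hc
    · exact ⟨0, if_pos (by simp)⟩
    · obtain ⟨t, ht⟩ := axis c⁻¹
      exact ⟨t, by rw [ht, D.fst_zero_eq_snd (inv_ne_zero hc), inv_inv]⟩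

end GluedCharts
end Gluing

/-! ### The sign of the transverse coordinate along the curve -/

namespace GluedCharts

variable {X : Type} [TopologicalSpace X] {a : ℤ} (D : GluedCharts X a)

/-- The points of the first chart off the curve, on the side where the transverse coordinate has
the sign of `s`. -/
def fstSide (s : ℝ) : Set X := D.fst '' {z | 0 < s * z.1}

/-- The points of the second chart off the curve, on the side where the transverse coordinate has
the sign of `s`. -/
def sndSide (s : ℝ) : Set X := D.snd '' {z | 0 < s * z.2}

lemma isOpen_fstSide (s : ℝ) : IsOpen (D.fstSide s) :=
  D.isOpenEmbedding_fst.isOpenMap _ (isOpen_lt continuous_const (by fun_prop))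

lemma isOpen_sndSide (s : ℝ) : IsOpen (D.sndSide s) :=
  D.isOpenEmbedding_snd.isOpenMap _ (isOpen_lt continuous_const (by fun_prop))

lemma fst_mem_fstSide {s : ℝ} {z : ℝ × ℝ} : D.fst z ∈ D.fstSide s ↔ 0 < s * z.1 :=
  D.isOpenEmbedding_fst.injective.mem_set_image

lemma snd_mem_sndSide {s : ℝ} {z : ℝ × ℝ} : D.snd z ∈ D.sndSide s ↔ 0 < s * z.2 :=
  D.isOpenEmbedding_snd.injective.mem_set_image

lemma mul_pos_of_mem_fstSide {s s' : ℝ} {q : X} (h : q ∈ D.fstSide s) (h' : q ∈ D.fstSide s') :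
    0 < s * s' := by
  obtain ⟨z, hz, rfl⟩ := h
  rw [fst_mem_fstSide] at h'
  have hz' : 0 < s * z.1 := hz
  have h0 : z.1 ≠ 0 := fun h => by simp [h] at hz'
  have := mul_pos hz' h'
  rw [show s * z.1 * (s' * z.1) = s * s' * (z.1 * z.1) by ring] at this
  exact (pos_iff_pos_of_mul_pos this).2 (mul_self_pos.2 h0)

lemma mul_pos_of_mem_sndSide {s s' : ℝ} {q : X} (h : q ∈ D.sndSide s) (h' : q ∈ D.sndSide s') :
    0 < s * s' := by
  obtain ⟨z, hz, rfl⟩ := h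
  rw [snd_mem_sndSide] at h'
  have hz' : 0 < s * z.2 := hz
  have h0 : z.2 ≠ 0 := fun h => by simp [h] at hz'
  have := mul_pos hz' h'
  rw [show s * z.2 * (s' * z.2) = s * s' * (z.2 * z.2) by ring] at this
  exact (pos_iff_pos_of_mul_pos this).2 (mul_self_pos.2 h0)

lemma mem_fstSide_or {q : X} (hq : q ∈ Set.range D.fst) (hK : q ∉ D.curve) {s : ℝ} (hs : s ≠ 0) :
    q ∈ D.fstSide s ∪ D.fstSide (-s) := by
  obtain ⟨z, rfl⟩ := hq
  rw [fst_mem_curve_iff] at hK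
  rw [Set.mem_union, fst_mem_fstSide, fst_mem_fstSide, neg_mul, neg_pos]
  exact (lt_or_gt_of_ne (mul_ne_zero hs hK)).symm

lemma mem_sndSide_or {q : X} (hq : q ∈ Set.range D.snd) (hK : q ∉ D.curve) {s : ℝ} (hs : s ≠ 0) :
    q ∈ D.sndSide s ∪ D.sndSide (-s) := by
  obtain ⟨z, rfl⟩ := hq
  rw [snd_mem_curve_iff] at hK
  rw [Set.mem_union, snd_mem_sndSide, snd_mem_sndSide, neg_mul, neg_pos]
  exact (lt_or_gt_of_ne (mul_ne_zero hs hK)).symm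

/-- Where the coordinate along the curve is positive, the two transverse coordinates have the same
sign. -/
lemma mem_sndSide_of_pos {s : ℝ} {q : X} (hq : q ∈ D.fst '' {z | 0 < z.2}) (h : q ∈ D.fstSide s) :
    q ∈ D.sndSide s := by
  obtain ⟨⟨x, y⟩, hy, rfl⟩ := hq
  have hy' : 0 < y := hy
  rw [fst_mem_fstSide] at h
  rw [D.glue x y hy'.ne', snd_mem_sndSide]
  simp only at h ⊢
  rw [← mul_assoc]
  exact mul_pos h (zpow_pos hy' a)

/-- Where the coordinate along the curve is negative, the signs of the two transverse coordinates
differ by the factor `(-1) ^ a`. -/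
lemma mem_sndSide_of_neg {s : ℝ} {q : X} (hq : q ∈ D.fst '' {z | z.2 < 0}) (h : q ∈ D.fstSide s) :
    q ∈ D.sndSide (s * (-1) ^ a) := by
  obtain ⟨⟨x, y⟩, hy, rfl⟩ := hq
  have hy' : y < 0 := hy
  rw [fst_mem_fstSide] at h
  rw [D.glue x y hy'.ne, snd_mem_sndSide]
  simp only at h ⊢
  rw [show s * (-1 : ℝ) ^ a * (x * y ^ a) = s * x * ((-1) ^ a * y ^ a) by ring, ← mul_zpow]
  exact mul_pos h (zpow_pos (by linarith) a)

/-- An open set of the plane containing a compact piece of the axis contains a tube around it. -/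
lemma exists_tube {S : Set ℝ} (hS : IsCompact S) {N : Set (ℝ × ℝ)} (hN : IsOpen N)
    (h : ∀ t ∈ S, (t, (0 : ℝ)) ∈ N) : ∃ δ > 0, ∀ t ∈ S, ∀ r : ℝ, |r| < δ → (t, r) ∈ N := by
  obtain ⟨u, v, -, hv, hSu, h0v, huv⟩ := generalized_tube_lemma hS (isCompact_singleton (x := (0 : ℝ)))
    hN (by rintro ⟨t, r⟩ ⟨ht, hr⟩; obtain rfl : r = 0 := hr; exact h t ht)
  obtain ⟨δ, hδ, hball⟩ := Metric.isOpen_iff.1 hv 0 (h0v rfl)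
  exact ⟨δ, hδ, fun t ht r hr => huv ⟨hSu ht, hball (by simpa using hr)⟩⟩

/-- A strip around the closed curve: over the parameter interval it follows the path, it meets the
curve only in the zero section, its two ends are glued by the factor `ε`, and it covers a
neighbourhood of the midpoint of the path. -/
structure IsStrip (Ψ : ℝ × ℝ → X) (ε : ℝ) : Prop where
  continuous : Continuous Ψ
  zero : ∀ t ∈ Set.Icc (0 : ℝ) 1, Ψ (t, 0) = D.path t
  mem_curve : ∀ t ∈ Set.Icc (0 : ℝ) 1, ∀ r, Ψ (t, r) ∈ D.curve → r = 0
  ends : ∀ r, Ψ (1, r) = Ψ (0, r * ε)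
  nhds_le : 𝓝 (D.path (1 / 2)) ≤ Filter.map Ψ (𝓝 (1 / 2, 0))

variable {D} {Ψ : ℝ × ℝ → X} {ε : ℝ}

lemma IsStrip.exists_forall_mem (h : D.IsStrip Ψ ε) {S : Set ℝ} (hS : IsCompact S)
    (hS1 : S ⊆ Set.Icc 0 1) {V : Set X} (hV : IsOpen V) (hp : ∀ t ∈ S, D.path t ∈ V) :
    ∃ δ > 0, ∀ t ∈ S, ∀ r : ℝ, |r| < δ → Ψ (t, r) ∈ V :=
  exists_tube hS (hV.preimage h.continuous) fun t ht => by
    rw [Set.mem_preimage, h.zero t (hS1 ht)]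
    exact hp t ht

lemma IsStrip.forall_mem_fstSide (h : D.IsStrip Ψ ε) {C : Set (ℝ × ℝ)} (hC : IsPreconnected C)
    (hC1 : ∀ x ∈ C, x.1 ∈ Set.Icc (0 : ℝ) 1 ∧ x.2 ≠ 0) (hfst : ∀ x ∈ C, Ψ x ∈ Set.range D.fst)
    {s : ℝ} {x₀ : ℝ × ℝ} (hx₀ : x₀ ∈ C) (hs : Ψ x₀ ∈ D.fstSide s) : ∀ x ∈ C, Ψ x ∈ D.fstSide s := by
  have hs0 : s ≠ 0 := fun h0 => by
    have := D.mul_pos_of_mem_fstSide hs hs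
    simp [h0] at this
  refine hC.subset_left_of_subset_union (u := Ψ ⁻¹' D.fstSide s) (v := Ψ ⁻¹' D.fstSide (-s))
    ((D.isOpen_fstSide s).preimage h.continuous)
    ((D.isOpen_fstSide (-s)).preimage h.continuous) ?_ ?_ ⟨x₀, hx₀, hs⟩
  · rw [Set.disjoint_left]
    intro x hx hx'
    have := D.mul_pos_of_mem_fstSide hx hx'
    nlinarith [mul_self_nonneg s]
  · intro x hx
    exact D.mem_fstSide_or (hfst x hx) (fun hk => (hC1 x hx).2 (h.mem_curve _ (hC1 x hx).1 _ hk)) hs0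

lemma IsStrip.forall_mem_sndSide (h : D.IsStrip Ψ ε) {C : Set (ℝ × ℝ)} (hC : IsPreconnected C)
    (hC1 : ∀ x ∈ C, x.1 ∈ Set.Icc (0 : ℝ) 1 ∧ x.2 ≠ 0) (hsnd : ∀ x ∈ C, Ψ x ∈ Set.range D.snd)
    {s : ℝ} {x₀ : ℝ × ℝ} (hx₀ : x₀ ∈ C) (hs : Ψ x₀ ∈ D.sndSide s) : ∀ x ∈ C, Ψ x ∈ D.sndSide s := by
  have hs0 : s ≠ 0 := fun h0 => by
    have := D.mul_pos_of_mem_sndSide hs hs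
    simp [h0] at this
  refine hC.subset_left_of_subset_union (u := Ψ ⁻¹' D.sndSide s) (v := Ψ ⁻¹' D.sndSide (-s))
    ((D.isOpen_sndSide s).preimage h.continuous)
    ((D.isOpen_sndSide (-s)).preimage h.continuous) ?_ ?_ ⟨x₀, hx₀, hs⟩
  · rw [Set.disjoint_left]
    intro x hx hx'
    have := D.mul_pos_of_mem_sndSide hx hx'
    nlinarith [mul_self_nonneg s]
  · intro x hx
    exact D.mem_sndSide_or (hsnd x hx) (fun hk => (hC1 x hx).2 (h.mem_curve _ (hC1 x hx).1 _ hk)) hs0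

/-- Following a thin parallel of the curve from the midpoint to either end: it stays in the first
chart over `[1/4, 3/4]` and in the second chart near the ends, and changing charts on the left
multiplies the sign of the transverse coordinate by `(-1) ^ a`. -/
lemma IsStrip.exists_sides (h : D.IsStrip Ψ ε) : ∃ δ > 0,
    (∀ t ∈ Set.Icc (1 / 4 : ℝ) (3 / 4), ∀ r : ℝ, |r| < δ → Ψ (t, r) ∈ Set.range D.fst) ∧
    ∀ r : ℝ, r ≠ 0 → |r| < δ → ∀ s, Ψ (1 / 2, r) ∈ D.fstSide s →
      (∀ t ∈ Set.Icc (1 / 4 : ℝ) (3 / 4), Ψ (t, r) ∈ D.fstSide s) ∧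
        Ψ (1, r) ∈ D.sndSide s ∧ Ψ (0, r) ∈ D.sndSide (s * (-1) ^ a) := by
  have hsub : Set.Icc (1 / 4 : ℝ) (3 / 4) ⊆ Set.Icc 0 1 :=
    Set.Icc_subset_Icc (by norm_num) (by norm_num)
  have hsubl : Set.Icc (0 : ℝ) (1 / 4) ⊆ Set.Icc 0 1 := Set.Icc_subset_Icc le_rfl (by norm_num)
  have hsubr : Set.Icc (3 / 4 : ℝ) 1 ⊆ Set.Icc 0 1 := Set.Icc_subset_Icc (by norm_num) le_rfl
  have hneg : IsOpen (D.fst '' {z | z.2 < 0}) :=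
    D.isOpenEmbedding_fst.isOpenMap _ (isOpen_lt (by fun_prop) continuous_const)
  have hpos : IsOpen (D.fst '' {z | 0 < z.2}) :=
    D.isOpenEmbedding_fst.isOpenMap _ (isOpen_lt continuous_const (by fun_prop))
  obtain ⟨δ₁, hδ₁, h₁⟩ := h.exists_forall_mem isCompact_Icc hsub D.isOpenEmbedding_fst.isOpen_range
    (fun t ht => by
      rw [D.path_eq_fst (mul_ne_zero (by linarith [ht.1]) (by linarith [ht.2]))]
      exact ⟨_, rfl⟩)
  obtain ⟨δ₂, hδ₂, h₂⟩ := h.exists_forall_mem isCompact_Icc hsubl D.isOpenEmbedding_snd.isOpen_range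
    (fun t ht => by
      rw [D.path_eq_snd (by linarith [ht.2])]
      exact ⟨_, rfl⟩)
  obtain ⟨δ₃, hδ₃, h₃⟩ := h.exists_forall_mem isCompact_Icc hsubr D.isOpenEmbedding_snd.isOpen_range
    (fun t ht => by
      rw [D.path_eq_snd (by linarith [ht.1])]
      exact ⟨_, rfl⟩)
  obtain ⟨δ₄, hδ₄, h₄⟩ := h.exists_forall_mem (isCompact_singleton (x := (1 / 4 : ℝ)))
    (by rintro _ rfl; norm_num) hneg (by
      rintro _ rfl
      rw [D.path_eq_fst (by norm_num)]
      exact ⟨_, by norm_num, rfl⟩)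
  obtain ⟨δ₅, hδ₅, h₅⟩ := h.exists_forall_mem (isCompact_singleton (x := (3 / 4 : ℝ)))
    (by rintro _ rfl; norm_num) hpos (by
      rintro _ rfl
      rw [D.path_eq_fst (by norm_num)]
      exact ⟨_, by norm_num, rfl⟩)
  refine ⟨min δ₁ (min δ₂ (min δ₃ (min δ₄ δ₅))), by positivity,
    fun t ht r hr => h₁ t ht r (hr.trans_le (min_le_left _ _)), fun r hr0 hr s hs => ?_⟩
  simp only [lt_min_iff] at hr
  obtain ⟨hr₁, hr₂, hr₃, hr₄, hr₅⟩ := hr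
  have hseg : ∀ u v : ℝ, IsPreconnected (Set.Icc u v ×ˢ ({r} : Set ℝ)) :=
    fun u v => isPreconnected_Icc.prod isPreconnected_singleton
  have hmid : ∀ t ∈ Set.Icc (1 / 4 : ℝ) (3 / 4), Ψ (t, r) ∈ D.fstSide s := by
    intro t ht
    refine h.forall_mem_fstSide (hseg (1 / 4) (3 / 4)) ?_ ?_ (x₀ := (1 / 2, r)) ?_ hs _ ⟨ht, rfl⟩
    · rintro ⟨t, _⟩ ⟨ht, rfl⟩
      exact ⟨hsub ht, hr0⟩
    · rintro ⟨t, _⟩ ⟨ht, rfl⟩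
      exact h₁ t ht _ hr₁
    · exact ⟨⟨by norm_num, by norm_num⟩, rfl⟩
  refine ⟨hmid, ?_, ?_⟩
  · refine h.forall_mem_sndSide (hseg (3 / 4) 1) ?_ ?_ (x₀ := (3 / 4, r)) ?_
      (D.mem_sndSide_of_pos (h₅ _ rfl r hr₅) (hmid _ ⟨by norm_num, le_rfl⟩)) _
      ⟨⟨by norm_num, le_rfl⟩, rfl⟩
    · rintro ⟨t, _⟩ ⟨ht, rfl⟩
      exact ⟨hsubr ht, hr0⟩
    · rintro ⟨t, _⟩ ⟨ht, rfl⟩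
      exact h₃ t ht _ hr₃
    · exact ⟨⟨le_rfl, by norm_num⟩, rfl⟩
  · refine h.forall_mem_sndSide (hseg 0 (1 / 4)) ?_ ?_ (x₀ := (1 / 4, r)) ?_
      (D.mem_sndSide_of_neg (h₄ _ rfl r hr₄) (hmid _ ⟨le_rfl, by norm_num⟩)) _
      ⟨⟨le_rfl, by norm_num⟩, rfl⟩
    · rintro ⟨t, _⟩ ⟨ht, rfl⟩
      exact ⟨hsubl ht, hr0⟩
    · rintro ⟨t, _⟩ ⟨ht, rfl⟩
      exact h₂ t ht _ hr₂
    · exact ⟨⟨by norm_num, le_rfl⟩, rfl⟩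

/-- Opposite thin parallels lie on opposite sides of the curve: otherwise the strip would miss the
points on one side near the midpoint. -/
lemma IsStrip.opposite_sides (h : D.IsStrip Ψ ε) {δ : ℝ}
    (hfst : ∀ t ∈ Set.Icc (1 / 4 : ℝ) (3 / 4), ∀ r : ℝ, |r| < δ → Ψ (t, r) ∈ Set.range D.fst)
    {r : ℝ} (hr : 0 < r) (hrδ : r < δ) {s : ℝ} (hs : Ψ (1 / 2, r) ∈ D.fstSide s) :
    Ψ (1 / 2, -r) ∈ D.fstSide (-s) := by
  have hs0 : s ≠ 0 := fun h0 => by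
    have := D.mul_pos_of_mem_fstSide hs hs
    simp [h0] at this
  have hhalf : (1 / 2 : ℝ) ∈ Set.Icc (1 / 4 : ℝ) (3 / 4) := by norm_num
  have hsub : Set.Icc (1 / 4 : ℝ) (3 / 4) ⊆ Set.Icc 0 1 :=
    Set.Icc_subset_Icc (by norm_num) (by norm_num)
  have hneg : Ψ (1 / 2, -r) ∈ D.fstSide s ∪ D.fstSide (-s) := by
    refine D.mem_fstSide_or (hfst _ hhalf _ (by rwa [abs_neg, abs_of_pos hr])) (fun hk => ?_) hs0
    exact hr.ne' (neg_eq_zero.1 (h.mem_curve _ (hsub hhalf) _ hk))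
  refine hneg.resolve_left fun hneg => ?_
  -- both halves of the punctured strip lie on one side
  have hright : ∀ x ∈ Set.Icc (1 / 4 : ℝ) (3 / 4) ×ˢ Set.Ioo 0 δ, Ψ x ∈ D.fstSide s := by
    refine h.forall_mem_fstSide (isPreconnected_Icc.prod isPreconnected_Ioo) ?_ ?_
      (x₀ := (1 / 2, r)) ⟨hhalf, hr, hrδ⟩ hs
    · rintro x ⟨hx1, hx2⟩
      exact ⟨hsub hx1, hx2.1.ne'⟩
    · rintro x ⟨hx1, hx2⟩
      exact hfst x.1 hx1 x.2 (by rw [abs_of_pos hx2.1]; exact hx2.2)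
  have hleft : ∀ x ∈ Set.Icc (1 / 4 : ℝ) (3 / 4) ×ˢ Set.Ioo (-δ) 0, Ψ x ∈ D.fstSide s := by
    refine h.forall_mem_fstSide (isPreconnected_Icc.prod isPreconnected_Ioo) ?_ ?_
      (x₀ := (1 / 2, -r)) ⟨hhalf, by simpa using hrδ, by simpa using hr⟩ hneg
    · rintro x ⟨hx1, hx2⟩
      exact ⟨hsub hx1, hx2.2.ne⟩
    · rintro x ⟨hx1, hx2⟩
      exact hfst x.1 hx1 x.2 (by rw [abs_of_neg hx2.2]; linarith [hx2.1])
  have hW : Set.Icc (1 / 4 : ℝ) (3 / 4) ×ˢ Set.Ioo (-δ) δ ∈ 𝓝 ((1 / 2 : ℝ), (0 : ℝ)) :=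
    prod_mem_nhds (Icc_mem_nhds (by norm_num) (by norm_num))
      (Ioo_mem_nhds (by linarith) (by linarith))
  have himg := h.nhds_le (Filter.image_mem_map hW)
  have hpath : D.path (1 / 2) = D.fst (0, 0) := by
    rw [D.path_eq_fst (by norm_num)]
    norm_num
  rw [hpath] at himg
  -- points on the other side converging to the midpoint of the path
  have hline : Filter.Tendsto (fun η : ℝ => D.fst (-s * η, 0)) (𝓝[>] 0) (𝓝 (D.fst (0, 0))) := by
    have hc : Continuous fun η : ℝ => D.fst (-s * η, 0) :=
      D.isOpenEmbedding_fst.continuous.comp (by fun_prop)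
    have := hc.tendsto 0
    rw [mul_zero] at this
    exact this.mono_left nhdsWithin_le_nhds
  obtain ⟨η, ⟨⟨t, q⟩, ⟨ht, hq⟩, hη⟩, hη0⟩ :=
    ((hline.eventually himg).and self_mem_nhdsWithin).exists
  have hη0' : 0 < η := hη0
  have hside : D.fst (-s * η, 0) ∈ D.fstSide (-s) := by
    rw [fst_mem_fstSide]
    have := mul_pos (mul_self_pos.2 hs0) hη0'
    simp only
    linarith
  have hcontra : ∀ q', q' ∈ D.fstSide s → q' ∈ D.fstSide (-s) → False := fun q' h1 h2 => by
    have := D.mul_pos_of_mem_fstSide h1 h2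
    nlinarith [mul_self_nonneg s]
  rw [← hη] at hside
  rcases lt_trichotomy q 0 with hq0 | rfl | hq0
  · exact hcontra _ (hleft _ ⟨ht, hq.1, hq0⟩) hside
  · have hk : Ψ (t, 0) ∈ D.curve := by
      rw [h.zero t (hsub ht)]
      exact D.path_mem_curve t
    rw [hη, fst_mem_curve_iff] at hk
    exact mul_ne_zero (neg_ne_zero.2 hs0) hη0'.ne' hk
  · exact hcontra _ (hright _ ⟨ht, hq0, hq.2⟩) hside

/-- The monodromy of a strip around the curve is `(-1) ^ a`. -/
theorem IsStrip.eq_neg_one_zpow (h : D.IsStrip Ψ ε) (hε : ε = 1 ∨ ε = -1) : ε = (-1) ^ a := by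
  obtain ⟨δ, hδ, hfst, hsides⟩ := h.exists_sides
  have hhalf : (1 / 2 : ℝ) ∈ Set.Icc (1 / 4 : ℝ) (3 / 4) := by norm_num
  have hr0 : 0 < δ / 2 := half_pos hδ
  have hrδ : |δ / 2| < δ := by rw [abs_of_pos hr0]; exact half_lt_self hδ
  have hside : ∃ s, Ψ (1 / 2, δ / 2) ∈ D.fstSide s := by
    have := D.mem_fstSide_or (hfst _ hhalf _ hrδ)
      (fun hk => hr0.ne' (h.mem_curve _ ⟨by norm_num, by norm_num⟩ _ hk)) one_ne_zero
    exact this.elim (fun h => ⟨_, h⟩) (fun h => ⟨_, h⟩)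
  obtain ⟨s, hs⟩ := hside
  obtain ⟨-, hone, hzero⟩ := hsides _ hr0.ne' hrδ s hs
  rw [h.ends] at hone
  have hsign : ∀ κ : ℝ, 0 < s * (s * κ) → 0 < κ := fun κ hκ => by
    rw [← mul_assoc] at hκ
    by_contra hn
    exact hκ.not_ge (mul_nonpos_of_nonneg_of_nonpos (mul_self_nonneg s) (not_lt.1 hn))
  rcases hε with rfl | rfl
  · rw [mul_one] at hone
    have hpos := hsign _ (D.mul_pos_of_mem_sndSide hone hzero)
    rcases Int.even_or_odd a with ha | ha
    · exact ha.neg_one_zpow.symm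
    · rw [ha.neg_one_zpow] at hpos
      norm_num at hpos
  · have hopp := h.opposite_sides hfst hr0 (by rwa [abs_of_pos hr0] at hrδ) hs
    obtain ⟨-, -, hzero'⟩ := hsides _ (neg_ne_zero.2 hr0.ne') (by rwa [abs_neg]) _ hopp
    rw [mul_neg_one] at hone
    have hpos := hsign (-(-1) ^ a) (by
      have := D.mul_pos_of_mem_sndSide hone hzero'
      linarith)
    rcases Int.even_or_odd a with ha | ha
    · rw [ha.neg_one_zpow] at hpos
      norm_num at hpos
    · exact ha.neg_one_zpow.symm

end GluedCharts

/-! ### Tubular neighbourhoods -/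

section Tubular

open Bundle unitInterval Topology

namespace GluedCharts

variable {X : Type} [TopologicalSpace X] {a : ℤ} (D : GluedCharts X a)

/-- The path around the closed curve, with values in the curve. -/
def loop (s : I) : D.curve := ⟨D.path s, D.path_mem_curve s⟩

lemma continuous_loop : Continuous D.loop :=
  (D.continuous_path.comp continuous_subtype_val).subtype_mk _

lemma loop_surjective : Function.Surjective D.loop := fun q =>
  (D.exists_path_eq q.2).imp fun _ h => Subtype.ext h

lemma loop_eq_iff (s t : I) :
    D.loop s = D.loop t ↔ s = t ∨ (s = 0 ∧ t = 1) ∨ (s = 1 ∧ t = 0) := by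
  rw [← D.path_eq_iff, Subtype.ext_iff]
  rfl

variable {D} {U : Set X} {E : D.curve → Type} [∀ x, AddCommGroup (E x)] [∀ x, Module ℝ (E x)]
  [∀ x, TopologicalSpace (E x)] [TopologicalSpace (TotalSpace ℝ E)] [FiberBundle ℝ E]
  [VectorBundle ℝ ℝ E]

/-- A nowhere vanishing section along the closed curve turns a tubular neighbourhood into a
strip. -/
lemma isStrip_of_homeomorph (hU : IsOpen U) (h : TotalSpace ℝ E ≃ₜ U)
    (hz : ∀ x : D.curve, (h ⟨x, 0⟩ : X) = x) {G : I → TotalSpace ℝ E} (hGc : Continuous G)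
    (hG : ∀ s, (G s).proj = D.loop s ∧ (G s).2 ≠ 0) {ε : ℝ} (hε : G 1 = fiberSMul ε (G 0)) :
    D.IsStrip (fun x => h (strip G (Set.projIcc 0 1 zero_le_one x.1, x.2))) ε := by
  have hval : ∀ (s : I) (r : ℝ), Set.projIcc (0 : ℝ) 1 zero_le_one s = s :=
    fun s _ => Set.projIcc_val zero_le_one s
  have hzero : ∀ s : I, strip G (s, 0) = ⟨D.loop s, 0⟩ := by
    intro s
    have hb : ∀ b b' : D.curve, b = b' → (⟨b, 0⟩ : TotalSpace ℝ E) = ⟨b', 0⟩ := by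
      rintro b _ rfl
      rfl
    exact (fiberSMul_zero (G s)).trans (hb _ _ (hG s).1)
  have hemb : IsOpenEmbedding fun z : TotalSpace ℝ E => (h z : X) :=
    hU.isOpenEmbedding_subtypeVal.comp h.isOpenEmbedding
  refine ⟨?_, ?_, ?_, ?_, ?_⟩
  · refine hemb.continuous.comp ((continuous_strip hGc).comp ?_)
    exact (continuous_projIcc.comp continuous_fst).prodMk continuous_snd
  · intro t ht
    simp only [Set.projIcc_of_mem zero_le_one ht]
    rw [hzero, hz]
    rfl
  · intro t ht r hr
    simp only [Set.projIcc_of_mem zero_le_one ht] at hr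
    set s : I := ⟨t, ht⟩
    have h1 : strip G (s, r) = ⟨⟨_, hr⟩, 0⟩ := hemb.injective (hz ⟨_, hr⟩).symm
    have h2 : (⟨_, hr⟩ : D.curve) = D.loop s := by
      rw [← (hG s).1]
      exact (congrArg (fun z : TotalSpace ℝ E => z.proj) h1).symm
    rw [h2, ← hzero] at h1
    exact fiberSMul_injective (hG s).2 h1
  · intro r
    simp only [Set.projIcc_left, Set.projIcc_right]
    change ((h (fiberSMul r (G 1)) : U) : X) = h (fiberSMul (r * ε) (G 0))
    rw [hε, fiberSMul_fiberSMul]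
  · let m : I := ⟨1 / 2, by norm_num, by norm_num⟩
    have hm : D.path (1 / 2) = h (strip G (m, 0)) := by
      rw [hzero, hz]
      rfl
    rw [hm, ← hemb.map_nhds_eq]
    intro W hW
    rw [Filter.mem_map] at hW ⊢
    have hproper := isProperMap_strip D.continuous_loop hGc hG
    have hfib := hproper.isClosedMap.eventually_nhds_fiber
      (p := fun x => (h (strip G x) : X) ∈ W) (strip G (m, 0)) (by
        intro x₀ hx₀
        have hx : x₀ = (m, 0) := by
          rcases (strip_eq_iff D.loop_eq_iff hG hε _ _).1 hx₀ with hx | ⟨-, hx, -⟩ | ⟨-, hx, -⟩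
          · exact hx
          · exact absurd (congrArg Subtype.val hx) (by norm_num [m])
          · exact absurd (congrArg Subtype.val hx) (by norm_num [m])
        rw [hx]
        have hc : Continuous fun x : I × ℝ => ((x.1 : ℝ), x.2) := by fun_prop
        have hW' := hc.continuousAt.preimage_mem_nhds (x := (m, 0)) hW
        filter_upwards [hW'] with x hxW
        simpa using hxW)
    filter_upwards [hfib] with z hz'
    obtain ⟨x, rfl⟩ := strip_surjective D.loop_surjective hG z
    exact hz' x rfl

/-- A tubular neighbourhood of the closed curve is a cylinder or a Möbius band according to the
parity of the exponent in the gluing. -/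
theorem nonempty_homeomorph_of_isTubularNeighborhood
    (hU : IsTubularNeighborhood D.curve U) :
    (Even a → Nonempty (U ≃ₜ Cylinder)) ∧ (Odd a → Nonempty (U ≃ₜ MoebiusBand)) := by
  obtain ⟨hUo, E, _, _, _, _, _, _, h, hz⟩ := hU
  have h01 : D.loop 0 = D.loop 1 := (D.loop_eq_iff 0 1).2 (Or.inr (Or.inl ⟨rfl, rfl⟩))
  obtain ⟨G, ε, hGc, hG, hε1, hε⟩ := exists_section_along_loop (E := E) D.continuous_loop h01
  have hmon := (isStrip_of_homeomorph hUo h hz hGc hG hε).eq_neg_one_zpow hε1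
  have hproper := isProperMap_strip D.continuous_loop hGc hG
  have hquot : IsQuotientMap (strip G) := hproper.isClosedMap.isQuotientMap hproper.continuous
    (strip_surjective D.loop_surjective hG)
  have hker := strip_eq_iff D.loop_eq_iff hG hε
  constructor
  · intro ha
    rw [hmon, ha.neg_one_zpow] at hker
    exact (nonempty_homeomorph_cylinder hquot hker).map h.symm.trans
  · intro ha
    rw [hmon, ha.neg_one_zpow] at hker
    exact (nonempty_homeomorph_moebiusBand hquot hker).map h.symm.trans

end GluedCharts

/-- The two charts of a smooth projective real toric surface along the divisor of a ray, with the
rays `u`, `v`, `w` in cyclic order: they are glued with exponent `det u w`. -/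
def gluedCharts {Δ : Fan 2} (hs : Δ.IsSmooth) (hp : Δ.IsProjective) {u v w : Fin 2 → ℤ}
    (huv : Δ.Adj u v) (hvw : Δ.Adj v w) : GluedCharts (Points Δ ℝ) (det u w) where
  fst z := hvw.pt z.1 z.2
  snd z := huv.pt z.1 z.2
  isOpenEmbedding_fst := hvw.isOpenEmbedding_pt hs hp
  isOpenEmbedding_snd := huv.isOpenEmbedding_pt hs hp
  glue _ _ hy := Fan.Adj.pt_eq_pt hs hp huv hvw hy
  ne_zero _ _ e := Fan.Adj.ne_zero_of_pt_eq_pt hs huv hvw e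

lemma curve_gluedCharts {Δ : Fan 2} (hs : Δ.IsSmooth) (hp : Δ.IsProjective) {u v w : Fin 2 → ℤ}
    (huv : Δ.Adj u v) (hvw : Δ.Adj v w) :
    (gluedCharts hs hp huv hvw).curve = divisor Δ ℝ v := by
  ext q
  constructor
  · rintro (⟨c, rfl⟩ | ⟨c, rfl⟩)
    · exact (Fan.Adj.pt_mem_divisor_left hs hvw).2 rfl
    · exact (Fan.Adj.pt_mem_divisor_right hs huv).2 rfl
  · intro hq
    exact (exists_pt_of_mem_divisor hs hp.complete huv hvw hq).symm

end Tubular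

end Toric

end

theorem mainTheorem4 (Δ : Toric.Fan 2) (hs : Δ.IsSmooth) (hp : Δ.IsProjective)
    (C : Set (Toric.Points Δ ℂ)) (hC : Toric.IsInvariantCurve Δ C)
    (U : Set (Toric.Points Δ ℝ)) (hU : Toric.IsTubularNeighborhood (Toric.realLocus C) U) :
    (Even (Toric.selfIntersection C) → Nonempty (U ≃ₜ Toric.Cylinder)) ∧
      (Odd (Toric.selfIntersection C) → Nonempty (U ≃ₜ Toric.MoebiusBand)) := by
  obtain ⟨v, hv, rfl⟩ := Toric.IsInvariantCurve.exists_eq_divisor hs hp.complete hC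
  obtain ⟨w, hvw⟩ := hv.exists_adj_right hs hp.complete
  obtain ⟨u, huv⟩ := hv.exists_adj_left hs hp.complete
  have hreal : Toric.realLocus (Toric.divisor Δ ℂ v) =
      (Toric.gluedCharts hs hp huv hvw).curve := by
    rw [Toric.curve_gluedCharts]
    exact Toric.baseChange_preimage_divisor hs _ v
  rw [hreal] at hU
  rw [Toric.selfIntersection_divisor hs hp.complete huv hvw, even_neg, odd_neg]
  exact Toric.GluedCharts.nonempty_homeomorph_of_isTubularNeighborhood hU
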